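/- Let $s>0$, $N_0=[s]+1$ (with $[s]$ the integer part), $\mathcal K_s=(1-\partial_x^2)^{-s/2}$, i.e. the Fourier multiplier with symbol $(1+|\xi|^2)^{-s/2}$, and $\widehat g(\xi)=\frac1{\sqrt{2\pi}}\int_{\mathbb R} g(x)e^{-ix\xi}\,dx$. Write $\langle y\rangle=\sqrt{1+y^2}$, $\|g\|_{H^\sigma}=\|\langle\xi\rangle^\sigma\widehat g\|_{L^2}$ and $\|g\|_{H^{1,1}}=\|\langle x\rangle g\|_{H^1}$. Let $\varphi\in C_0^\infty(\mathbb R)$ be a real function with $\varphi(\xi)=1$ for $|\xi|\le 1$ and $\varphi(\xi)=0$ for $|\xi|>2$. Put $$\Phi(\xi)=\Phi(\xi;x,t)=t^{-1}x\xi+(1+|\xi|^2)^{-s/2}\xi ,$$ $$I_L(t,x,g)=\frac1{\sqrt{2\pi}}\int_{\mathbb R}e^{it\Phi(\xi)}\widehat g(\xi)\,\varphi(2^{10}\xi)\,d\xi,\qquad I_H(t,x,g)=\frac1{\sqrt{2\pi}}\int_{\mathbb R}e^{it\Phi(\xi)}\widehat g(\xi)\,\bigl(1-\varphi(2^{10}\xi)\bigr)\,d\xi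 .$$ **Proposition.** Let $t\ge1$, $x\in\mathbb R$, and let $g$ be a real function (which may depend on $t$) with $$\|\widehat g\|_{L^\infty}+t^{-1/6}\bigl(\|g\|_{H^{1,1}}+\|g\|_{H^{N_0}}\bigr)\le 1 .$$ Then $\widehat g\in L^1$, so that the integrals converge absolutely and the propagator splits as $(e^{t\mathcal K_s\partial_x}g)(x)=I_L(t,x,g)+I_H(t,x,g)$. Moreover: 1. if $s<1+3\cdot2^{18}$, then $|I_L(t,x,g)|\le C\,t^{-1/3}\langle (x+t)/t^{1/3}\rangle^{-1/4}$; 2. if $s\ne1$, then $|I_H(t,x,g)|\le C\,t^{-1/3}$; where $C$ depends only on $s$ and $\varphi$, and not on $t$, $x$, $g$. Consequently, if $s\neq1$, there is a constant $C$ depending only on $s$ such that every real weak solution $u\in C([0,\infty);L^2(\mathbb R))$ of the linear equation $u_t+\mathcal K_su_x=0$, or of $u_t-\mathcal K_su_x=0$, with $u(\cdot,0)=u_0$ satisfies $$\|u(\cdot,t)\|_{L^\infty}\le C\,t^{-1/3}\Bigl[\|u_0\|_{L^1}+t^{-1/6}\bigl(\|u_0\|_{H^{1,1}}+\|u_0\|_{H^{N_0}}\bigr)\Bigr]\qquad\text{for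 all }t\ge1 .$$ (A weak solution of $u_t+\sigma\mathcal K_su_x=0$ satisfies $\frac{d}{dt}\int u\,\theta\,dx=\sigma\int u\,\mathcal K_s\theta'\,dx$ for all $t\ge0$ and all Schwartz functions $\theta$.) -/

import Mathlib

open MeasureTheory Set Filter Topology
open scoped ENNReal ContDiff SchwartzMap FourierTransform

noncomputable section

/-- Japanese bracket `⟨y⟩ = √(1 + y²)`. -/
def japBracket (y : ℝ) : ℝ := Real.sqrt (1 + y ^ 2)

/-- Unitary Fourier transform `ĝ(ξ) = (2π)^{-1/2} ∫ g(x) e^{-ixξ} dx` of a real function. -/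
def hatFT (g : ℝ → ℝ) (ξ : ℝ) : ℂ :=
  ((1 / Real.sqrt (2 * Real.pi) : ℝ) : ℂ) *
    ∫ x : ℝ, Complex.exp (-(Complex.I * x * ξ)) * (g x : ℂ)

/-- The norm `‖f‖_{H^σ} = ‖⟨ξ⟩^σ f̂‖_{L²}` of a real function `f`, equal to `∞` when `f ∉ L²`.
It is written with the Fourier transform of `L²` in the normalization `e^{-2πixη}`, whose frequency
variable is `η = ξ / (2π)`; the change of variables preserves the `L²` norm. -/
def sobolevNorm (σ : ℝ) (f : ℝ → ℝ) : ℝ≥0∞ :=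
  ⨅ hf : MemLp (fun x : ℝ => (f x : ℂ)) 2 (volume : Measure ℝ),
    eLpNorm (fun η : ℝ => ((japBracket (2 * Real.pi * η) ^ σ : ℝ) : ℂ) *
      (𝓕 (hf.toLp (fun x : ℝ => (f x : ℂ))) : Lp ℂ 2 (volume : Measure ℝ)) η) 2 volume

/-- The weighted norm `‖g‖_{H^{1,1}} = ‖⟨x⟩ g‖_{H^1}`. -/
def weightedNorm (g : ℝ → ℝ) : ℝ≥0∞ := sobolevNorm 1 (fun x => japBracket x * g x)

/-- The symbol `(1 + |ξ|²)^{-s/2}` of `K_s = (1 - ∂ₓ²)^{-s/2}`. -/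
def besselSymbol (s ξ : ℝ) : ℝ := (1 + |ξ| ^ 2) ^ (-s / 2)

/-- The phase `Φ(ξ; x, t) = t⁻¹ x ξ + (1 + |ξ|²)^{-s/2} ξ`. -/
def phase (s x t ξ : ℝ) : ℝ := t⁻¹ * x * ξ + besselSymbol s ξ * ξ

/-- `e^{t K_s ∂ₓ} g`, the Fourier multiplier with symbol `e^{i t ξ (1 + |ξ|²)^{-s/2}}`. -/
def propagator (s t : ℝ) (g : ℝ → ℝ) (x : ℝ) : ℂ :=
  ((1 / Real.sqrt (2 * Real.pi) : ℝ) : ℂ) *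
    ∫ ξ : ℝ, Complex.exp (Complex.I * x * ξ) *
      (Complex.exp (Complex.I * t * ξ * (besselSymbol s ξ : ℝ)) * hatFT g ξ)

/-- A smooth cutoff, equal to `1` for `|ξ| ≤ 1` and to `0` for `|ξ| > 2`. -/
structure IsCutoff (φ : ℝ → ℝ) : Prop where
  smooth : ContDiff ℝ ∞ φ
  eq_one : ∀ ξ : ℝ, |ξ| ≤ 1 → φ ξ = 1
  eq_zero : ∀ ξ : ℝ, 2 < |ξ| → φ ξ = 0

/-- The low-frequency part of the propagator. -/
def lowInt (φ : ℝ → ℝ) (s t x : ℝ) (g : ℝ → ℝ) : ℂ :=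
  ((1 / Real.sqrt (2 * Real.pi) : ℝ) : ℂ) *
    ∫ ξ : ℝ, Complex.exp (Complex.I * t * (phase s x t ξ : ℝ)) * hatFT g ξ *
      ((φ (2 ^ 10 * ξ) : ℝ) : ℂ)

/-- The high-frequency part of the propagator. -/
def highInt (φ : ℝ → ℝ) (s t x : ℝ) (g : ℝ → ℝ) : ℂ :=
  ((1 / Real.sqrt (2 * Real.pi) : ℝ) : ℂ) *
    ∫ ξ : ℝ, Complex.exp (Complex.I * t * (phase s x t ξ : ℝ)) * hatFT g ξ *
      ((1 - φ (2 ^ 10 * ξ) : ℝ) : ℂ)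

/-- `N₀ = [s] + 1`. -/
def sobolevIndex (s : ℝ) : ℕ := ⌊s⌋₊ + 1

/-- `‖ĝ‖_{L^∞} + t^{-1/6} (‖g‖_{H^{1,1}} + ‖g‖_{H^{N₀}}) ≤ 1`. -/
def SmallProfile (s t : ℝ) (g : ℝ → ℝ) : Prop :=
  eLpNorm (hatFT g) ∞ volume +
    ENNReal.ofReal (t ^ (-(1 : ℝ) / 6)) *
      (weightedNorm g + sobolevNorm (sobolevIndex s : ℝ) g) ≤ 1

/-- `K_s = (1 - ∂ₓ²)^{-s/2}` on Schwartz functions (Mathlib's frequency variable is `ξ / (2π)`). -/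
def besselOp (s : ℝ) : 𝓢(ℝ, ℂ) →L[ℂ] 𝓢(ℝ, ℂ) :=
  SchwartzMap.fourierMultiplierCLM ℂ
    (fun η : ℝ => ((besselSymbol s (2 * Real.pi * η) : ℝ) : ℂ))

/-- `u ∈ C([0,∞); L²(ℝ))` is a real weak solution of `u_t + σ K_s u_x = 0`, `u(·, 0) = u₀`: against
every Schwartz function `θ`, `d/dt ∫ u θ dx = σ ∫ u K_s θ' dx` for `t ≥ 0`. -/
structure IsLinearSolution (σ s : ℝ) (u₀ : ℝ → ℝ)
    (u : ℝ → Lp ℝ 2 (volume : Measure ℝ)) : Prop where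
  continuousOn : ContinuousOn u (Ici 0)
  initial : u 0 =ᵐ[volume] u₀
  weak : ∀ θ : 𝓢(ℝ, ℂ), ∀ t : ℝ, 0 ≤ t →
    HasDerivWithinAt (fun τ : ℝ => ∫ x : ℝ, ((u τ x : ℝ) : ℂ) * θ x)
      ((σ : ℂ) * ∫ x : ℝ, ((u t x : ℝ) : ℂ) * besselOp s (SchwartzMap.derivCLM ℂ ℂ θ) x)
      (Ici 0) t

end

/-! Write p(ξ) = ξ(1+ξ²)^{-s/2}, so that tΦ(ξ) = t p(ξ) + xξ. Everything is a van der Corput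
estimate for ∫ e^{itΦ} f, where f is ĝ or ĝ times a cutoff. The hypotheses on g become |f| ≤ A,
‖⟨ξ⟩^N f‖_{L²} ≤ B and ‖⟨ξ⟩ f'‖_{L²} ≤ B with N = N₀ > s and B = A t^{1/6} (`AmplitudeBound`,
`exists_amplitudeBound_hatFT`). Since f' is only square integrable, the second derivative test takes
the form A κ^{-1/2} + B κ^{-3/4} when |tΦ''| ≥ κ; its companion √(LD/κ) uses only the L² norms L of
f and D of f'.

On ξ ≥ 0, p'' vanishes simply at 0 and, if s > 1, at x₀ = √(3/(s-1)). Intervals of length of order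
t^{-1/3} around these points are estimated trivially. Elsewhere on a bounded range κ is of order
t·t^{-1/3} = t^{2/3}, and both terms of the test are of order A t^{-1/3}. For large ξ, |p''| is at
least of order ξ^{-s-1}, provided s ≠ 1 (for s = 1 it decays like ξ^{-s-3}). The L² test on a dyadic
block [R, 2R] then gives B t^{-1/2} R^{(s-N)/2}, which is summable because N > s. This yields
t^{-1/3} on the whole line (`exists_norm_integral_dispersion_le`), hence the bound for I_H.

For I_L the amplitude lives in |ξ| ≤ 2⁻⁹, and s < 1 + 3·2¹⁸ keeps x₀ outside that interval. As p'(0)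
= 1, tΦ' = (x+t) + O(tξ²). With X = (x+t)/t^{1/3}, the phase has no stationary point for |ξ| up to a
small multiple of t^{-1/3}|X|^{1/2} when |X| ≥ 1; beyond, κ is at least of order t^{2/3}|X|^{1/2},
and κ^{-1/2} produces the factor ⟨X⟩^{-1/4} (`exists_norm_integral_low_le`).

For the linear equation, the pairing of a weak solution with the backward flow of a Schwartz
function is constant in time (`IsLinearSolution.integral_mul_eq`). This identifies u(t) almost
everywhere with an explicit Fourier integral, to which the whole-line bound applies; ‖û₀‖_∞ ≤
‖u₀‖_{L¹} supplies A. -/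

/-! ### Integration by parts and functions with an L² derivative. -/

/-- Here f is only absolutely continuous. Insert f(x) - f(a) = ∫_a^x f' and exchange the integrals
over the triangle η ≤ x; the inner integral of G' becomes G(b) - G(η). -/
theorem intervalIntegral_deriv_mul_of_primitive {a b : ℝ} {f f' G G' : ℝ → ℂ} (hab : a ≤ b)
    (hf : ∀ x ∈ Icc a b, f x = f a + ∫ η in a..x, f' η)
    (hf' : IntervalIntegrable f' volume a b)
    (hG : ∀ x ∈ Icc a b, HasDerivAt G (G' x) x) (hG' : ContinuousOn G' (Icc a b)) :
    ∫ x in a..b, G' x * f x = G b * f b - G a * f a - ∫ x in a..b, G x * f' x := by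
  have hGc : ContinuousOn G (Icc a b) := fun x hx => (hG x hx).continuousAt.continuousWithinAt
  have hG'i : IntervalIntegrable G' volume a b := by
    apply ContinuousOn.intervalIntegrable; rwa [uIcc_of_le hab]
  have hsub : ∀ x ∈ Icc a b, ∀ y ∈ Icc a b, uIcc x y ⊆ Icc a b := by
    intro x hx y hy
    rw [← uIcc_of_le hab] at *
    exact uIcc_subset_uIcc hx hy
  have hb : b ∈ Icc a b := right_mem_Icc.2 hab
  have ha : a ∈ Icc a b := left_mem_Icc.2 hab
  have hFTC : ∀ x ∈ Icc a b, ∫ y in x..b, G' y = G b - G x := by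
    intro x hx
    apply intervalIntegral.integral_eq_sub_of_hasDerivAt
    · intro y hy; exact hG y (hsub x hx b hb hy)
    · apply ContinuousOn.intervalIntegrable
      exact hG'.mono (hsub x hx b hb)
  set μ := volume.restrict (Ioc a b) with hμ
  have h1 : Integrable f' μ := by
    rwa [intervalIntegrable_iff_integrableOn_Ioc_of_le hab] at hf'
  have h2 : Integrable G' μ := by
    rwa [intervalIntegrable_iff_integrableOn_Ioc_of_le hab] at hG'i
  have hprod : Integrable (fun q : ℝ × ℝ => {q : ℝ × ℝ | q.2 ≤ q.1}.indicator
      (fun q => G' q.1 * f' q.2) q) (μ.prod μ) :=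
    (h2.mul_prod h1).indicator (measurableSet_le measurable_snd measurable_fst)
  have hswap := integral_integral_swap (μ := μ) (ν := μ)
    (f := fun x η => {q : ℝ × ℝ | q.2 ≤ q.1}.indicator (fun q => G' q.1 * f' q.2) (x, η)) hprod
  have hL : ∫ x, ∫ η, {q : ℝ × ℝ | q.2 ≤ q.1}.indicator (fun q => G' q.1 * f' q.2) (x, η) ∂μ ∂μ
      = ∫ x in a..b, G' x * (f x - f a) := by
    rw [intervalIntegral.integral_of_le hab]
    apply setIntegral_congr_fun measurableSet_Ioc
    intro x hx
    have hxI : x ∈ Icc a b := Ioc_subset_Icc_self hx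
    have e : (fun η => {q : ℝ × ℝ | q.2 ≤ q.1}.indicator (fun q => G' q.1 * f' q.2) (x, η))
        = (Iic x).indicator (fun η => G' x * f' η) := by
      funext η; simp [indicator]
    simp only
    rw [e, integral_indicator measurableSet_Iic, hμ, Measure.restrict_restrict measurableSet_Iic,
      integral_const_mul, hf x hxI, intervalIntegral.integral_of_le hx.1.le]
    have : Iic x ∩ Ioc a b = Ioc a x := by
      ext y; simp only [mem_inter_iff, mem_Iic, mem_Ioc]
      constructor
      · rintro ⟨h, h', -⟩; exact ⟨h', h⟩
      · rintro ⟨h, h'⟩; exact ⟨h', h, h'.trans hx.2⟩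
    rw [this, add_sub_cancel_left]
  have hR : ∫ η, ∫ x, {q : ℝ × ℝ | q.2 ≤ q.1}.indicator (fun q => G' q.1 * f' q.2) (x, η) ∂μ ∂μ
      = ∫ η in a..b, (G b - G η) * f' η := by
    rw [intervalIntegral.integral_of_le hab]
    apply setIntegral_congr_fun measurableSet_Ioc
    intro x hx
    have hxI : x ∈ Icc a b := Ioc_subset_Icc_self hx
    have e : (fun y => {q : ℝ × ℝ | q.2 ≤ q.1}.indicator (fun q => G' q.1 * f' q.2) (y, x))
        = (Ici x).indicator (fun y => G' y * f' x) := by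
      funext η; simp [indicator]
    simp only
    rw [e, integral_indicator measurableSet_Ici, hμ, Measure.restrict_restrict measurableSet_Ici,
      integral_mul_const, ← hFTC x hxI, intervalIntegral.integral_of_le hx.2]
    congr 1
    have : Ici x ∩ Ioc a b = Icc x b := by
      ext y; simp only [mem_inter_iff, mem_Ici, mem_Ioc, mem_Icc]
      constructor
      · rintro ⟨h, h', h''⟩; exact ⟨h, h''⟩
      · rintro ⟨h, h'⟩; exact ⟨h, hx.1.trans_le h, h'⟩
    rw [this, integral_Icc_eq_integral_Ioc]
  rw [hL, hR] at hswap
  have hfc : ContinuousOn f (Icc a b) := by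
    have : ContinuousOn (fun x => f a + ∫ η in a..x, f' η) (Icc a b) :=
      continuousOn_const.add (by
        have := intervalIntegral.continuousOn_primitive_interval' hf' left_mem_uIcc
        rwa [uIcc_of_le hab] at this)
    exact this.congr hf
  have i1 : IntervalIntegrable (fun x => G' x * f x) volume a b := by
    apply ContinuousOn.intervalIntegrable; rw [uIcc_of_le hab]; exact hG'.mul hfc
  have i2 : IntervalIntegrable (fun x => G x * f' x) volume a b :=
    hf'.continuousOn_mul (by rwa [uIcc_of_le hab])
  have e1 : ∫ x in a..b, G' x * (f x - f a) = (∫ x in a..b, G' x * f x) - (G b - G a) * f a := by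
    simp_rw [mul_sub]
    rw [intervalIntegral.integral_sub i1 (hG'i.mul_const _), intervalIntegral.integral_mul_const,
      hFTC a ha]
  have e2 : ∫ η in a..b, (G b - G η) * f' η
      = G b * (f b - f a) - ∫ x in a..b, G x * f' x := by
    simp_rw [sub_mul]
    rw [intervalIntegral.integral_sub (hf'.const_mul _) i2, intervalIntegral.integral_const_mul,
      hf b hb]
    ring
  rw [e1, e2] at hswap
  linear_combination hswap

/-- `f` is locally absolutely continuous with square-integrable derivative `f'`. -/
structure HasL2Deriv (f f' : ℝ → ℂ) : Prop where
  memLp : MemLp f' 2 volume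
  sub_eq : ∀ x y : ℝ, f y - f x = ∫ η in x..y, f' η

namespace HasL2Deriv

variable {f f' : ℝ → ℂ}

theorem intervalIntegrable (h : HasL2Deriv f f') (a b : ℝ) : IntervalIntegrable f' volume a b :=
  ((h.memLp.locallyIntegrable (by norm_num)).integrableOn_isCompact isCompact_uIcc).intervalIntegrable

theorem eq_add (h : HasL2Deriv f f') (a x : ℝ) : f x = f a + ∫ η in a..x, f' η := by
  rw [← h.sub_eq]; ring

theorem continuous (h : HasL2Deriv f f') : Continuous f := by
  have : f = fun x => f 0 + ∫ η in (0 : ℝ)..x, f' η := funext fun x => h.eq_add 0 x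
  rw [this]
  exact continuous_const.add
    (intervalIntegral.continuous_primitive (fun a b => h.intervalIntegrable a b) 0)

theorem integrable_sq (h : HasL2Deriv f f') : Integrable (fun x => ‖f' x‖ ^ 2) volume :=
  h.memLp.integrable_norm_pow (by norm_num)

theorem intervalIntegrable_sq (h : HasL2Deriv f f') (a b : ℝ) :
    IntervalIntegrable (fun x => ‖f' x‖ ^ 2) volume a b := h.integrable_sq.intervalIntegrable

theorem comp_neg (h : HasL2Deriv f f') : HasL2Deriv (fun x => f (-x)) (fun x => -f' (-x)) where
  memLp := (h.memLp.comp_measurePreserving (Measure.measurePreserving_neg volume)).neg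
  sub_eq x y := by
    rw [intervalIntegral.integral_neg, intervalIntegral.integral_comp_neg, h.sub_eq,
      intervalIntegral.integral_symm]

theorem conj (h : HasL2Deriv f f') :
    HasL2Deriv (fun x => (starRingEnd ℂ) (f x)) (fun x => (starRingEnd ℂ) (f' x)) where
  memLp := h.memLp.star
  sub_eq x y := by
    rw [intervalIntegral.intervalIntegral_eq_integral_uIoc, integral_conj, ← map_sub, h.sub_eq,
      intervalIntegral.intervalIntegral_eq_integral_uIoc]
    split_ifs <;> simp

theorem mul {m m' : ℝ → ℂ} (h : HasL2Deriv f f') (hm : ∀ x, HasDerivAt m (m' x) x)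
    (hm' : Continuous m') (h2 : MemLp (fun x => m x * f' x + m' x * f x) 2 volume) :
    HasL2Deriv (fun x => m x * f x) (fun x => m x * f' x + m' x * f x) where
  memLp := h2
  sub_eq := by
    have hmc : Continuous m := continuous_iff_continuousAt.2 fun x => (hm x).continuousAt
    have key : ∀ x y : ℝ, x ≤ y →
        m y * f y - m x * f x = ∫ η in x..y, (m η * f' η + m' η * f η) := by
      intro x y hxy
      have := intervalIntegral_deriv_mul_of_primitive hxy (fun z _ => h.eq_add x z)
        (h.intervalIntegrable x y) (fun z _ => hm z) hm'.continuousOn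
      have i2 : IntervalIntegrable (fun z => m' z * f z) volume x y :=
        (hm'.mul h.continuous).intervalIntegrable x y
      rw [intervalIntegral.integral_add
        ((h.intervalIntegrable x y).continuousOn_mul hmc.continuousOn) i2, this]
      ring
    intro x y
    rcases le_total x y with hxy | hxy
    · exact key x y hxy
    · rw [intervalIntegral.integral_symm, ← key y x hxy]; ring

end HasL2Deriv

/-! ### Oscillatory integrals with amplitudes whose derivative is in L². -/

theorem intervalIntegral_mul_le_of_sq_le {a b U V : ℝ} (hab : a ≤ b) {u v : ℝ → ℝ}
    (hu : MemLp u 2 (volume.restrict (Ioc a b))) (hv : MemLp v 2 (volume.restrict (Ioc a b)))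
    (hu0 : ∀ x ∈ Ioc a b, 0 ≤ u x) (hv0 : ∀ x ∈ Ioc a b, 0 ≤ v x) (hU : 0 ≤ U) (hV : 0 ≤ V)
    (hUU : ∫ x in a..b, u x ^ 2 ≤ U ^ 2) (hVV : ∫ x in a..b, v x ^ 2 ≤ V ^ 2) :
    ∫ x in a..b, u x * v x ≤ U * V := by
  rw [intervalIntegral.integral_of_le hab] at *
  have := integral_mul_le_Lp_mul_Lq_of_nonneg (μ := volume.restrict (Ioc a b)) (f := u) (g := v)
    Real.HolderConjugate.two_two
    ((ae_restrict_iff' measurableSet_Ioc).2 (Eventually.of_forall hu0))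
    ((ae_restrict_iff' measurableSet_Ioc).2 (Eventually.of_forall hv0))
    (by simpa using hu) (by simpa using hv)
  refine this.trans ?_
  simp only [Real.rpow_two]
  rw [← Real.sqrt_eq_rpow, ← Real.sqrt_eq_rpow]
  exact mul_le_mul (Real.sqrt_le_iff.2 ⟨hU, hUU⟩) (Real.sqrt_le_iff.2 ⟨hV, hVV⟩)
    (Real.sqrt_nonneg _) hU

/-- Non-stationary phase on an interval where `|Φ'| ≥ μ` and `Φ''` has one sign. -/
theorem norm_integral_exp_mul_le_of_le_abs_deriv {a b μ M : ℝ} (hab : a ≤ b) {Φ Φ₁ Φ₂ : ℝ → ℝ}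
    (h1 : ∀ x ∈ Icc a b, HasDerivAt Φ (Φ₁ x) x) (h2 : ∀ x ∈ Icc a b, HasDerivAt Φ₁ (Φ₂ x) x)
    (hc : ContinuousOn Φ₂ (Icc a b))
    (hsign : (∀ x ∈ Icc a b, 0 ≤ Φ₂ x) ∨ (∀ x ∈ Icc a b, Φ₂ x ≤ 0))
    (hμ : 0 < μ) (hΦ : ∀ x ∈ Icc a b, μ ≤ |Φ₁ x|) {f f' : ℝ → ℂ} (hf : HasL2Deriv f f')
    (hM : ∀ x ∈ Icc a b, ‖f x‖ ≤ M) :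
    ‖∫ x in a..b, Complex.exp (Complex.I * (Φ x : ℝ)) * f x‖ ≤
      4 * M / μ + ∫ x in a..b, ‖f' x‖ / |Φ₁ x| := by
  have hne : ∀ x ∈ Icc a b, Φ₁ x ≠ 0 := fun x hx h => by
    have := hΦ x hx; rw [h, abs_zero] at this; linarith
  have ha : a ∈ Icc a b := left_mem_Icc.2 hab
  have hb : b ∈ Icc a b := right_mem_Icc.2 hab
  have hM0 : 0 ≤ M := (norm_nonneg _).trans (hM a ha)
  have hIoc : ∀ x ∈ Ioc a b, x ∈ Icc a b := fun x hx => Ioc_subset_Icc_self hx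
  have c0 : ContinuousOn (fun x => Complex.exp (Complex.I * (Φ x : ℝ))) (Icc a b) := by
    have : ContinuousOn Φ (Icc a b) := fun x hx => (h1 x hx).continuousAt.continuousWithinAt
    fun_prop
  have c1 : ContinuousOn Φ₁ (Icc a b) := fun x hx => (h2 x hx).continuousAt.continuousWithinAt
  -- The usual integration by parts: e^{iΦ} = G' + E with G = e^{iΦ}/(iΦ') and E = e^{iΦ}Φ''/(iΦ'²).
  set G : ℝ → ℂ := fun x => Complex.exp (Complex.I * (Φ x : ℝ)) * (Complex.I * (Φ₁ x : ℝ))⁻¹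
  set E : ℝ → ℂ := fun x =>
    Complex.exp (Complex.I * (Φ x : ℝ)) * ((Φ₂ x : ℂ) / (Complex.I * (Φ₁ x : ℂ) ^ 2))
  set G' : ℝ → ℂ := fun x => Complex.exp (Complex.I * (Φ x : ℝ)) - E x
  have hG : ∀ x ∈ Icc a b, HasDerivAt G (G' x) x := by
    intro x hx
    have d1 : HasDerivAt (fun x => Complex.exp (Complex.I * (Φ x : ℝ)))
        (Complex.exp (Complex.I * (Φ x : ℝ)) * (Complex.I * (Φ₁ x : ℝ))) x :=
      (((h1 x hx).ofReal_comp).const_mul Complex.I).cexp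
    have hne' : Complex.I * (Φ₁ x : ℂ) ≠ 0 :=
      mul_ne_zero Complex.I_ne_zero (by exact_mod_cast hne x hx)
    have d2 := (((h2 x hx).ofReal_comp).const_mul Complex.I).inv hne'
    convert! d1.mul d2 using 1
    simp only [G', E, Pi.inv_apply]
    have h' : (Φ₁ x : ℂ) ≠ 0 := by exact_mod_cast hne x hx
    field_simp
    ring
  have cE : ContinuousOn E (Icc a b) := by
    refine c0.mul (ContinuousOn.div (by fun_prop) (by fun_prop) ?_)
    intro x hx
    exact mul_ne_zero Complex.I_ne_zero (pow_ne_zero _ (by exact_mod_cast hne x hx))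
  have cG' : ContinuousOn G' (Icc a b) := c0.sub cE
  have hIBP := intervalIntegral_deriv_mul_of_primitive hab (fun x _ => hf.eq_add a x)
    (hf.intervalIntegrable a b) hG cG'
  have fc := hf.continuous
  have hsplit : ∫ x in a..b, Complex.exp (Complex.I * (Φ x : ℝ)) * f x =
      (G b * f b - G a * f a - ∫ x in a..b, G x * f' x) + ∫ x in a..b, E x * f x := by
    rw [← hIBP, ← intervalIntegral.integral_add]
    · congr 1; ext x; simp only [G']; ring
    · apply ContinuousOn.intervalIntegrable; rw [uIcc_of_le hab]; exact cG'.mul fc.continuousOn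
    · apply ContinuousOn.intervalIntegrable; rw [uIcc_of_le hab]; exact cE.mul fc.continuousOn
  have hnorm : ∀ x, ‖Complex.exp (Complex.I * (Φ x : ℝ))‖ = 1 := by
    intro x; rw [mul_comm]; exact Complex.norm_exp_ofReal_mul_I _
  have nG : ∀ x, ‖G x‖ = 1 / |Φ₁ x| := by
    intro x; simp [G, hnorm]
  have nE : ∀ x, ‖E x‖ = |Φ₂ x| / Φ₁ x ^ 2 := by
    intro x; simp [E, hnorm]
  have bG : ∀ x ∈ Icc a b, ‖G x * f x‖ ≤ M / μ := by
    intro x hx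
    rw [norm_mul, nG, div_mul_eq_mul_div, one_mul]
    exact div_le_div₀ hM0 (hM x hx) hμ (hΦ x hx)
  have b3 : ‖∫ x in a..b, G x * f' x‖ ≤ ∫ x in a..b, ‖f' x‖ / |Φ₁ x| := by
    refine (intervalIntegral.norm_integral_le_integral_norm hab).trans (le_of_eq ?_)
    congr 1; ext x; rw [norm_mul, nG]; ring
  have cq : ContinuousOn (fun x => Φ₂ x / Φ₁ x ^ 2) (Icc a b) :=
    hc.div (c1.pow 2) fun x hx => pow_ne_zero _ (hne x hx)
  have iq : IntervalIntegrable (fun x => Φ₂ x / Φ₁ x ^ 2) volume a b := by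
    apply ContinuousOn.intervalIntegrable; rwa [uIcc_of_le hab]
  have hq : ∫ x in a..b, Φ₂ x / Φ₁ x ^ 2 = (Φ₁ a)⁻¹ - (Φ₁ b)⁻¹ := by
    have := intervalIntegral.integral_eq_sub_of_hasDerivAt (f := fun x => -(Φ₁ x)⁻¹)
      (f' := fun x => Φ₂ x / Φ₁ x ^ 2) (a := a) (b := b) ?_ iq
    · rw [this]; ring
    · intro x hx
      rw [uIcc_of_le hab] at hx
      convert! ((h2 x hx).inv (hne x hx)).neg using 1
      ring
  have hinv : ∀ x ∈ Icc a b, |(Φ₁ x)⁻¹| ≤ 1 / μ := by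
    intro x hx; rw [abs_inv, ← one_div]; exact one_div_le_one_div_of_le hμ (hΦ x hx)
  -- Because Φ'' keeps its sign, |Φ''|/Φ'² is up to sign the derivative of 1/Φ', so its integral is
  -- a difference of boundary values. With the two boundary terms of G f this makes 4M/μ.
  have habs : ∫ x in a..b, |Φ₂ x| / Φ₁ x ^ 2 ≤ 2 / μ := by
    have hq' : |∫ x in a..b, Φ₂ x / Φ₁ x ^ 2| ≤ 2 / μ := by
      rw [hq]
      refine (abs_sub _ _).trans ((add_le_add (hinv a ha) (hinv b hb)).trans (le_of_eq ?_))
      ring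
    rcases hsign with hs | hs
    · refine le_trans (le_of_eq ?_) ((le_abs_self _).trans hq')
      apply intervalIntegral.integral_congr
      intro x hx
      rw [uIcc_of_le hab] at hx
      simp only [abs_of_nonneg (hs x hx)]
    · refine le_trans (le_of_eq ?_) ((neg_le_abs _).trans hq')
      rw [← intervalIntegral.integral_neg]
      apply intervalIntegral.integral_congr
      intro x hx
      rw [uIcc_of_le hab] at hx
      simp only [abs_of_nonpos (hs x hx)]; ring
  have b4 : ‖∫ x in a..b, E x * f x‖ ≤ M * (2 / μ) := by
    have : ∀ x ∈ Ioc a b, ‖E x * f x‖ ≤ M * (|Φ₂ x| / Φ₁ x ^ 2) := by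
      intro x hx
      rw [norm_mul, nE, mul_comm]
      exact mul_le_mul_of_nonneg_right (hM x (hIoc x hx)) (by positivity)
    refine (intervalIntegral.norm_integral_le_of_norm_le hab
      (Eventually.of_forall this) ?_).trans ?_
    · apply ContinuousOn.intervalIntegrable; rw [uIcc_of_le hab]
      exact continuousOn_const.mul ((hc.abs).div (c1.pow 2) fun x hx => pow_ne_zero _ (hne x hx))
    · rw [intervalIntegral.integral_const_mul]
      exact mul_le_mul_of_nonneg_left habs hM0
  rw [hsplit]
  calc _ ≤ ‖G b * f b‖ + ‖G a * f a‖ + ‖∫ x in a..b, G x * f' x‖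
        + ‖∫ x in a..b, E x * f x‖ := by
        refine (norm_add_le _ _).trans (add_le_add_left ?_ _)
        refine (norm_sub_le _ _).trans (add_le_add_left ?_ _)
        exact norm_sub_le _ _
    _ ≤ M / μ + M / μ + (∫ x in a..b, ‖f' x‖ / |Φ₁ x|) + M * (2 / μ) := by
        gcongr
        · exact bG b hb
        · exact bG a ha
    _ = _ := by ring

/-- A `C²` phase with its first two derivatives. -/
structure IsPhase (Φ Φ₁ Φ₂ : ℝ → ℝ) : Prop where
  deriv_one : ∀ x, HasDerivAt Φ (Φ₁ x) x
  deriv_two : ∀ x, HasDerivAt Φ₁ (Φ₂ x) x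
  cont : Continuous Φ₂

theorem ContinuousOn.memLp_two_Ioc {E : Type*} [NormedAddCommGroup E] {a b : ℝ} {u : ℝ → E}
    (hu : ContinuousOn u (Icc a b)) : MemLp u 2 (volume.restrict (Ioc a b)) := by
  rw [Measure.restrict_congr_set Ioc_ae_eq_Icc,
    memLp_two_iff_integrable_sq_norm (hu.aestronglyMeasurable measurableSet_Icc)]
  exact (hu.norm.pow 2).integrableOn_Icc

theorem intervalIntegral_norm_le_sqrt_mul {E : Type*} [NormedAddCommGroup E] {a b G : ℝ}
    (hab : a ≤ b) {g : ℝ → E} (hg : MemLp g 2 (volume.restrict (Ioc a b))) (hG : 0 ≤ G)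
    (h : ∫ x in a..b, ‖g x‖ ^ 2 ≤ G ^ 2) : ∫ x in a..b, ‖g x‖ ≤ √(b - a) * G := by
  have := intervalIntegral_mul_le_of_sq_le hab (u := fun _ => 1) (v := fun x => ‖g x‖)
    (U := √(b - a)) (V := G) continuousOn_const.memLp_two_Ioc hg.norm (by simp) (by simp)
    (by positivity) hG (by simp [Real.sq_sqrt (sub_nonneg.2 hab)]) h
  simpa using this

/-- Interpolation of the sup norm between L² norms. On a subinterval of length l around x, |f(x)| is
at most the mean of |f|, bounded by L/√l, plus an oscillation of at most √l·D. The choice l = L/D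
makes both equal to √(LD); the length condition ensures that such a subinterval fits. -/
theorem HasL2Deriv.norm_le_two_mul_sqrt {f f' : ℝ → ℂ} (hf : HasL2Deriv f f') {a b L D : ℝ}
    (hL0 : 0 < L) (hD0 : 0 < D) (hlen : L / D ≤ b - a)
    (hL : ∫ x in a..b, ‖f x‖ ^ 2 ≤ L ^ 2) (hD : ∫ x in a..b, ‖f' x‖ ^ 2 ≤ D ^ 2) :
    ∀ x ∈ Icc a b, ‖f x‖ ≤ 2 * √(L * D) := by
  intro x hx
  set l := L / D with hl
  have hl0 : 0 < l := by positivity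
  obtain ⟨p, q, hap, hpx, hxq, hqb, hpq⟩ :
      ∃ p q, a ≤ p ∧ p ≤ x ∧ x ≤ q ∧ q ≤ b ∧ q - p = l := by
    -- The subinterval starts at x, unless it would then pass b; in that case it ends at b.
    refine ⟨min x (b - l), min x (b - l) + l, le_min hx.1 (by linarith), min_le_left _ _, ?_, ?_,
      by ring⟩
    · rcases le_total x (b - l) with h | h
      · rw [min_eq_left h]; linarith
      · rw [min_eq_right h]; linarith [hx.2]
    · linarith [min_le_right x (b - l)]
  have hpq' : p ≤ q := hpx.trans hxq
  have mono : ∀ {u : ℝ → ℂ} {p' q' U : ℝ}, p ≤ p' → p' ≤ q' → q' ≤ q →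
      IntervalIntegrable (fun x => ‖u x‖ ^ 2) volume a b →
      ∫ x in a..b, ‖u x‖ ^ 2 ≤ U → ∫ x in p'..q', ‖u x‖ ^ 2 ≤ U := by
    intro u p' q' U h1 h2 h3 hi hU
    exact (intervalIntegral.integral_mono_interval (hap.trans h1) h2 (h3.trans hqb)
      (Eventually.of_forall fun x => by positivity) hi).trans hU
  have key : ∀ y ∈ Icc p q, ‖f x‖ ≤ ‖f y‖ + √l * D := by
    have aux : ∀ p' q', p ≤ p' → p' ≤ q' → q' ≤ q → ‖f q' - f p'‖ ≤ √l * D := by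
      intro p' q' h1 h2 h3
      rw [hf.sub_eq]
      refine (intervalIntegral.norm_integral_le_integral_norm h2).trans ?_
      refine (intervalIntegral_norm_le_sqrt_mul h2 (hf.memLp.restrict _) hD0.le
        (mono h1 h2 h3 (hf.intervalIntegrable_sq a b) hD)).trans ?_
      gcongr
      linarith
    intro y hy
    have : ‖f x - f y‖ ≤ √l * D := by
      rcases le_total y x with h | h
      · exact aux y x hy.1 h hxq
      · rw [norm_sub_rev]; exact aux x y hpx h hy.2
    have h2 := norm_sub_norm_le (f x) (f y)
    linarith
  have h1 : l * ‖f x‖ ≤ √l * L + l * (√l * D) := by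
    calc l * ‖f x‖ = ∫ _ in p..q, ‖f x‖ := by simp [hpq]
      _ ≤ ∫ y in p..q, (‖f y‖ + √l * D) :=
        intervalIntegral.integral_mono_on hpq' (by simp)
          ((hf.continuous.norm.add continuous_const).intervalIntegrable _ _) key
      _ = (∫ y in p..q, ‖f y‖) + l * (√l * D) := by
        rw [intervalIntegral.integral_add (hf.continuous.norm.intervalIntegrable _ _) (by simp)]
        simp [hpq]; ring
      _ ≤ _ := by
        gcongr
        have := intervalIntegral_norm_le_sqrt_mul hpq'
          hf.continuous.continuousOn.memLp_two_Ioc hL0.le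
          (mono le_rfl hpq' le_rfl ((hf.continuous.norm.pow 2).intervalIntegrable a b) hL)
        rwa [hpq] at this
  have hs : √l * √l = l := Real.mul_self_sqrt hl0.le
  have e1 : √l * D = √(L * D) := by
    have : L * D = l * D ^ 2 := by rw [hl]; field_simp
    rw [this, Real.sqrt_mul hl0.le, Real.sqrt_sq hD0.le]
  have e2 : √l * L = l * √(L * D) := by
    rw [← e1]
    have : L = l * D := by rw [hl]; field_simp
    linear_combination √l * this
  rw [e2, e1] at h1
  nlinarith

namespace IsPhase

variable {Φ Φ₁ Φ₂ : ℝ → ℝ} {f f' : ℝ → ℂ}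

theorem neg (h : IsPhase Φ Φ₁ Φ₂) :
    IsPhase (fun x => -Φ x) (fun x => -Φ₁ x) (fun x => -Φ₂ x) where
  deriv_one x := (h.deriv_one x).neg
  deriv_two x := (h.deriv_two x).neg
  cont := h.cont.neg

theorem continuous (h : IsPhase Φ Φ₁ Φ₂) : Continuous Φ :=
  continuous_iff_continuousAt.2 fun x => (h.deriv_one x).continuousAt

theorem continuous_deriv (h : IsPhase Φ Φ₁ Φ₂) : Continuous Φ₁ :=
  continuous_iff_continuousAt.2 fun x => (h.deriv_two x).continuousAt

theorem norm_exp (x : ℝ) : ‖Complex.exp (Complex.I * (x : ℂ))‖ = 1 := by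
  rw [mul_comm]; exact Complex.norm_exp_ofReal_mul_I _

theorem continuous_exp_mul (h : IsPhase Φ Φ₁ Φ₂) (hf : Continuous f) :
    Continuous fun x => Complex.exp (Complex.I * (Φ x : ℝ)) * f x := by
  have := h.continuous
  fun_prop

/-- At distance δ from c the function 1/|x - c| has L² norm at most δ^{-1/2}, so Cauchy–Schwarz
controls ∫ |f'|/|Φ'| by the L² norm of f'. -/
theorem norm_integral_exp_mul_le_of_mul_abs_sub_le (h : IsPhase Φ Φ₁ Φ₂) (hf : HasL2Deriv f f')
    {a b c δ κ M D : ℝ} (hab : a ≤ b) (hδ : 0 < δ) (hκ : 0 < κ) (hc : c + δ ≤ a ∨ b ≤ c - δ)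
    (hΦ : ∀ x ∈ Icc a b, κ * |x - c| ≤ |Φ₁ x|) (hsign : ∀ x ∈ Icc a b, 0 ≤ Φ₂ x)
    (hM : ∀ x ∈ Icc a b, ‖f x‖ ≤ M) (hD0 : 0 ≤ D) (hD : ∫ x in a..b, ‖f' x‖ ^ 2 ≤ D ^ 2) :
    ‖∫ x in a..b, Complex.exp (Complex.I * (Φ x : ℝ)) * f x‖ ≤
      4 * M / (κ * δ) + D / (κ * √δ) := by
  have hxc : ∀ x ∈ Icc a b, δ ≤ |x - c| := by
    intro x hx
    rcases hc with hc | hc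
    · rw [abs_of_nonneg] <;> linarith [hx.1]
    · rw [abs_of_nonpos] <;> linarith [hx.2]
  have hxne : ∀ x ∈ Icc a b, x - c ≠ 0 := by
    intro x hx h0
    have := hxc x hx
    rw [h0, abs_zero] at this; linarith
  refine (norm_integral_exp_mul_le_of_le_abs_deriv hab (fun x _ => h.deriv_one x)
    (fun x _ => h.deriv_two x) h.cont.continuousOn (Or.inl hsign) (mul_pos hκ hδ)
    (fun x hx => (mul_le_mul_of_nonneg_left (hxc x hx) hκ.le).trans (hΦ x hx)) hf hM).trans
    (add_le_add_right ?_ _)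
  have cinv : ContinuousOn (fun x => |x - c|⁻¹) (Icc a b) :=
    ContinuousOn.inv₀ (by fun_prop) fun x hx => abs_ne_zero.2 (hxne x hx)
  have cΦ : ContinuousOn (fun x => |Φ₁ x|⁻¹) (Icc a b) := by
    refine ContinuousOn.inv₀ (h.continuous_deriv.abs.continuousOn) fun x hx h0 => ?_
    have h1 := hΦ x hx
    rw [h0] at h1
    have := mul_pos hκ (hδ.trans_le (hxc x hx))
    linarith
  have hfi : IntervalIntegrable (fun x => ‖f' x‖) volume a b := (hf.intervalIntegrable a b).norm
  have i1 : IntervalIntegrable (fun x => ‖f' x‖ * |Φ₁ x|⁻¹) volume a b :=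
    hfi.mul_continuousOn (by rwa [uIcc_of_le hab])
  have i2 : IntervalIntegrable (fun x => ‖f' x‖ * |x - c|⁻¹) volume a b :=
    hfi.mul_continuousOn (by rwa [uIcc_of_le hab])
  have hsq : ∫ x in a..b, (|x - c|⁻¹) ^ 2 ≤ (√δ)⁻¹ ^ 2 := by
    have e : ∫ x in a..b, (|x - c|⁻¹) ^ 2 = (a - c)⁻¹ - (b - c)⁻¹ := by
      have ii : IntervalIntegrable (fun x => (|x - c|⁻¹) ^ 2) volume a b := by
        apply ContinuousOn.intervalIntegrable; rw [uIcc_of_le hab]; exact cinv.pow 2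
      rw [intervalIntegral.integral_eq_sub_of_hasDerivAt (f := fun x => -(x - c)⁻¹) ?_ ii]
      · ring
      · intro x hx
        rw [uIcc_of_le hab] at hx
        convert! (((hasDerivAt_id x).sub_const c).inv (hxne x hx)).neg using 1
        simp [neg_div]
    rw [e, inv_pow, Real.sq_sqrt hδ.le]
    rcases hc with hc | hc
    · have h1 : (a - c)⁻¹ ≤ δ⁻¹ := inv_anti₀ hδ (by linarith)
      have h2 : 0 ≤ (b - c)⁻¹ := inv_nonneg.2 (by linarith)
      linarith
    · have h1 : -(b - c)⁻¹ ≤ δ⁻¹ := by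
        rw [← inv_neg]; exact inv_anti₀ hδ (by linarith)
      have h2 : (a - c)⁻¹ ≤ 0 := inv_nonpos.2 (by linarith)
      linarith
  have hcs : ∫ x in a..b, ‖f' x‖ * |x - c|⁻¹ ≤ D * (√δ)⁻¹ := by
    refine intervalIntegral_mul_le_of_sq_le hab (hf.memLp.norm.restrict _) ?_ (by simp) (by simp)
      hD0 (by positivity) hD hsq
    exact cinv.memLp_two_Ioc
  calc ∫ x in a..b, ‖f' x‖ / |Φ₁ x| ≤ ∫ x in a..b, κ⁻¹ * (‖f' x‖ * |x - c|⁻¹) := by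
        simp_rw [div_eq_mul_inv]
        refine intervalIntegral.integral_mono_on hab i1 (i2.const_mul _) fun x hx => ?_
        have : |Φ₁ x|⁻¹ ≤ (κ * |x - c|)⁻¹ :=
          inv_anti₀ (mul_pos hκ (hδ.trans_le (hxc x hx))) (hΦ x hx)
        rw [mul_inv] at this
        calc _ ≤ ‖f' x‖ * (κ⁻¹ * |x - c|⁻¹) := mul_le_mul_of_nonneg_left this (norm_nonneg _)
          _ = _ := by ring
    _ ≤ κ⁻¹ * (D * (√δ)⁻¹) := by
        rw [intervalIntegral.integral_const_mul]
        exact mul_le_mul_of_nonneg_left hcs (by positivity)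
    _ = _ := by rw [div_eq_mul_inv, mul_inv]; ring

/-- Φ' increases with slope at least κ. Take for c its zero; if it has no zero, take the endpoint
where |Φ'| is smallest. -/
theorem exists_mul_abs_sub_le (h : IsPhase Φ Φ₁ Φ₂) {a b κ : ℝ} (hab : a ≤ b) 
    (hΦ : ∀ x ∈ Icc a b, κ ≤ Φ₂ x) : ∃ c ∈ Icc a b, ∀ x ∈ Icc a b, κ * |x - c| ≤ |Φ₁ x| := by
  have mono : ∀ x ∈ Icc a b, ∀ y ∈ Icc a b, x ≤ y → κ * (y - x) ≤ Φ₁ y - Φ₁ x := by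
    apply (convex_Icc a b).mul_sub_le_image_sub_of_le_deriv h.continuous_deriv.continuousOn
    · exact fun x _ => (h.deriv_two x).differentiableAt.differentiableWithinAt
    · intro x hx
      rw [(h.deriv_two x).deriv]
      exact hΦ x (interior_subset hx)
  have ha : a ∈ Icc a b := left_mem_Icc.2 hab
  have hb : b ∈ Icc a b := right_mem_Icc.2 hab
  rcases le_total 0 (Φ₁ a) with h0 | h0
  · refine ⟨a, ha, fun x hx => ?_⟩
    have := mono a ha x hx hx.1
    rw [abs_of_nonneg (sub_nonneg.2 hx.1)]
    exact le_trans (by linarith) (le_abs_self _)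
  rcases le_total (Φ₁ b) 0 with h1 | h1
  · refine ⟨b, hb, fun x hx => ?_⟩
    have := mono x hx b hb hx.2
    rw [abs_of_nonpos (sub_nonpos.2 hx.2)]
    exact le_trans (by linarith) (neg_le_abs _)
  obtain ⟨c, hc, hc0⟩ := intermediate_value_Icc hab h.continuous_deriv.continuousOn ⟨h0, h1⟩
  refine ⟨c, hc, fun x hx => ?_⟩
  rcases le_total c x with hx' | hx'
  · have := mono c hc x hx hx'
    rw [abs_of_nonneg (sub_nonneg.2 hx')]
    exact le_trans (by linarith) (le_abs_self _)
  · have := mono x hx c hc hx'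
    rw [abs_of_nonpos (sub_nonpos.2 hx')]
    exact le_trans (by linarith) (neg_le_abs _)

/-- Cut at c ± δ: the middle piece costs K, each outer piece is nonstationary. Both δ and the bound
K are left open, because the sup norm and L² tests choose them differently. -/
theorem norm_integral_exp_mul_le_near_add (h : IsPhase Φ Φ₁ Φ₂) (hf : HasL2Deriv f f')
    {a b δ κ M D K : ℝ} (hab : a ≤ b) (hδ : 0 < δ) (hκ : 0 < κ)
    (hΦ : ∀ x ∈ Icc a b, κ ≤ Φ₂ x)
    (hM : ∀ x ∈ Icc a b, ‖f x‖ ≤ M) (hD0 : 0 ≤ D) (hD : ∫ x in a..b, ‖f' x‖ ^ 2 ≤ D ^ 2)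
    (hK : ∀ p q, a ≤ p → p ≤ q → q ≤ b → q - p ≤ 2 * δ → ∫ x in p..q, ‖f x‖ ≤ K) :
    ‖∫ x in a..b, Complex.exp (Complex.I * (Φ x : ℝ)) * f x‖ ≤
      K + 2 * (4 * M / (κ * δ) + D / (κ * √δ)) := by
  obtain ⟨c, hc, hcΦ⟩ := h.exists_mul_abs_sub_le hab hΦ
  have hM0 : 0 ≤ M := (norm_nonneg _).trans (hM a (left_mem_Icc.2 hab))
  have hB0 : 0 ≤ 4 * M / (κ * δ) + D / (κ * √δ) := by positivity
  have hΦ0 : ∀ x ∈ Icc a b, 0 ≤ Φ₂ x := fun x hx => hκ.le.trans (hΦ x hx)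
  have hfar : ∀ p q, a ≤ p → p ≤ q → q ≤ b → (c + δ ≤ p ∨ q ≤ c - δ) →
      ‖∫ x in p..q, Complex.exp (Complex.I * (Φ x : ℝ)) * f x‖ ≤
        4 * M / (κ * δ) + D / (κ * √δ) := by
    intro p q hp hpq hq hpqc
    have hsub : ∀ x ∈ Icc p q, x ∈ Icc a b := fun x hx => ⟨hp.trans hx.1, hx.2.trans hq⟩
    refine h.norm_integral_exp_mul_le_of_mul_abs_sub_le hf hpq hδ hκ hpqc
      (fun x hx => hcΦ x (hsub x hx)) (fun x hx => hΦ0 x (hsub x hx))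
      (fun x hx => hM x (hsub x hx)) hD0 (le_trans ?_ hD)
    exact intervalIntegral.integral_mono_interval hp hpq hq
      (Eventually.of_forall fun x => by positivity) (hf.intervalIntegrable_sq a b)
  set p := max a (c - δ)
  set q := min b (c + δ)
  have hap : a ≤ p := le_max_left _ _
  have hqb : q ≤ b := min_le_left _ _
  have hpc : p ≤ c := max_le hc.1 (by linarith)
  have hcq : c ≤ q := le_min hc.2 (by linarith)
  have hpq : q - p ≤ 2 * δ := by
    have h1 : q ≤ c + δ := min_le_right _ _
    have h2 : c - δ ≤ p := le_max_right _ _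
    linarith
  have b1 : ‖∫ x in a..p, Complex.exp (Complex.I * (Φ x : ℝ)) * f x‖ ≤
      4 * M / (κ * δ) + D / (κ * √δ) := by
    rcases le_total a (c - δ) with h' | h'
    · exact hfar a p le_rfl hap (hpc.trans hc.2) (Or.inr (by simp [p, h']))
    · have : p = a := by simp [p, h']
      rw [this, intervalIntegral.integral_same, norm_zero]; exact hB0
  have b3 : ‖∫ x in q..b, Complex.exp (Complex.I * (Φ x : ℝ)) * f x‖ ≤
      4 * M / (κ * δ) + D / (κ * √δ) := by
    rcases le_total (c + δ) b with h' | h'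
    · exact hfar q b (hc.1.trans hcq) hqb le_rfl (Or.inl (by simp [q, h']))
    · have : q = b := by simp [q, h']
      rw [this, intervalIntegral.integral_same, norm_zero]; exact hB0
  have b2 : ‖∫ x in p..q, Complex.exp (Complex.I * (Φ x : ℝ)) * f x‖ ≤ K := by
    refine (intervalIntegral.norm_integral_le_integral_norm (hpc.trans hcq)).trans ?_
    simp_rw [norm_mul, norm_exp, one_mul]
    exact hK p q hap (hpc.trans hcq) hqb hpq
  have hi : ∀ x y, IntervalIntegrable (fun x => Complex.exp (Complex.I * (Φ x : ℝ)) * f x)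
      volume x y := fun x y => (h.continuous_exp_mul hf.continuous).intervalIntegrable x y
  rw [← intervalIntegral.integral_add_adjacent_intervals (hi a p) (hi p b),
    ← intervalIntegral.integral_add_adjacent_intervals (hi p q) (hi q b)]
  refine (norm_add_le _ _).trans ?_
  have := norm_add_le (∫ x in p..q, Complex.exp (Complex.I * (Φ x : ℝ)) * f x)
    (∫ x in q..b, Complex.exp (Complex.I * (Φ x : ℝ)) * f x)
  linarith

/-- Conjugation reverses the phase, which reduces Φ'' ≤ -κ to Φ'' ≥ κ. -/
theorem norm_integral_exp_neg_mul (a b : ℝ) :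
    ‖∫ x in a..b, Complex.exp (Complex.I * ((-Φ x : ℝ) : ℂ)) * (starRingEnd ℂ) (f x)‖ =
      ‖∫ x in a..b, Complex.exp (Complex.I * (Φ x : ℝ)) * f x‖ := by
  rw [intervalIntegral.norm_intervalIntegral_eq, intervalIntegral.norm_intervalIntegral_eq,
    ← Complex.norm_conj, ← integral_conj]
  congr 1
  apply integral_congr_ae
  refine Eventually.of_forall fun x => ?_
  simp [← Complex.exp_conj]

/-- Second derivative test with the sup norm of the amplitude. -/
theorem norm_integral_exp_mul_le_of_le_abs_deriv_two (h : IsPhase Φ Φ₁ Φ₂) (hf : HasL2Deriv f f')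
    {a b κ M D : ℝ} (hab : a ≤ b) (hκ : 0 < κ)
    (hΦ : (∀ x ∈ Icc a b, κ ≤ Φ₂ x) ∨ (∀ x ∈ Icc a b, Φ₂ x ≤ -κ))
    (hM : ∀ x ∈ Icc a b, ‖f x‖ ≤ M) (hD0 : 0 ≤ D) (hD : ∫ x in a..b, ‖f' x‖ ^ 2 ≤ D ^ 2) :
    ‖∫ x in a..b, Complex.exp (Complex.I * (Φ x : ℝ)) * f x‖ ≤
      10 * M * κ ^ (-(1 / 2) : ℝ) + 2 * D * κ ^ (-(3 / 4) : ℝ) := by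
  wlog hpos : ∀ x ∈ Icc a b, κ ≤ Φ₂ x generalizing Φ Φ₁ Φ₂ f f'
  · have hneg := hΦ.resolve_left hpos
    have := this h.neg hf.conj (Or.inl fun x hx => by linarith [hneg x hx])
      (fun x hx => by simpa using hM x hx) (by simpa using hD)
      (fun x hx => by linarith [hneg x hx])
    rwa [norm_integral_exp_neg_mul] at this
  have hM0 : 0 ≤ M := (norm_nonneg _).trans (hM a (left_mem_Icc.2 hab))
  -- This δ balances the trivial bound 2δM near the stationary point against M/(κδ) away from it.
  set δ := κ ^ (-(1 / 2) : ℝ) with hδ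
  have hδ0 : 0 < δ := Real.rpow_pos_of_pos hκ _
  have := h.norm_integral_exp_mul_le_near_add hf (K := 2 * δ * M) hab hδ0 hκ hpos hM hD0 hD ?_
  · refine this.trans (le_of_eq ?_)
    have e1 : κ * δ = δ⁻¹ := by
      rw [hδ, ← Real.rpow_neg hκ.le]
      nth_rw 1 [← Real.rpow_one κ]
      rw [← Real.rpow_add hκ]; norm_num
    have e2 : κ * √δ = (κ ^ (-(3 / 4) : ℝ))⁻¹ := by
      rw [hδ, ← Real.rpow_neg hκ.le, Real.sqrt_eq_rpow, ← Real.rpow_mul hκ.le]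
      nth_rw 1 [← Real.rpow_one κ]
      rw [← Real.rpow_add hκ]; norm_num
    rw [e1, e2, div_inv_eq_mul, div_inv_eq_mul]; ring
  · intro p q hp hpq hq hlen
    have : ∀ x ∈ Ioc p q, ‖‖f x‖‖ ≤ M := fun x hx => by
      rw [norm_norm]; exact hM x ⟨hp.trans hx.1.le, hx.2.trans hq⟩
    have h1 := intervalIntegral.norm_integral_le_of_norm_le_const (a := p) (b := q)
      (C := M) (f := fun x => ‖f x‖) (by rwa [uIoc_of_le hpq])
    rw [abs_of_nonneg (sub_nonneg.2 hpq)] at h1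
    calc _ ≤ M * (q - p) := (Real.le_norm_self _).trans h1
      _ ≤ M * (2 * δ) := mul_le_mul_of_nonneg_left hlen hM0
      _ = _ := by ring

/-- Second derivative test with the `L²` norm of the amplitude. -/
theorem norm_integral_exp_mul_le_sqrt (h : IsPhase Φ Φ₁ Φ₂) (hf : HasL2Deriv f f')
    {a b κ L D : ℝ} (hab : a ≤ b) (hκ : 0 < κ)
    (hΦ : (∀ x ∈ Icc a b, κ ≤ Φ₂ x) ∨ (∀ x ∈ Icc a b, Φ₂ x ≤ -κ))
    (hL0 : 0 < L) (hD0 : 0 < D) (hlen : L / D ≤ b - a)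
    (hL : ∫ x in a..b, ‖f x‖ ^ 2 ≤ L ^ 2) (hD : ∫ x in a..b, ‖f' x‖ ^ 2 ≤ D ^ 2) :
    ‖∫ x in a..b, Complex.exp (Complex.I * (Φ x : ℝ)) * f x‖ ≤ 24 * √(L * D / κ) := by
  wlog hpos : ∀ x ∈ Icc a b, κ ≤ Φ₂ x generalizing Φ Φ₁ Φ₂ f f'
  · have hneg := hΦ.resolve_left hpos
    have := this h.neg hf.conj (Or.inl fun x hx => by linarith [hneg x hx])
      (by simpa using hL) (by simpa using hD) (fun x hx => by linarith [hneg x hx])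
    rwa [norm_integral_exp_neg_mul] at this
  have hM := hf.norm_le_two_mul_sqrt hL0 hD0 hlen hL hD
  set S := √(L * D / κ) with hS
  set r := (√κ)⁻¹ with hr
  have hκ' : 0 < √κ := Real.sqrt_pos.2 hκ
  have hr0 : 0 < r := inv_pos.2 hκ'
  have hMr : √(L * D) * r = S := by
    rw [hS, Real.sqrt_div (mul_pos hL0 hD0).le]; rfl
  have hκr : κ * r = √κ := by
    rw [hr]; field_simp; exact (Real.sq_sqrt hκ.le).symm
  set d := D / (κ * L) with hd
  have hd0 : 0 < d := by positivity
  have hdL : √d * L = S := by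
    have : L * D / κ = d * L ^ 2 := by rw [hd]; field_simp
    rw [hS, this, Real.sqrt_mul hd0.le, Real.sqrt_sq hL0.le]
  have hdD : D / (κ * √d) = S := by
    rw [← hdL, div_eq_iff (by positivity)]
    have : √d * L * (κ * √d) = (√d * √d) * (κ * L) := by ring
    rw [this, Real.mul_self_sqrt hd0.le, hd]; field_simp
  -- The radius r balances the terms with the sup norm 2√(LD), and d balances √δ·L against D/(κ√δ).
  -- With the larger of the two, both outer terms are of size S. The middle piece is estimated by
  -- the sup norm when δ = r and by Cauchy–Schwarz when δ = d.
  set δ := max r d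
  have hδ0 : 0 < δ := lt_max_of_lt_left hr0
  have hM0 : 0 ≤ 2 * √(L * D) := by positivity
  have := h.norm_integral_exp_mul_le_near_add hf (K := 4 * S) hab hδ0 hκ hpos hM hD0.le hD ?_
  · have b1 : 4 * (2 * √(L * D)) / (κ * δ) ≤ 8 * S := by
      calc 4 * (2 * √(L * D)) / (κ * δ) ≤ 4 * (2 * √(L * D)) / (κ * r) := by
            gcongr; exact le_max_left _ _
        _ = 8 * S := by rw [hκr, ← hMr, hr]; ring
    have b2 : D / (κ * √δ) ≤ S := by
      rw [← hdD]; gcongr; exact le_max_right _ _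
    have hS0 : 0 ≤ S := Real.sqrt_nonneg _
    linarith
  · intro p q hp hpq hq hlen'
    rcases le_total d r with hdr | hdr
    · have hδ : δ = r := max_eq_left hdr
      have h1 := intervalIntegral.norm_integral_le_of_norm_le_const (a := p) (b := q)
        (C := 2 * √(L * D)) (f := fun x => ‖f x‖) (by
          rw [uIoc_of_le hpq]; intro x hx
          rw [norm_norm]; exact hM x ⟨hp.trans hx.1.le, hx.2.trans hq⟩)
      rw [abs_of_nonneg (sub_nonneg.2 hpq)] at h1
      calc _ ≤ 2 * √(L * D) * (q - p) := (Real.le_norm_self _).trans h1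
        _ ≤ 2 * √(L * D) * (2 * r) := mul_le_mul_of_nonneg_left (hδ ▸ hlen') hM0
        _ = _ := by rw [← hMr]; ring
    · have hδ : δ = d := max_eq_right hdr
      have h1 := intervalIntegral_norm_le_sqrt_mul hpq
        hf.continuous.continuousOn.memLp_two_Ioc hL0.le
        ((intervalIntegral.integral_mono_interval hp hpq hq
          (Eventually.of_forall fun x => sq_nonneg _)
          ((hf.continuous.norm.pow 2).intervalIntegrable a b)).trans hL)
      refine h1.trans ?_
      have h2 : √(q - p) ≤ √(4 * d) := Real.sqrt_le_sqrt (by rw [← hδ]; linarith)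
      have h4 : √(4 * d) = 2 * √d := by
        rw [Real.sqrt_mul (by norm_num), show (4 : ℝ) = 2 ^ 2 by norm_num,
          Real.sqrt_sq (by norm_num)]
      calc √(q - p) * L ≤ 2 * √d * L := by rw [← h4]; gcongr
        _ = 2 * S := by rw [← hdL]; ring
        _ ≤ 4 * S := by linarith [Real.sqrt_nonneg (L * D / κ)]

end IsPhase

/-! ### The dispersion relation and its inflection points. -/

noncomputable section

/-- The dispersion relation `ξ (1 + ξ²)^{-s/2}`. -/
def dispersion (s x : ℝ) : ℝ := besselSymbol s x * x

/-- The first derivative of `dispersion`. -/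
def dispersionDeriv (s x : ℝ) : ℝ := (1 + x ^ 2) ^ (-s / 2 - 1) * (1 + (1 - s) * x ^ 2)

/-- The second derivative of `dispersion`. -/
def dispersionDerivTwo (s x : ℝ) : ℝ :=
  s * x * (1 + x ^ 2) ^ (-s / 2 - 2) * ((s - 1) * x ^ 2 - 3)

theorem besselSymbol_eq (s x : ℝ) : besselSymbol s x = (1 + x ^ 2) ^ (-s / 2) := by
  simp [besselSymbol]

theorem besselSymbol_neg (s x : ℝ) : besselSymbol s (-x) = besselSymbol s x := by
  simp [besselSymbol]

theorem dispersion_neg (s x : ℝ) : dispersion s (-x) = -dispersion s x := by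
  simp [dispersion, besselSymbol_neg]

theorem hasDerivAt_one_add_sq_rpow (r x : ℝ) :
    HasDerivAt (fun x : ℝ => (1 + x ^ 2) ^ r) (2 * r * x * (1 + x ^ 2) ^ (r - 1)) x := by
  have h : HasDerivAt (fun x : ℝ => 1 + x ^ 2) (2 * x) x := by
    simpa using (hasDerivAt_pow 2 x).const_add 1
  convert! h.rpow_const (p := r) (Or.inl (by positivity)) using 1
  ring

theorem hasDerivAt_dispersion (s x : ℝ) : HasDerivAt (dispersion s) (dispersionDeriv s x) x := by
  have e : dispersion s = fun x => (1 + x ^ 2) ^ (-s / 2) * x := by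
    ext x; rw [dispersion, besselSymbol_eq]
  rw [e]
  convert! (hasDerivAt_one_add_sq_rpow (-s / 2) x).mul (hasDerivAt_id x) using 1
  have hw : (0 : ℝ) < 1 + x ^ 2 := by positivity
  have h1 : (1 + x ^ 2) ^ (-s / 2) = (1 + x ^ 2) ^ (-s / 2 - 1) * (1 + x ^ 2) := by
    rw [Real.rpow_sub_one hw.ne']; field_simp
  rw [dispersionDeriv, h1, id]; ring

theorem hasDerivAt_dispersionDeriv (s x : ℝ) :
    HasDerivAt (dispersionDeriv s) (dispersionDerivTwo s x) x := by
  have h : HasDerivAt (fun x : ℝ => 1 + (1 - s) * x ^ 2) ((1 - s) * (2 * x)) x := by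
    simpa using ((hasDerivAt_pow 2 x).const_mul (1 - s)).const_add 1
  convert! (hasDerivAt_one_add_sq_rpow (-s / 2 - 1) x).mul h using 1
  have hw : (0 : ℝ) < 1 + x ^ 2 := by positivity
  have e : -s / 2 - 1 - 1 = -s / 2 - 2 := by ring
  have h1 : (1 + x ^ 2) ^ (-s / 2 - 1) = (1 + x ^ 2) ^ (-s / 2 - 2) * (1 + x ^ 2) := by
    rw [← e, Real.rpow_sub_one hw.ne' (-s / 2 - 1), div_mul_cancel₀ _ hw.ne']
  rw [dispersionDerivTwo, e, h1]; ring

theorem continuous_dispersionDerivTwo (s : ℝ) : Continuous (dispersionDerivTwo s) := by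
  unfold dispersionDerivTwo
  have : Continuous fun x : ℝ => (1 + x ^ 2) ^ (-s / 2 - 2) :=
    (by fun_prop : Continuous fun x : ℝ => 1 + x ^ 2).rpow_const
      fun x => Or.inl (by positivity)
  fun_prop

theorem isPhase_dispersion (s t y : ℝ) :
    IsPhase (fun x => t * dispersion s x + y * x) (fun x => t * dispersionDeriv s x + y)
      (fun x => t * dispersionDerivTwo s x) where
  deriv_one x := by
    simpa using ((hasDerivAt_dispersion s x).const_mul t).fun_add ((hasDerivAt_id x).const_mul y)
  deriv_two x := ((hasDerivAt_dispersionDeriv s x).const_mul t).add_const y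
  cont := (continuous_dispersionDerivTwo s).const_mul t

theorem rpow_le_one_add_sq_rpow {r x : ℝ} (hr : r ≤ 0) (hx : 1 ≤ x) :
    2 ^ r * x ^ (2 * r) ≤ (1 + x ^ 2) ^ r := by
  have hx0 : 0 < x := by linarith
  have e : 2 ^ r * x ^ (2 * r) = (2 * x ^ 2) ^ r := by
    rw [Real.mul_rpow (by norm_num) (by positivity), Real.rpow_mul hx0.le, Real.rpow_two]
  rw [e]
  exact Real.rpow_le_rpow_of_nonpos (by positivity) (by nlinarith) hr

theorem mul_rpow_le_mul_one_add_sq_rpow {s x : ℝ} (hs : 0 < s) (hx : 1 ≤ x) :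
    2 ^ (-s / 2 - 2) * x ^ (-s - 1) ≤ (1 + x ^ 2) ^ (-s / 2 - 2) * x ^ 3 := by
  have hx0 : 0 < x := by linarith
  have h := rpow_le_one_add_sq_rpow (r := -s / 2 - 2) (by linarith) hx
  calc 2 ^ (-s / 2 - 2) * x ^ (-s - 1)
      = 2 ^ (-s / 2 - 2) * x ^ (2 * (-s / 2 - 2)) * x ^ 3 := by
        rw [mul_assoc, ← Real.rpow_natCast, ← Real.rpow_add hx0]
        congr 2; push_cast; ring
    _ ≤ _ := by gcongr

/-- For x > 0 the sign of p'' is that of (s-1)x² - 3. Its zeros on x ≥ 0 are simple, hence the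
linear lower bound cτ at distance τ from them on [0, M]. At infinity the factor (s-1)x² dominates,
and this needs s ≠ 1. The sign ε is the one p'' has to the right of x₀. -/
theorem exists_dispersionDerivTwo_bounds {s : ℝ} (hs : 0 < s) (hs1 : s ≠ 1) :
    ∃ M c x₀ ε : ℝ, 1 ≤ M ∧ 0 < c ∧ (ε = 1 ∨ ε = -1) ∧
      (∀ τ > 0, ∀ x, τ ≤ x → x ≤ M → x ≤ x₀ - τ → dispersionDerivTwo s x ≤ -(c * τ)) ∧
      (∀ τ > 0, ∀ x, τ ≤ x → x ≤ M → x₀ + τ ≤ x → c * τ ≤ ε * dispersionDerivTwo s x) ∧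
      (∀ x, M ≤ x → c * x ^ (-s - 1) ≤ ε * dispersionDerivTwo s x) := by
  rcases lt_or_gt_of_ne hs1 with h1 | h1
  · have hs' : 0 < 1 - s := by linarith
    -- For s < 1 the origin is the only zero; x₀ = 0 makes the range τ ≤ x ≤ x₀ - τ empty.
    refine ⟨1, s * (1 - s) * 2 ^ (-s / 2 - 2), 0, -1, le_rfl, by positivity, Or.inr rfl, ?_, ?_, ?_⟩
    · intro τ hτ x h1 h2 h3; linarith
    · intro τ hτ x hx1 hx2 hx3
      have hx : 0 < x := by linarith
      have hw : (2 : ℝ) ^ (-s / 2 - 2) ≤ (1 + x ^ 2) ^ (-s / 2 - 2) :=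
        Real.rpow_le_rpow_of_nonpos (by positivity) (by nlinarith) (by linarith)
      calc s * (1 - s) * 2 ^ (-s / 2 - 2) * τ = s * τ * 2 ^ (-s / 2 - 2) * (1 - s) := by ring
        _ ≤ s * x * (1 + x ^ 2) ^ (-s / 2 - 2) * (3 + (1 - s) * x ^ 2) := by
          gcongr
          nlinarith [mul_nonneg hs'.le (sq_nonneg x)]
        _ = _ := by rw [dispersionDerivTwo]; ring
    · intro x hx
      have hx0 : 0 < x := by linarith
      have hw := mul_rpow_le_mul_one_add_sq_rpow hs hx
      calc s * (1 - s) * 2 ^ (-s / 2 - 2) * x ^ (-s - 1)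
          = s * (1 - s) * (2 ^ (-s / 2 - 2) * x ^ (-s - 1)) := by ring
        _ ≤ s * (1 - s) * ((1 + x ^ 2) ^ (-s / 2 - 2) * x ^ 3) := by gcongr
        _ ≤ s * (1 - s) * ((1 + x ^ 2) ^ (-s / 2 - 2) * x ^ 3)
            + 3 * (s * x * (1 + x ^ 2) ^ (-s / 2 - 2)) := by
          have : 0 ≤ 3 * (s * x * (1 + x ^ 2) ^ (-s / 2 - 2)) := by positivity
          linarith
        _ = _ := by rw [dispersionDerivTwo]; ring
  · have hs' : 0 < s - 1 := by linarith
    set x₀ := √(3 / (s - 1)) with hx₀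
    have hx₀p : 0 < x₀ := by positivity
    have hfac : ∀ x, dispersionDerivTwo s x =
        s * (s - 1) * ((1 + x ^ 2) ^ (-s / 2 - 2) * (x * (x ^ 2 - x₀ ^ 2))) := by
      intro x
      have : (s - 1) * x₀ ^ 2 = 3 := by rw [hx₀, Real.sq_sqrt (by positivity)]; field_simp
      rw [dispersionDerivTwo]
      linear_combination (s * x * (1 + x ^ 2) ^ (-s / 2 - 2)) * this
    -- Beyond 2x₀ one has x² - x₀² ≥ (3/4)x², which is the origin of the 3/4 in c₂.
    set M := max 1 (2 * x₀)
    have hM1 : 1 ≤ M := le_max_left _ _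
    set W := (1 + M ^ 2) ^ (-s / 2 - 2) with hW
    have hWp : 0 < W := by positivity
    have hWle : ∀ x, 0 < x → x ≤ M → W ≤ (1 + x ^ 2) ^ (-s / 2 - 2) := by
      intro x hx hxM
      exact Real.rpow_le_rpow_of_nonpos (by positivity) (by nlinarith) (by linarith)
    set c₁ := s * (s - 1) * (W * (x₀ ^ 2 / 2))
    set c₂ := s * (s - 1) * (2 ^ (-s / 2 - 2) * (3 / 4))
    have hc₁ : 0 < c₁ := by positivity
    have hc₂ : 0 < c₂ := by positivity
    refine ⟨M, min c₁ c₂, x₀, 1, hM1, lt_min hc₁ hc₂, Or.inl rfl, ?_, ?_, ?_⟩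
    · intro τ hτ x hx1 hx2 hx3
      have hx : 0 < x := by linarith
      have h1 : x₀ ^ 2 / 2 * τ ≤ x * (x₀ ^ 2 - x ^ 2) := by
        have e : x * (x₀ ^ 2 - x ^ 2) = x * (x₀ - x) * (x₀ + x) := by ring
        -- One of the factors x, x₀ - x is at least x₀/2 and the other is at least τ.
        have h2 : x₀ / 2 * τ ≤ x * (x₀ - x) := by
          rcases le_total x (x₀ / 2) with h | h
          · rw [mul_comm]; exact mul_le_mul hx1 (by linarith) (by linarith) hx.le
          · exact mul_le_mul h (by linarith) hτ.le hx.le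
        rw [e]
        calc x₀ ^ 2 / 2 * τ = x₀ / 2 * τ * x₀ := by ring
          _ ≤ x * (x₀ - x) * (x₀ + x) :=
            mul_le_mul h2 (by linarith) hx₀p.le (le_trans (by positivity) h2)
      have : c₁ * τ ≤ -dispersionDerivTwo s x := by
        calc c₁ * τ = s * (s - 1) * (W * (x₀ ^ 2 / 2 * τ)) := by ring
          _ ≤ s * (s - 1) * ((1 + x ^ 2) ^ (-s / 2 - 2) * (x * (x₀ ^ 2 - x ^ 2))) := by
            gcongr
            exact hWle x hx hx2
          _ = _ := by rw [hfac]; ring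
      have h3 : min c₁ c₂ * τ ≤ c₁ * τ := by gcongr; exact min_le_left _ _
      linarith
    · intro τ hτ x hx1 hx2 hx3
      have hx : 0 < x := by linarith
      have h1 : x₀ ^ 2 / 2 * τ ≤ x * (x ^ 2 - x₀ ^ 2) := by
        have e : x * (x ^ 2 - x₀ ^ 2) = x * (x + x₀) * (x - x₀) := by ring
        rw [e]
        have : x₀ ^ 2 / 2 ≤ x * (x + x₀) := by nlinarith
        exact mul_le_mul this (by linarith) hτ.le (by positivity)
      rw [one_mul, hfac]
      calc min c₁ c₂ * τ ≤ c₁ * τ := by gcongr; exact min_le_left _ _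
        _ = s * (s - 1) * (W * (x₀ ^ 2 / 2 * τ)) := by ring
        _ ≤ _ := by
          gcongr
          exact hWle x hx hx2
    · intro x hx
      have hx1 : 1 ≤ x := hM1.trans hx
      have hx0 : 0 < x := by linarith
      have hx2 : 2 * x₀ ≤ x := (le_max_right _ _).trans hx
      have hw := mul_rpow_le_mul_one_add_sq_rpow hs hx1
      rw [one_mul, hfac]
      calc min c₁ c₂ * x ^ (-s - 1) ≤ c₂ * x ^ (-s - 1) := by gcongr; exact min_le_right _ _
        _ = s * (s - 1) * (2 ^ (-s / 2 - 2) * x ^ (-s - 1) * (3 / 4)) := by ring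
        _ ≤ s * (s - 1) * ((1 + x ^ 2) ^ (-s / 2 - 2) * x ^ 3 * (3 / 4)) := by gcongr
        _ = s * (s - 1) * ((1 + x ^ 2) ^ (-s / 2 - 2) * (x * (3 / 4 * x ^ 2))) := by ring
        _ ≤ _ := by
          gcongr
          nlinarith

/-- When s > 1 the condition on s says x₀² = 3/(s-1) > 2⁻¹⁸, so 3 - (s-1)x² stays above a positive d
on [0, 2⁻⁹]; when s ≤ 1 it is at least 3. The second bound integrates |p''(y)| ≤ Cx over [0, x],
starting from p'(0) = 1. -/
theorem exists_dispersion_low_bounds {s : ℝ} (hs : 0 < s) (hs1 : s < 1 + 3 * 2 ^ 18) :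
    ∃ c c₂ : ℝ, 0 < c ∧ 0 < c₂ ∧ ∀ x, 0 ≤ x → x ≤ (2 ^ 9)⁻¹ →
      dispersionDerivTwo s x ≤ -(c * x) ∧ |dispersionDeriv s x - 1| ≤ c₂ * x ^ 2 := by
  set d := min 3 (3 - (s - 1) / 2 ^ 18)
  have hd : 0 < d := lt_min (by norm_num) (by
    rw [sub_pos, div_lt_iff₀ (by positivity)]; linarith)
  refine ⟨s * 2 ^ (-s / 2 - 2) * d, s * (|s - 1| + 3), by positivity, by positivity, ?_⟩
  intro x hx0 hx1
  have hx1' : x ≤ 1 := hx1.trans (by norm_num)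
  have hx2 : x ^ 2 ≤ (2 ^ 18)⁻¹ := by
    calc x ^ 2 ≤ ((2 ^ 9 : ℝ)⁻¹) ^ 2 := by gcongr
      _ = _ := by norm_num
  constructor
  · have hw : (2 : ℝ) ^ (-s / 2 - 2) ≤ (1 + x ^ 2) ^ (-s / 2 - 2) :=
      Real.rpow_le_rpow_of_nonpos (by positivity) (by nlinarith) (by linarith)
    have hdx : d ≤ 3 - (s - 1) * x ^ 2 := by
      rcases le_total s 1 with h | h
      · refine (min_le_left _ _).trans ?_
        nlinarith [sq_nonneg x]
      · refine (min_le_right _ _).trans ?_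
        rw [div_eq_mul_inv]
        nlinarith [mul_le_mul_of_nonneg_left hx2 (sub_nonneg.2 h)]
    have : s * 2 ^ (-s / 2 - 2) * d * x ≤ -dispersionDerivTwo s x := by
      calc s * 2 ^ (-s / 2 - 2) * d * x = s * x * 2 ^ (-s / 2 - 2) * d := by ring
        _ ≤ s * x * (1 + x ^ 2) ^ (-s / 2 - 2) * (3 - (s - 1) * x ^ 2) := by gcongr
        _ = _ := by rw [dispersionDerivTwo]; ring
    linarith
  · have hb : ∀ y ∈ Icc 0 x, ‖dispersionDerivTwo s y‖ ≤ s * (|s - 1| + 3) * x := by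
      intro y hy
      have hw1 : (1 + y ^ 2) ^ (-s / 2 - 2) ≤ 1 :=
        Real.rpow_le_one_of_one_le_of_nonpos (by nlinarith [sq_nonneg y]) (by linarith)
      have hw0 : 0 ≤ (1 + y ^ 2) ^ (-s / 2 - 2) := by positivity
      have hy1 : y ^ 2 ≤ 1 := by nlinarith [hy.1, hy.2]
      have h3 : |(s - 1) * y ^ 2 - 3| ≤ |s - 1| + 3 := by
        refine (abs_sub _ _).trans ?_
        rw [abs_mul, abs_of_nonneg (sq_nonneg y), abs_of_pos (by norm_num : (0 : ℝ) < 3)]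
        nlinarith [abs_nonneg (s - 1)]
      rw [dispersionDerivTwo, Real.norm_eq_abs, abs_mul, abs_mul, abs_mul, abs_of_pos hs,
        abs_of_nonneg hy.1, abs_of_nonneg hw0]
      calc s * y * (1 + y ^ 2) ^ (-s / 2 - 2) * |(s - 1) * y ^ 2 - 3|
          ≤ s * x * 1 * (|s - 1| + 3) := by
            gcongr
            exact hy.2
        _ = _ := by ring
    have := (convex_Icc 0 x).norm_image_sub_le_of_norm_hasDerivWithin_le
      (fun y _ => (hasDerivAt_dispersionDeriv s y).hasDerivWithinAt) hb
      (left_mem_Icc.2 hx0) (right_mem_Icc.2 hx0)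
    have h0 : dispersionDeriv s 0 = 1 := by simp [dispersionDeriv]
    rw [h0, sub_zero, Real.norm_eq_abs, Real.norm_eq_abs, abs_of_nonneg hx0] at this
    calc _ ≤ _ := this
      _ = _ := by ring

end

/-! ### Amplitudes with weighted L² bounds, and the dyadic sum at high frequency. -/

noncomputable section

/-- An amplitude `f` bounded by `A` whose weighted norms `‖⟨x⟩^N f‖_{L²}` and `‖⟨x⟩ f'‖_{L²}` are
bounded by `B`. -/
structure AmplitudeBound (N A B : ℝ) (f f' : ℝ → ℂ) : Prop extends HasL2Deriv f f' where
  nonneg : 0 ≤ B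
  integrable : Integrable f volume
  sup_le : ∀ x, ‖f x‖ ≤ A
  integrable_sq_weight : Integrable (fun x => (1 + x ^ 2) ^ N * ‖f x‖ ^ 2) volume
  sq_le : ∫ x, (1 + x ^ 2) ^ N * ‖f x‖ ^ 2 ≤ B ^ 2
  integrable_deriv_weight : Integrable (fun x => (1 + x ^ 2) * ‖f' x‖ ^ 2) volume
  deriv_le : ∫ x, (1 + x ^ 2) * ‖f' x‖ ^ 2 ≤ B ^ 2

namespace AmplitudeBound

variable {N A B : ℝ} {f f' : ℝ → ℂ}

theorem sup_nonneg (h : AmplitudeBound N A B f f') : 0 ≤ A := (norm_nonneg _).trans (h.sup_le 0)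

theorem comp_neg (h : AmplitudeBound N A B f f') :
    AmplitudeBound N A B (fun x => f (-x)) (fun x => -f' (-x)) where
  toHasL2Deriv := h.toHasL2Deriv.comp_neg
  nonneg := h.nonneg
  integrable := h.integrable.comp_neg
  sup_le x := h.sup_le _
  integrable_sq_weight := by simpa using h.integrable_sq_weight.comp_neg
  sq_le := by
    have := integral_neg_eq_self (fun x => (1 + x ^ 2) ^ N * ‖f x‖ ^ 2) volume
    simp only [neg_sq] at this
    rw [this]; exact h.sq_le
  integrable_deriv_weight := by simpa using h.integrable_deriv_weight.comp_neg
  deriv_le := by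
    have := integral_neg_eq_self (fun x => (1 + x ^ 2) * ‖f' x‖ ^ 2) volume
    simp only [neg_sq] at this
    simp only [norm_neg]
    rw [this]; exact h.deriv_le

theorem conj (h : AmplitudeBound N A B f f') :
    AmplitudeBound N A B (fun x => (starRingEnd ℂ) (f x)) (fun x => (starRingEnd ℂ) (f' x)) where
  toHasL2Deriv := h.toHasL2Deriv.conj
  nonneg := h.nonneg
  integrable := by
    have := h.integrable.norm
    exact (integrable_norm_iff
      (Complex.continuous_conj.comp_aestronglyMeasurable h.integrable.1)).1 (by simpa using this)
  sup_le x := by simpa using h.sup_le x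
  integrable_sq_weight := by simpa using h.integrable_sq_weight
  sq_le := by simpa using h.sq_le
  integrable_deriv_weight := by simpa using h.integrable_deriv_weight
  deriv_le := by simpa using h.deriv_le

theorem integral_deriv_sq_le (h : AmplitudeBound N A B f f') {a b : ℝ} (hab : a ≤ b) :
    ∫ x in a..b, ‖f' x‖ ^ 2 ≤ B ^ 2 := by
  rw [intervalIntegral.integral_of_le hab]
  calc ∫ x in Ioc a b, ‖f' x‖ ^ 2 ≤ ∫ x, ‖f' x‖ ^ 2 :=
        setIntegral_le_integral h.integrable_sq (Eventually.of_forall fun x => sq_nonneg _)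
    _ ≤ ∫ x, (1 + x ^ 2) * ‖f' x‖ ^ 2 := by
        refine integral_mono h.integrable_sq h.integrable_deriv_weight fun x => ?_
        nlinarith [mul_nonneg (sq_nonneg x) (sq_nonneg ‖f' x‖)]
    _ ≤ B ^ 2 := h.deriv_le

theorem integral_weight_le {w u : ℝ → ℝ} {a b W K : ℝ} (hab : a ≤ b) (hW : 0 < W)
    (hi : Integrable (fun x => w x * u x ^ 2) volume) (hK : ∫ x, w x * u x ^ 2 ≤ K ^ 2)
    (hu : IntervalIntegrable (fun x => u x ^ 2) volume a b) (hw0 : ∀ x, 0 ≤ w x)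
    (hw : ∀ x ∈ Icc a b, W ^ 2 ≤ w x) : ∫ x in a..b, u x ^ 2 ≤ (K * W⁻¹) ^ 2 := by
  have : W ^ 2 * ∫ x in a..b, u x ^ 2 ≤ K ^ 2 := by
    calc W ^ 2 * ∫ x in a..b, u x ^ 2 = ∫ x in a..b, W ^ 2 * u x ^ 2 := by
          rw [intervalIntegral.integral_const_mul]
      _ ≤ ∫ x in a..b, w x * u x ^ 2 :=
          intervalIntegral.integral_mono_on hab (hu.const_mul _) hi.intervalIntegrable
            fun x hx => mul_le_mul_of_nonneg_right (hw x hx) (sq_nonneg _)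
      _ ≤ ∫ x, w x * u x ^ 2 := by
          rw [intervalIntegral.integral_of_le hab]
          exact setIntegral_le_integral hi
            (Eventually.of_forall fun x => mul_nonneg (hw0 x) (sq_nonneg _))
      _ ≤ K ^ 2 := hK
  rw [mul_pow, inv_pow, ← div_eq_mul_inv, le_div_iff₀ (by positivity), mul_comm]
  exact this

/-- On [R, 2R] the weights give L = B R^{-N} and D = B R^{-1}, while κ is of order c R^{-s-1}; so
√(LD/κ) is of order R^{(s-N)/2}. The sup norm test would grow like R^{(s+1)/2} here. The length
condition of the L² test reads R^{1-N} ≤ R. -/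
theorem norm_integral_dyadic_le (h : AmplitudeBound N A B f f') (hB : 0 < B) {Φ Φ₁ Φ₂ : ℝ → ℝ}
    (hΦ : IsPhase Φ Φ₁ Φ₂) {s c R : ℝ} (hs : 0 < s) (hN : 0 ≤ N) (hc : 0 < c) (hR : 1 ≤ R)
    (hΦ₂ : (∀ x ∈ Icc R (R * 2), c * x ^ (-s - 1) ≤ Φ₂ x) ∨
      (∀ x ∈ Icc R (R * 2), Φ₂ x ≤ -(c * x ^ (-s - 1)))) :
    ‖∫ x in R..R * 2, Complex.exp (Complex.I * (Φ x : ℝ)) * f x‖ ≤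
      24 * (B * √(2 ^ (s + 1) / c) * √(R ^ (s - N))) := by
  have hR0 : 0 < R := by linarith
  have hR2 : R ≤ R * 2 := by linarith
  have hL : ∫ x in R..R * 2, ‖f x‖ ^ 2 ≤ (B * (R ^ N)⁻¹) ^ 2 := by
    refine integral_weight_le hR2 (by positivity) h.integrable_sq_weight h.sq_le
      ((h.continuous.norm.pow 2).intervalIntegrable _ _) (fun x => by positivity) fun x hx => ?_
    rw [← Real.rpow_natCast, ← Real.rpow_mul hR0.le, mul_comm, Real.rpow_mul hR0.le,
      Real.rpow_natCast]
    exact Real.rpow_le_rpow (by positivity) (by nlinarith [hx.1]) hN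
  have hD : ∫ x in R..R * 2, ‖f' x‖ ^ 2 ≤ (B * R⁻¹) ^ 2 :=
    integral_weight_le hR2 hR0 h.integrable_deriv_weight h.deriv_le
      (h.intervalIntegrable_sq _ _) (fun x => by positivity) fun x hx => by nlinarith [hx.1]
  set κ := c * (R * 2) ^ (-s - 1) with hκ
  have hκ0 : 0 < κ := by positivity
  have hmono : ∀ x ∈ Icc R (R * 2), κ ≤ c * x ^ (-s - 1) := by
    intro x hx
    have hx0 : 0 < x := hR0.trans_le hx.1
    exact mul_le_mul_of_nonneg_left (Real.rpow_le_rpow_of_nonpos hx0 hx.2 (by linarith)) hc.le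
  have := hΦ.norm_integral_exp_mul_le_sqrt h.toHasL2Deriv hR2 hκ0
    (hΦ₂.imp (fun h x hx => (hmono x hx).trans (h x hx))
      (fun h x hx => (h x hx).trans (neg_le_neg (hmono x hx))))
    (L := B * (R ^ N)⁻¹) (D := B * R⁻¹) (by positivity) (by positivity) ?_ hL hD
  · refine this.trans (le_of_eq ?_)
    have e : B * (R ^ N)⁻¹ * (B * R⁻¹) / κ = B ^ 2 * (2 ^ (s + 1) / c) * R ^ (s - N) := by
      have h1 : (R * 2) ^ (-s - 1) = ((2 : ℝ) ^ (s + 1))⁻¹ * (R ^ s * R)⁻¹ := by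
        rw [Real.mul_rpow hR0.le (by norm_num), ← Real.rpow_add_one hR0.ne',
          ← Real.rpow_neg hR0.le, ← Real.rpow_neg (by norm_num)]
        ring_nf
      rw [hκ, h1, Real.rpow_sub hR0]
      field_simp
    rw [e, Real.sqrt_mul (by positivity), Real.sqrt_mul (by positivity), Real.sqrt_sq hB.le]
  · have e : B * (R ^ N)⁻¹ / (B * R⁻¹) = R / R ^ N := by field_simp
    rw [e, show R * 2 - R = R by ring, div_le_iff₀ (by positivity)]
    nlinarith [Real.one_le_rpow hR hN]

/-- The blocks [M 2^k, M 2^{k+1}] form a geometric series of ratio 2^{(s-N)/2} < 1. This bounds the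
integrals over [M, M 2^n] uniformly in n, and the bound passes to the limit. -/
theorem norm_integral_Ioi_le (h : AmplitudeBound N A B f f') (hB : 0 < B) {Φ Φ₁ Φ₂ : ℝ → ℝ}
    (hΦ : IsPhase Φ Φ₁ Φ₂) {s c M : ℝ} (hs : 0 < s) (hsN : s < N) (hc : 0 < c) (hM : 1 ≤ M)
    (hΦ₂ : (∀ x, M ≤ x → c * x ^ (-s - 1) ≤ Φ₂ x) ∨
      (∀ x, M ≤ x → Φ₂ x ≤ -(c * x ^ (-s - 1)))) :
    ‖∫ x in Ioi M, Complex.exp (Complex.I * (Φ x : ℝ)) * f x‖ ≤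
      24 * (B * √(2 ^ (s + 1) / c)) * (1 - √(2 ^ (s - N)))⁻¹ := by
  set F : ℝ → ℂ := fun x => Complex.exp (Complex.I * (Φ x : ℝ)) * f x with hF
  have hFc : Continuous F := hΦ.continuous_exp_mul h.continuous
  have hFi : Integrable F volume := by
    refine (integrable_norm_iff hFc.aestronglyMeasurable).1 ?_
    simpa [hF, IsPhase.norm_exp] using h.integrable.norm
  set r := √((2 : ℝ) ^ (s - N)) with hr
  have hr0 : 0 ≤ r := Real.sqrt_nonneg _
  have hr1 : r < 1 := by
    rw [hr, Real.sqrt_lt' one_pos, one_pow]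
    exact Real.rpow_lt_one_of_one_lt_of_neg (by norm_num) (by linarith)
  set K := 24 * (B * √(2 ^ (s + 1) / c)) with hK
  have hK0 : 0 ≤ K := by positivity
  have hpiece : ∀ k : ℕ, ‖∫ x in M * 2 ^ k..M * 2 ^ (k + 1), F x‖ ≤ K * r ^ k := by
    intro k
    have h2k : (1 : ℝ) ≤ 2 ^ k := one_le_pow₀ (by norm_num)
    have hMk : M ≤ M * 2 ^ k := le_mul_of_one_le_right (by linarith) h2k
    rw [pow_succ, ← mul_assoc]
    refine (h.norm_integral_dyadic_le hB hΦ hs (by linarith) hc (hM.trans hMk)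
      (hΦ₂.imp (fun h x hx => h x (hMk.trans hx.1)) (fun h x hx => h x (hMk.trans hx.1)))).trans ?_
    rw [hK, ← mul_assoc 24]
    gcongr
    have e : r ^ k = √(((2 : ℝ) ^ k) ^ (s - N)) := by
      rw [hr, Real.sqrt_eq_rpow, Real.sqrt_eq_rpow, Real.rpow_pow_comm (by positivity),
        Real.rpow_pow_comm (by positivity)]
    rw [e]
    apply Real.sqrt_le_sqrt
    exact Real.rpow_le_rpow_of_nonpos (by positivity) (by nlinarith) (by linarith)
  have hpart : ∀ n : ℕ, ‖∫ x in M..M * 2 ^ n, F x‖ ≤ K * (1 - r)⁻¹ := by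
    intro n
    have := intervalIntegral.sum_integral_adjacent_intervals (f := F) (μ := volume)
      (a := fun k : ℕ => M * 2 ^ k) (n := n) (fun k _ => hFc.intervalIntegrable _ _)
    simp only [pow_zero, mul_one] at this
    rw [← this]
    calc _ ≤ ∑ k ∈ Finset.range n, K * r ^ k :=
          (norm_sum_le _ _).trans (Finset.sum_le_sum fun k _ => hpiece k)
      _ = K * ∑ k ∈ Finset.range n, r ^ k := by rw [Finset.mul_sum]
      _ ≤ K * (1 - r)⁻¹ := by
          rw [← tsum_geometric_of_lt_one hr0 hr1]
          exact mul_le_mul_of_nonneg_left ((summable_geometric_of_lt_one hr0 hr1).sum_le_tsum _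
            fun k _ => by positivity) hK0
  have hlim : Tendsto (fun n : ℕ => M * (2 : ℝ) ^ n) atTop atTop :=
    (tendsto_pow_atTop_atTop_of_one_lt (by norm_num)).const_mul_atTop (by linarith)
  exact le_of_tendsto (intervalIntegral_tendsto_integral_Ioi M hFi.integrableOn hlim).norm
    (Eventually.of_forall hpart)

end AmplitudeBound

end

/-! ### Decay of the oscillatory integrals with dispersive phase. -/

noncomputable section

theorem intervalIntegral_exp_mul_norm_le {Φ : ℝ → ℝ} {f : ℝ → ℂ} {A a b : ℝ} (hab : a ≤ b)
    (hf : ∀ x, ‖f x‖ ≤ A) :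
    ‖∫ x in a..b, Complex.exp (Complex.I * (Φ x : ℝ)) * f x‖ ≤ A * (b - a) := by
  have := intervalIntegral.norm_integral_le_of_norm_le_const (a := a) (b := b)
    (C := A) (f := fun x => Complex.exp (Complex.I * (Φ x : ℝ)) * f x) (fun x _ => by
      rw [norm_mul, IsPhase.norm_exp, one_mul]; exact hf x)
  rwa [abs_of_nonneg (sub_nonneg.2 hab)] at this

namespace AmplitudeBound

variable {N A B : ℝ} {f f' : ℝ → ℂ}

theorem norm_integral_le_of_le_abs_deriv_two (h : AmplitudeBound N A B f f') {Φ Φ₁ Φ₂ : ℝ → ℝ}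
    (hΦ : IsPhase Φ Φ₁ Φ₂) {a b κ : ℝ} (hab : a ≤ b) (hκ : 0 < κ)
    (hΦ₂ : (∀ x ∈ Icc a b, κ ≤ Φ₂ x) ∨ (∀ x ∈ Icc a b, Φ₂ x ≤ -κ)) :
    ‖∫ x in a..b, Complex.exp (Complex.I * (Φ x : ℝ)) * f x‖ ≤
      10 * A * κ ^ (-(1 / 2) : ℝ) + 2 * B * κ ^ (-(3 / 4) : ℝ) :=
  hΦ.norm_integral_exp_mul_le_of_le_abs_deriv_two h.toHasL2Deriv hab hκ hΦ₂
    (fun x _ => h.sup_le x) h.nonneg (h.integral_deriv_sq_le hab)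

theorem integrable_exp_mul (h : AmplitudeBound N A B f f') {Φ Φ₁ Φ₂ : ℝ → ℝ}
    (hΦ : IsPhase Φ Φ₁ Φ₂) :
    Integrable (fun x => Complex.exp (Complex.I * (Φ x : ℝ)) * f x) volume := by
  refine (integrable_norm_iff (hΦ.continuous_exp_mul h.continuous).aestronglyMeasurable).1 ?_
  simpa [IsPhase.norm_exp] using h.integrable.norm

/-- Splitting of `[0, M]` at the inflection points `0` and `x₀`. -/
theorem norm_integral_le_of_inflection (h : AmplitudeBound N A B f f') {Φ Φ₁ Φ₂ : ℝ → ℝ}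
    (hΦ : IsPhase Φ Φ₁ Φ₂) {M x₀ τ κ : ℝ} (hτ : 0 < τ) (hτM : τ ≤ M) (hκ : 0 < κ)
    (hl : ∀ x, τ ≤ x → x ≤ M → x ≤ x₀ - τ → Φ₂ x ≤ -κ)
    (hr : (∀ x, τ ≤ x → x ≤ M → x₀ + τ ≤ x → κ ≤ Φ₂ x) ∨
      (∀ x, τ ≤ x → x ≤ M → x₀ + τ ≤ x → Φ₂ x ≤ -κ)) :
    ‖∫ x in 0..M, Complex.exp (Complex.I * (Φ x : ℝ)) * f x‖ ≤
      3 * A * τ + 2 * (10 * A * κ ^ (-(1 / 2) : ℝ) + 2 * B * κ ^ (-(3 / 4) : ℝ)) := by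
  set F : ℝ → ℂ := fun x => Complex.exp (Complex.I * (Φ x : ℝ)) * f x with hF
  have hi : ∀ x y, IntervalIntegrable F volume x y := fun x y =>
    (hΦ.continuous_exp_mul h.continuous).intervalIntegrable x y
  have hA : 0 ≤ A := h.sup_nonneg
  have hB := h.nonneg
  have hE0 : 0 ≤ 10 * A * κ ^ (-(1 / 2) : ℝ) + 2 * B * κ ^ (-(3 / 4) : ℝ) := by positivity
  -- [τ, p] is left of x₀ - τ, [p, q] has length at most 2τ, and [q, M] is right of x₀ + τ. The
  -- truncations collapse a piece to a point when x₀ lies too far to one side.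
  set p := max τ (min (x₀ - τ) M)
  set q := max p (min (x₀ + τ) M)
  have hτp : τ ≤ p := le_max_left _ _
  have hpq : p ≤ q := le_max_left _ _
  have hpM : p ≤ M := max_le hτM (min_le_right _ _)
  have hqM : q ≤ M := max_le hpM (min_le_right _ _)
  have hlen : q - p ≤ 2 * τ := by
    rw [sub_le_iff_le_add]
    refine max_le (by linarith) ?_
    have : min (x₀ - τ) M ≤ p := le_max_right _ _
    rcases le_total (x₀ - τ) M with h1 | h1
    · rw [min_eq_left h1] at this
      linarith [min_le_left (x₀ + τ) M]
    · rw [min_eq_right h1] at this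
      linarith [min_le_right (x₀ + τ) M]
  have b1 : ‖∫ x in 0..τ, F x‖ ≤ A * τ := by
    simpa using intervalIntegral_exp_mul_norm_le (Φ := Φ) hτ.le h.sup_le
  have b2 : ‖∫ x in τ..p, F x‖ ≤
      10 * A * κ ^ (-(1 / 2) : ℝ) + 2 * B * κ ^ (-(3 / 4) : ℝ) := by
    rcases le_total (min (x₀ - τ) M) τ with h1 | h1
    · have : p = τ := max_eq_left h1
      rw [this, intervalIntegral.integral_same, norm_zero]; exact hE0
    · have : p = min (x₀ - τ) M := max_eq_right h1
      refine h.norm_integral_le_of_le_abs_deriv_two hΦ hτp hκ (Or.inr fun x hx => ?_)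
      exact hl x hx.1 (hx.2.trans hpM) (hx.2.trans (this ▸ min_le_left _ _))
  have b3 : ‖∫ x in p..q, F x‖ ≤ A * (2 * τ) :=
    (intervalIntegral_exp_mul_norm_le hpq h.sup_le).trans (mul_le_mul_of_nonneg_left hlen hA)
  have b4 : ‖∫ x in q..M, F x‖ ≤
      10 * A * κ ^ (-(1 / 2) : ℝ) + 2 * B * κ ^ (-(3 / 4) : ℝ) := by
    have hq : min (x₀ + τ) M ≤ q := le_max_right _ _
    rcases le_total (x₀ + τ) M with h1 | h1
    · rw [min_eq_left h1] at hq
      refine h.norm_integral_le_of_le_abs_deriv_two hΦ hqM hκ (hr.imp ?_ ?_) <;>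
      exact fun h2 x hx => h2 x ((hτp.trans hpq).trans hx.1) hx.2 (hq.trans hx.1)
    · rw [min_eq_right h1] at hq
      rw [le_antisymm hqM hq, intervalIntegral.integral_same, norm_zero]; exact hE0
  rw [← intervalIntegral.integral_add_adjacent_intervals (hi 0 τ) (hi τ M),
    ← intervalIntegral.integral_add_adjacent_intervals (hi τ p) (hi p M),
    ← intervalIntegral.integral_add_adjacent_intervals (hi p q) (hi q M)]
  refine (norm_add_le _ _).trans ?_
  refine (add_le_add_right ((norm_add_le _ _).trans (add_le_add_right (norm_add_le _ _) _)) _).trans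
    ?_
  linarith

end AmplitudeBound

/-- With τ = t^{-1/3} and κ = c t τ = c t^{2/3}, the size B = A t^{1/6} is exactly what makes B
κ^{-3/4} on [0, M] and B t^{-1/2} in the tail both of order A t^{-1/3}. -/
theorem exists_norm_integral_Ioi_dispersion_le {s N : ℝ} (hs : 0 < s) (hs1 : s ≠ 1) (hsN : s < N) :
    ∃ C : ℝ, 0 < C ∧ ∀ t : ℝ, 1 ≤ t → ∀ (y A : ℝ) (f f' : ℝ → ℂ),
      AmplitudeBound N A (A * t ^ (1 / 6 : ℝ)) f f' →
      ‖∫ x in Ioi 0, Complex.exp (Complex.I * ((t * dispersion s x + y * x : ℝ) : ℂ)) * f x‖ ≤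
        C * A * t ^ (-(1 / 3) : ℝ) := by
  obtain ⟨M, c, x₀, ε, hM, hc, hε, hl, hr, hinf⟩ := exists_dispersionDerivTwo_bounds hs hs1
  set r := √((2 : ℝ) ^ (s - N)) with hr_def
  have hr1 : r < 1 := by
    rw [hr_def, Real.sqrt_lt' one_pos, one_pow]
    exact Real.rpow_lt_one_of_one_lt_of_neg (by norm_num) (by linarith)
  have hr2 : 0 < (1 - r)⁻¹ := inv_pos.2 (by linarith)
  refine ⟨3 + 20 * c ^ (-(1 / 2) : ℝ) + 4 * c ^ (-(3 / 4) : ℝ)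
    + 24 * √(2 ^ (s + 1) / c) * (1 - r)⁻¹, by positivity, ?_⟩
  intro t ht y A f f' hf
  have ht0 : 0 < t := by linarith
  have hΦ := isPhase_dispersion s t y
  set F : ℝ → ℂ := fun x =>
    Complex.exp (Complex.I * ((t * dispersion s x + y * x : ℝ) : ℂ)) * f x with hF
  have hFi : Integrable F volume := hf.integrable_exp_mul hΦ
  -- The tail estimate needs B > 0; if A = 0 the amplitude vanishes.
  rcases hf.sup_nonneg.eq_or_lt with hA | hA
  · have : F = 0 := by
      funext x
      have := hf.sup_le x
      rw [← hA] at this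
      simp [hF, norm_le_zero_iff.1 this]
    rw [this, ← hA]; simp
  set τ := t ^ (-(1 / 3) : ℝ) with hτ
  have hτ0 : 0 < τ := by positivity
  have hτ1 : τ ≤ 1 := Real.rpow_le_one_of_one_le_of_nonpos ht (by norm_num)
  have htτ : t * τ = t ^ (2 / 3 : ℝ) := by
    nth_rw 1 [← Real.rpow_one t]
    rw [hτ, ← Real.rpow_add ht0]; norm_num
  have e1 : (c * (t * τ)) ^ (-(1 / 2) : ℝ) = c ^ (-(1 / 2) : ℝ) * τ := by
    rw [htτ, Real.mul_rpow hc.le (by positivity), ← Real.rpow_mul ht0.le]; norm_num [hτ]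
  have e2 : A * t ^ (1 / 6 : ℝ) * (c * (t * τ)) ^ (-(3 / 4) : ℝ) = A * c ^ (-(3 / 4) : ℝ) * τ := by
    rw [htτ, Real.mul_rpow hc.le (by positivity), ← Real.rpow_mul ht0.le]
    have : t ^ (1 / 6 : ℝ) * t ^ (2 / 3 * (-(3 / 4)) : ℝ) = τ := by
      rw [← Real.rpow_add ht0, hτ]; norm_num
    rw [← this]; ring
  have e3 : A * t ^ (1 / 6 : ℝ) * √(2 ^ (s + 1) / (c * t)) = A * √(2 ^ (s + 1) / c) * τ := by
    have h1 : √(2 ^ (s + 1) / (c * t)) = √(2 ^ (s + 1) / c) * t ^ (-(1 / 2) : ℝ) := by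
      rw [← div_div, Real.sqrt_div (by positivity), Real.sqrt_eq_rpow t, Real.rpow_neg ht0.le]; rfl
    have : t ^ (1 / 6 : ℝ) * t ^ (-(1 / 2) : ℝ) = τ := by
      rw [← Real.rpow_add ht0, hτ]; norm_num
    rw [h1, ← this]; ring
  have hcompact := hf.norm_integral_le_of_inflection hΦ hτ0 (hτ1.trans hM)
    (x₀ := x₀) (κ := c * (t * τ)) (by positivity)
    (fun x h1 h2 h3 => by nlinarith [hl τ hτ0 x h1 h2 h3]) (by
      rcases hε with rfl | rfl
      · exact Or.inl fun x h1 h2 h3 => by nlinarith [hr τ hτ0 x h1 h2 h3]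
      · exact Or.inr fun x h1 h2 h3 => by nlinarith [hr τ hτ0 x h1 h2 h3])
  have htail := hf.norm_integral_Ioi_le (by positivity) hΦ hs hsN (c := c * t) (M := M)
    (by positivity) hM (by
      rcases hε with rfl | rfl
      · exact Or.inl fun x h1 => by nlinarith [hinf x h1]
      · exact Or.inr fun x h1 => by nlinarith [hinf x h1])
  rw [e3] at htail
  rw [e1, mul_assoc 2 (A * t ^ (1 / 6 : ℝ)), e2] at hcompact
  have hsplit : ∫ x in Ioi 0, F x = (∫ x in 0..M, F x) + ∫ x in Ioi M, F x :=
    (intervalIntegral.integral_interval_add_Ioi hFi.integrableOn hFi.integrableOn).symm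
  rw [hsplit]
  refine (norm_add_le _ _).trans ((add_le_add hcompact htail).trans (le_of_eq ?_))
  ring

/-- The dispersion is odd, so reflection reverses the phase and conjugation restores it: negative
frequencies reduce to positive ones. -/
theorem norm_integral_Iic_dispersion (s t y : ℝ) (f : ℝ → ℂ) (a b : ℝ) :
    ‖∫ x in -b..-a, Complex.exp (Complex.I * ((t * dispersion s x + y * x : ℝ) : ℂ)) * f x‖ =
      ‖∫ x in a..b, Complex.exp (Complex.I * ((t * dispersion s x + y * x : ℝ) : ℂ)) *
        (starRingEnd ℂ) (f (-x))‖ := by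
  rw [← intervalIntegral.integral_comp_neg, ← IsPhase.norm_integral_exp_neg_mul]
  congr 2
  ext x
  simp only [dispersion_neg]
  congr 3
  push_cast; ring

theorem exists_norm_integral_dispersion_le {s N : ℝ} (hs : 0 < s) (hs1 : s ≠ 1) (hsN : s < N) :
    ∃ C : ℝ, 0 < C ∧ ∀ t : ℝ, 1 ≤ t → ∀ (y A : ℝ) (f f' : ℝ → ℂ),
      AmplitudeBound N A (A * t ^ (1 / 6 : ℝ)) f f' →
      ‖∫ x, Complex.exp (Complex.I * ((t * dispersion s x + y * x : ℝ) : ℂ)) * f x‖ ≤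
        C * A * t ^ (-(1 / 3) : ℝ) := by
  obtain ⟨C, hC, h⟩ := exists_norm_integral_Ioi_dispersion_le hs hs1 hsN
  refine ⟨2 * C, by positivity, fun t ht y A f f' hf => ?_⟩
  have h1 := h t ht y A f f' hf
  have h2 := h t ht y A _ _ hf.comp_neg.conj
  have hFi := hf.integrable_exp_mul (isPhase_dispersion s t y)
  have h3 : ‖∫ x in Iic 0, Complex.exp (Complex.I * ((t * dispersion s x + y * x : ℝ) : ℂ)) * f x‖
      ≤ C * A * t ^ (-(1 / 3) : ℝ) := by
    refine le_trans (le_of_eq ?_) h2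
    rw [← neg_zero, ← integral_comp_neg_Ioi, neg_zero, ← Complex.norm_conj, ← integral_conj]
    refine congrArg norm (integral_congr_ae (Eventually.of_forall fun x => ?_))
    simp only [dispersion_neg, map_mul, ← Complex.exp_conj, Complex.conj_I, Complex.conj_ofReal]
    congr 2
    push_cast
    ring
  rw [← intervalIntegral.integral_Iic_add_Ioi (b := 0) hFi.integrableOn hFi.integrableOn]
  refine (norm_add_le _ _).trans ((add_le_add h3 h1).trans (le_of_eq ?_))
  ring

/-- Below a multiple of ρ = τ√Y the derivative of the phase is dominated by y + t, and integration
by parts gives τ(Y⁻¹ + Y^{-3/4}). Above it the second derivative is at least of order τ⁻²Y^{1/2},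
which gives τ(Y^{-1/4} + Y^{-3/8}). The exponent -1/4 is the worst of the four. -/
theorem exists_norm_integral_low_le {s N : ℝ} (hs : 0 < s) (hs1 : s < 1 + 3 * 2 ^ 18) :
    ∃ C : ℝ, 0 < C ∧ ∀ t : ℝ, 1 ≤ t → ∀ (y A : ℝ) (f f' : ℝ → ℂ),
      AmplitudeBound N A (A * t ^ (1 / 6 : ℝ)) f f' →
      ‖∫ x in 0..(2 ^ 9 : ℝ)⁻¹,
        Complex.exp (Complex.I * ((t * dispersion s x + y * x : ℝ) : ℂ)) * f x‖ ≤
        C * A * (t ^ (-(1 / 3) : ℝ) *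
          (max 1 |(y + t) * t ^ (-(1 / 3) : ℝ)|) ^ (-(1 / 4) : ℝ)) := by
  obtain ⟨c, c₂, hc, hc₂, hb⟩ := exists_dispersion_low_bounds hs hs1
  -- The choice c₂k² ≤ 1/2 keeps t|p' - 1| below half of |y + t| on [0, kρ].
  set k := √(2 * c₂ + 1)⁻¹ with hk
  have hk0 : 0 < k := by positivity
  have hk1 : k ≤ 1 := by
    rw [hk, Real.sqrt_le_iff, one_pow]
    exact ⟨zero_le_one, inv_le_one_of_one_le₀ (by linarith)⟩
  have hkc : c₂ * k ^ 2 ≤ 1 / 2 := by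
    rw [hk, Real.sq_sqrt (by positivity), ← div_eq_mul_inv, div_le_div_iff₀] <;> linarith
  refine ⟨10 + 10 * (c * k) ^ (-(1 / 2) : ℝ) + 2 * (c * k) ^ (-(3 / 4) : ℝ), by positivity, ?_⟩
  intro t ht y A f f' hf
  have ht0 : 0 < t := by linarith
  have hA := hf.sup_nonneg
  have hΦ := isPhase_dispersion s t y
  set F : ℝ → ℂ := fun x =>
    Complex.exp (Complex.I * ((t * dispersion s x + y * x : ℝ) : ℂ)) * f x with hF
  set a := (2 ^ 9 : ℝ)⁻¹ with ha
  have ha0 : 0 < a := by positivity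
  set τ := t ^ (-(1 / 3) : ℝ) with hτ
  have hτ0 : 0 < τ := by positivity
  set X := (y + t) * τ with hX
  set Y := max 1 |X| with hY
  have hY1 : 1 ≤ Y := le_max_left _ _
  have hY0 : 0 < Y := by linarith
  have ht3 : t * τ ^ 3 = 1 := by
    rw [hτ, ← Real.rpow_natCast, ← Real.rpow_mul ht0.le]
    norm_num
    rw [Real.rpow_neg_one, mul_inv_cancel₀ ht0.ne']
  have ht6 : t ^ (1 / 6 : ℝ) = τ ^ (-(1 / 2) : ℝ) := by
    rw [hτ, ← Real.rpow_mul ht0.le]; norm_num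
  -- This is the scale where tρ² = Y/τ, which equals |y + t| once |X| ≥ 1.
  set ρ := τ * √Y with hρ
  have hρ0 : 0 < ρ := by positivity
  set q := min (k * ρ) a with hq
  have hq0 : 0 < q := lt_min (by positivity) ha0
  have hqa : q ≤ a := min_le_right _ _
  have hqk : q ≤ k * ρ := min_le_left _ _
  set Z := Y ^ (-(1 / 4) : ℝ) with hZ
  have hZ0 : 0 < Z := by positivity
  have hB : A * t ^ (1 / 6 : ℝ) = A * τ ^ (-(1 / 2) : ℝ) := by rw [ht6]
  -- the part with large second derivative
  have b2 : ‖∫ x in q..a, F x‖ ≤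
      (10 * (c * k) ^ (-(1 / 2) : ℝ) + 2 * (c * k) ^ (-(3 / 4) : ℝ)) * A * (τ * Z) := by
    rcases le_total a (k * ρ) with h1 | h1
    · have : q = a := min_eq_right h1
      rw [this, intervalIntegral.integral_same, norm_zero]; positivity
    · have hq' : q = k * ρ := min_eq_left h1
      have hκ : c * k * (t * ρ) = c * k * (τ ^ (-2 : ℝ) * Y ^ (1 / 2 : ℝ)) := by
        have : t * τ = τ ^ (-2 : ℝ) := by
          rw [Real.rpow_neg hτ0.le, Real.rpow_two]
          refine eq_inv_of_mul_eq_one_left ?_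
          rw [← ht3]; ring
        rw [hρ, Real.sqrt_eq_rpow, ← this]; ring
      refine (hf.norm_integral_le_of_le_abs_deriv_two hΦ hqa (κ := c * k * (t * ρ)) (by positivity)
        (Or.inr fun x hx => ?_)).trans ?_
      · have hx0 : 0 ≤ x := hq0.le.trans hx.1
        have h2 := (hb x hx0 hx.2).1
        have h3 : k * ρ ≤ x := hq' ▸ hx.1
        have h4 : c * (k * ρ) ≤ c * x := by gcongr
        calc t * dispersionDerivTwo s x ≤ t * (-(c * (k * ρ))) := by gcongr; linarith
          _ = _ := by ring
      · have e0 : ∀ r : ℝ, (c * k * (τ ^ (-2 : ℝ) * Y ^ (1 / 2 : ℝ))) ^ r =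
            (c * k) ^ r * (τ ^ (-2 * r) * Y ^ (1 / 2 * r)) := fun r => by
          rw [Real.mul_rpow (x := c * k) (by positivity) (by positivity),
            Real.mul_rpow (x := τ ^ (-2 : ℝ)) (by positivity) (by positivity), Real.rpow_mul hτ0.le,
            Real.rpow_mul hY0.le]
        rw [hκ, e0, e0, hB]
        have e1 : τ ^ (-2 * -(1 / 2) : ℝ) = τ := by norm_num
        have e2 : Y ^ (1 / 2 * -(1 / 2) : ℝ) = Z := by rw [hZ]; norm_num
        have e3 : τ ^ (-(1 / 2) : ℝ) * τ ^ (-2 * -(3 / 4) : ℝ) = τ := by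
          rw [← Real.rpow_add hτ0]; norm_num
        have e4 : Y ^ (1 / 2 * -(3 / 4) : ℝ) ≤ Z := by
          rw [hZ]; exact Real.rpow_le_rpow_of_exponent_le hY1 (by norm_num)
        rw [e1, e2]
        calc _ = 10 * (c * k) ^ (-(1 / 2) : ℝ) * A * (τ * Z) + 2 * (c * k) ^ (-(3 / 4) : ℝ) * A *
              (τ ^ (-(1 / 2) : ℝ) * τ ^ (-2 * -(3 / 4) : ℝ) * Y ^ (1 / 2 * -(3 / 4) : ℝ)) := by
              ring
          _ ≤ 10 * (c * k) ^ (-(1 / 2) : ℝ) * A * (τ * Z) + 2 * (c * k) ^ (-(3 / 4) : ℝ) * A *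
              (τ * Z) := by rw [e3]; gcongr
          _ = _ := by ring
  -- the part near the origin
  have b1 : ‖∫ x in 0..q, F x‖ ≤ 10 * A * (τ * Z) := by
    -- For |X| ≤ 1 the interval is shorter than τ and the trivial bound suffices; otherwise the
    -- phase is nonstationary on it.
    rcases le_total |X| 1 with h1 | h1
    · have hYe : Y = 1 := max_eq_left h1
      have hZe : Z = 1 := by rw [hZ, hYe, Real.one_rpow]
      have hqτ : q ≤ τ := by
        refine hqk.trans ?_
        rw [hρ, hYe, Real.sqrt_one, mul_one]
        nlinarith
      have := intervalIntegral_exp_mul_norm_le (Φ := fun x => t * dispersion s x + y * x)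
        hq0.le hf.sup_le
      rw [sub_zero] at this
      rw [hZe, mul_one]
      refine this.trans ?_
      nlinarith [mul_le_mul_of_nonneg_left hqτ hA, mul_nonneg hA hτ0.le]
    · have hYe : Y = |X| := max_eq_right h1
      set μ := Y / (2 * τ) with hμ
      have hμ0 : 0 < μ := by positivity
      have hμΦ : ∀ x ∈ Icc 0 q, μ ≤ |t * dispersionDeriv s x + y| := by
        intro x hx
        have h2 := (hb x hx.1 (hx.2.trans hqa)).2
        have h3 : |y + t| = Y / τ := by
          rw [hYe, hX, abs_mul, abs_of_pos hτ0]; field_simp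
        have hx2 : x ^ 2 ≤ k ^ 2 * (τ ^ 2 * Y) := by
          calc x ^ 2 ≤ (k * ρ) ^ 2 := by
                have := hx.1; have := hx.2.trans hqk; gcongr
            _ = k ^ 2 * (τ ^ 2 * Y) := by
                rw [hρ, mul_pow, mul_pow, Real.sq_sqrt hY0.le]
        have h4 : |t * (dispersionDeriv s x - 1)| ≤ Y / τ / 2 := by
          rw [abs_mul, abs_of_pos ht0]
          calc t * |dispersionDeriv s x - 1| ≤ t * (c₂ * (k ^ 2 * (τ ^ 2 * Y))) := by
                gcongr; exact h2.trans (by gcongr)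
            _ = (c₂ * k ^ 2) * (t * τ ^ 3) * (Y / τ) := by field_simp
            _ ≤ 1 / 2 * (Y / τ) := by rw [ht3, mul_one]; gcongr
            _ = _ := by ring
        have h5 : t * dispersionDeriv s x + y = (y + t) + t * (dispersionDeriv s x - 1) := by ring
        rw [h5]
        have h6 := abs_sub_abs_le_abs_sub (y + t) (-(t * (dispersionDeriv s x - 1)))
        rw [abs_neg, sub_neg_eq_add] at h6
        have h7 : μ = Y / τ / 2 := by rw [hμ]; field_simp
        linarith
      have hne : ∀ x ∈ Icc 0 q, |t * dispersionDeriv s x + y| ≠ 0 := fun x hx h0 => by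
        have := hμΦ x hx; linarith
      refine (norm_integral_exp_mul_le_of_le_abs_deriv hq0.le (fun x _ => hΦ.deriv_one x)
        (fun x _ => hΦ.deriv_two x) hΦ.cont.continuousOn (Or.inr fun x hx => ?_) hμ0 hμΦ
        hf.toHasL2Deriv (fun x _ => hf.sup_le x)).trans ?_
      · have := (hb x hx.1 (hx.2.trans hqa)).1
        have h3 : 0 ≤ c * x := mul_nonneg hc.le hx.1
        nlinarith
      · have hcs := intervalIntegral_norm_le_sqrt_mul hq0.le (hf.memLp.restrict _) hf.nonneg
          (hf.integral_deriv_sq_le hq0.le)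
        rw [sub_zero] at hcs
        have hint : ∫ x in 0..q, ‖f' x‖ / |t * dispersionDeriv s x + y| ≤
            (√q * (A * t ^ (1 / 6 : ℝ))) / μ := by
          calc _ ≤ ∫ x in 0..q, ‖f' x‖ / μ := by
                refine intervalIntegral.integral_mono_on hq0.le ?_
                  ((hf.intervalIntegrable 0 q).norm.div_const _) fun x hx => ?_
                · simp_rw [div_eq_mul_inv]
                  refine (hf.intervalIntegrable 0 q).norm.mul_continuousOn ?_
                  rw [uIcc_of_le hq0.le]
                  exact (hΦ.continuous_deriv.abs.continuousOn).inv₀ hne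
                · exact div_le_div_of_nonneg_left (norm_nonneg _) hμ0 (hμΦ x hx)
            _ = (∫ x in 0..q, ‖f' x‖) / μ := by rw [intervalIntegral.integral_div]
            _ ≤ _ := by gcongr
        have hY34 : Y ^ (-(3 / 4) : ℝ) ≤ Z := by
          rw [hZ]; exact Real.rpow_le_rpow_of_exponent_le hY1 (by norm_num)
        have hY11 : Y⁻¹ ≤ Z := by
          rw [hZ, ← Real.rpow_neg_one]
          exact Real.rpow_le_rpow_of_exponent_le hY1 (by norm_num)
        have hsq : √q ≤ τ ^ (1 / 2 : ℝ) * Y ^ (1 / 4 : ℝ) := by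
          have : q ≤ τ * √Y := hqk.trans (mul_le_of_le_one_left hρ0.le hk1)
          refine (Real.sqrt_le_sqrt this).trans (le_of_eq ?_)
          rw [Real.sqrt_mul hτ0.le, Real.sqrt_eq_rpow, Real.sqrt_eq_rpow, Real.sqrt_eq_rpow,
            ← Real.rpow_mul hY0.le]
          norm_num
        have h1 : 4 * A / μ ≤ 8 * A * (τ * Z) := by
          calc 4 * A / μ = 8 * A * (τ * Y⁻¹) := by rw [hμ]; field_simp; ring
            _ ≤ _ := by gcongr
        have h2 : (√q * (A * t ^ (1 / 6 : ℝ))) / μ ≤ 2 * A * (τ * Z) := by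
          calc (√q * (A * t ^ (1 / 6 : ℝ))) / μ
              ≤ (τ ^ (1 / 2 : ℝ) * Y ^ (1 / 4 : ℝ) * (A * τ ^ (-(1 / 2) : ℝ))) / μ := by
                rw [hB]; gcongr
            _ = 2 * A * (τ * ((τ ^ (1 / 2 : ℝ) * τ ^ (-(1 / 2) : ℝ)) *
                (Y ^ (1 / 4 : ℝ) * Y⁻¹))) := by
                rw [hμ]; field_simp
            _ = 2 * A * (τ * Y ^ (-(3 / 4) : ℝ)) := by
                rw [← Real.rpow_add hτ0, ← Real.rpow_neg_one Y, ← Real.rpow_add hY0]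
                norm_num
            _ ≤ _ := by gcongr
        linarith
  have hi : ∀ x y, IntervalIntegrable F volume x y := fun x y =>
    (hΦ.continuous_exp_mul hf.continuous).intervalIntegrable x y
  rw [← intervalIntegral.integral_add_adjacent_intervals (hi 0 q) (hi q a)]
  refine (norm_add_le _ _).trans ((add_le_add b1 b2).trans (le_of_eq ?_))
  ring

end

/-! ### The Fourier transform on L² and weak derivatives. -/

noncomputable section

theorem ae_eq_of_integral_schwartz_mul_eq {u v : ℝ → ℂ} (hu : LocallyIntegrable u volume)
    (hv : LocallyIntegrable v volume)
    (h : ∀ ψ : 𝓢(ℝ, ℂ), ∫ x, ψ x * u x = ∫ x, ψ x * v x) : u =ᵐ[volume] v := by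
  refine ae_eq_of_integral_contDiff_smul_eq hu hv fun g hg hgc => ?_
  have hg₁ : HasCompactSupport (Complex.ofRealCLM ∘ g) := hgc.comp_left rfl
  have hg₂ : ContDiff ℝ ∞ (Complex.ofRealCLM ∘ g) := by fun_prop
  simpa using h (hg₁.toSchwartzMap hg₂)

theorem integral_mul_coeFn_fourier (U : Lp ℂ 2 (volume : Measure ℝ)) (ψ : 𝓢(ℝ, ℂ)) :
    ∫ x, ψ x * (𝓕 U : Lp ℂ 2 (volume : Measure ℝ)) x = ∫ x, 𝓕 ψ x * U x := by
  have := congrArg (fun T : TemperedDistribution ℝ ℂ => T ψ) (Lp.fourier_toTemperedDistribution_eq U)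
  simpa [TemperedDistribution.fourier_apply] using this.symm

theorem integral_mul_coeFn_fourierInv (U : Lp ℂ 2 (volume : Measure ℝ)) (ψ : 𝓢(ℝ, ℂ)) :
    ∫ x, ψ x * (𝓕⁻ U : Lp ℂ 2 (volume : Measure ℝ)) x = ∫ x, 𝓕⁻ ψ x * U x := by
  have := congrArg (fun T : TemperedDistribution ℝ ℂ => T ψ)
    (Lp.fourierInv_toTemperedDistribution_eq U)
  simpa [TemperedDistribution.fourierInv_apply] using this.symm

theorem locallyIntegrable_coeFn (U : Lp ℂ 2 (volume : Measure ℝ)) :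
    LocallyIntegrable U volume := (Lp.memLp U).locallyIntegrable (by norm_num)

theorem continuous_fourier_of_integrable {g : ℝ → ℂ} (hg : Integrable g volume) :
    Continuous (𝓕 g) :=
  VectorFourier.fourierIntegral_continuous Real.continuous_fourierChar
    (by exact continuous_inner) hg

theorem integral_fourier_mul_eq {f g : ℝ → ℂ} (hf : Integrable f volume)
    (hg : Integrable g volume) : ∫ x, 𝓕 f x * g x = ∫ x, f x * 𝓕 g x := by
  have := VectorFourier.integral_fourierIntegral_smul_eq_flip (L := innerₗ ℝ)
    Real.continuous_fourierChar continuous_inner hf hg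
  rw [flip_innerₗ] at this
  exact this

/-- The L² transform is defined by extension, the other one by an integral; both satisfy the same
multiplication formula against Schwartz functions, so they agree almost everywhere. -/
theorem coeFn_fourier_toLp {g : ℝ → ℂ} (h1 : Integrable g volume) (h2 : MemLp g 2 volume) :
    (𝓕 (h2.toLp g) : Lp ℂ 2 (volume : Measure ℝ)) =ᵐ[volume] 𝓕 g := by
  refine ae_eq_of_integral_schwartz_mul_eq (locallyIntegrable_coeFn _)
    (continuous_fourier_of_integrable h1).locallyIntegrable fun ψ => ?_
  rw [integral_mul_coeFn_fourier, ← integral_fourier_mul_eq ψ.integrable h1]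
  refine integral_congr_ae ?_
  filter_upwards [h2.coeFn_toLp] with x hx
  rw [hx]; rfl

theorem coeFn_fourierInv_toLp {g : ℝ → ℂ} (h1 : Integrable g volume) (h2 : MemLp g 2 volume) :
    (𝓕⁻ (h2.toLp g) : Lp ℂ 2 (volume : Measure ℝ)) =ᵐ[volume] 𝓕⁻ g := by
  have e : 𝓕⁻ g = fun x => 𝓕 g (-x) := by ext x; exact Real.fourierInv_eq_fourier_neg g x
  refine ae_eq_of_integral_schwartz_mul_eq (locallyIntegrable_coeFn _) ?_ fun ψ => ?_
  · rw [e]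
    exact ((continuous_fourier_of_integrable h1).comp continuous_neg).locallyIntegrable
  rw [integral_mul_coeFn_fourierInv]
  have h3 : ∫ x, 𝓕 (fun y => ψ (-y)) x * g x = ∫ x, ψ (-x) * 𝓕 g x :=
    integral_fourier_mul_eq ψ.integrable.comp_neg h1
  have h4 : ∫ x, ψ (-x) * 𝓕 g x = ∫ x, ψ x * 𝓕⁻ g x := by
    rw [← integral_neg_eq_self]
    simp [Real.fourierInv_eq_fourier_neg]
  rw [← h4, ← h3]
  refine integral_congr_ae ?_
  filter_upwards [h2.coeFn_toLp] with x hx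
  rw [hx, SchwartzMap.fourierInv_coe, Real.fourierInv_eq_fourier_comp_neg]

/-- Multiplication of a Schwartz function by `-2πiη`. -/
def freqMul (ψ : 𝓢(ℝ, ℂ)) : 𝓢(ℝ, ℂ) :=
  -(2 * Real.pi * Complex.I) • SchwartzMap.smulLeftCLM ℂ (fun y : ℝ => inner ℝ y (1 : ℝ)) ψ

theorem freqMul_apply (ψ : 𝓢(ℝ, ℂ)) (x : ℝ) :
    freqMul ψ x = -(2 * Real.pi * Complex.I) * x * ψ x := by
  have hin : (fun y : ℝ => inner ℝ y (1 : ℝ)).HasTemperateGrowth := by fun_prop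
  have := SchwartzMap.smulLeftCLM_apply_apply (𝕜 := ℝ) hin ψ x
  rw [freqMul, smul_apply, this]
  simp
  ring

theorem deriv_fourier_eq (ψ : 𝓢(ℝ, ℂ)) (x : ℝ) :
    deriv (𝓕 ψ : 𝓢(ℝ, ℂ)) x = (𝓕 (freqMul ψ) : 𝓢(ℝ, ℂ)) x := by
  rw [freqMul, ← SchwartzMap.lineDerivOp_fourier_eq, SchwartzMap.lineDerivOp_apply_eq_fderiv]
  exact fderiv_apply_one_eq_deriv.symm

/-- If `2πiη û ∈ L²`, its inverse Fourier transform is the weak derivative of `u`. -/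
theorem integral_deriv_mul_eq_neg {u w : Lp ℂ 2 (volume : Measure ℝ)}
    (hw : (𝓕 w : Lp ℂ 2 (volume : Measure ℝ)) =ᵐ[volume] fun η =>
      2 * Real.pi * Complex.I * η * (𝓕 u : Lp ℂ 2 (volume : Measure ℝ)) η)
    (χ : 𝓢(ℝ, ℂ)) : ∫ x, deriv χ x * u x = -∫ x, χ x * w x := by
  have hχ : 𝓕 (𝓕⁻ χ) = χ := FourierTransform.fourier_fourierInv_eq χ
  have h1 : ∫ x, χ x * w x =
      ∫ η, 𝓕⁻ χ η * (2 * Real.pi * Complex.I * η * (𝓕 u : Lp ℂ 2 (volume : Measure ℝ)) η) := by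
    conv_lhs => rw [← hχ]
    rw [← integral_mul_coeFn_fourier]
    refine integral_congr_ae ?_
    filter_upwards [hw] with x hx
    rw [hx]
  have hd : ∀ x, deriv χ x = (𝓕 (freqMul (𝓕⁻ χ)) : 𝓢(ℝ, ℂ)) x := fun x => by
    rw [← deriv_fourier_eq, hχ]
  simp_rw [hd]
  rw [← integral_mul_coeFn_fourier, h1, ← integral_neg]
  congr 1
  ext η
  rw [freqMul_apply]
  ring

/-- The bounded multiplier `x / ⟨x⟩`. -/
def unitWeight (x : ℝ) : ℝ := x * (1 + x ^ 2) ^ (-(1 / 2) : ℝ)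

/-- The derivative of `unitWeight`. -/
def unitWeightDeriv (x : ℝ) : ℝ := (1 + x ^ 2) ^ (-(3 / 2) : ℝ)

theorem hasDerivAt_unitWeight (x : ℝ) : HasDerivAt unitWeight (unitWeightDeriv x) x := by
  convert! (hasDerivAt_id x).mul (hasDerivAt_one_add_sq_rpow (-(1 / 2)) x) using 1
  have hw : (0 : ℝ) < 1 + x ^ 2 := by positivity
  have h1 : (1 + x ^ 2) ^ (-(1 / 2) : ℝ) = (1 + x ^ 2) ^ (-(3 / 2) : ℝ) * (1 + x ^ 2) := by
    rw [← Real.rpow_add_one hw.ne']; norm_num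
  have h2 : (-(1 / 2) - 1 : ℝ) = -(3 / 2) := by norm_num
  rw [unitWeightDeriv, h1, h2, id]; ring

theorem hasTemperateGrowth_unitWeight :
    (fun x : ℝ => (unitWeight x : ℂ)).HasTemperateGrowth := by
  have h1 : (fun x : ℝ => (1 + ‖x‖ ^ 2) ^ (-(1 / 2) : ℝ)).HasTemperateGrowth :=
    Function.hasTemperateGrowth_one_add_norm_sq_rpow ℝ _
  have h2 : (fun x : ℝ => unitWeight x).HasTemperateGrowth := by
    have := (Function.HasTemperateGrowth.id' (E := ℝ)).mul h1
    simp only [Real.norm_eq_abs, sq_abs] at this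
    exact this
  fun_prop

theorem unitWeight_mul_japBracket (x : ℝ) : unitWeight x * japBracket x = x := by
  have hw : (0 : ℝ) < 1 + x ^ 2 := by positivity
  rw [unitWeight, japBracket, Real.sqrt_eq_rpow, mul_assoc, ← Real.rpow_add hw]
  norm_num

theorem one_le_japBracket (x : ℝ) : 1 ≤ japBracket x := by
  rw [japBracket, Real.one_le_sqrt]; nlinarith [sq_nonneg x]

theorem abs_unitWeight_le (x : ℝ) : |unitWeight x| ≤ 1 := by
  have h1 := unitWeight_mul_japBracket x
  have h2 : |x| ≤ japBracket x := Real.abs_le_sqrt (by linarith)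
  have h3 : |unitWeight x| * japBracket x = |x| := by
    conv_rhs => rw [← h1]
    rw [abs_mul, abs_of_pos (a := japBracket x) (by linarith [one_le_japBracket x])]
  have h4 := one_le_japBracket x
  by_contra! h5
  nlinarith

theorem abs_unitWeightDeriv_le (x : ℝ) : |unitWeightDeriv x| ≤ 1 := by
  rw [unitWeightDeriv, abs_of_nonneg (by positivity)]
  exact Real.rpow_le_one_of_one_le_of_nonpos (by nlinarith [sq_nonneg x]) (by norm_num)

theorem continuous_unitWeight : Continuous unitWeight :=
  continuous_iff_continuousAt.2 fun x => (hasDerivAt_unitWeight x).continuousAt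

theorem continuous_unitWeightDeriv : Continuous unitWeightDeriv :=
  (by fun_prop : Continuous fun x : ℝ => 1 + x ^ 2).rpow_const fun x => Or.inl (by positivity)

theorem memLp_ofReal_mul {a : ℝ → ℝ} (ha : Continuous a) (hb : ∀ x, |a x| ≤ 1) {u : ℝ → ℂ}
    (hu : MemLp u 2 volume) : MemLp (fun x => (a x : ℂ) * u x) 2 volume := by
  refine MemLp.of_le hu
    ((Complex.continuous_ofReal.comp ha).aestronglyMeasurable.mul hu.1)
    (Eventually.of_forall fun x => ?_)
  rw [norm_mul, Complex.norm_real, Real.norm_eq_abs]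
  exact mul_le_of_le_one_left (norm_nonneg _) (hb x)

/-- Multiplication by `x / ⟨x⟩` preserves `H¹`. -/
theorem fourier_unitWeight_mul {u w v : Lp ℂ 2 (volume : Measure ℝ)}
    (hw : (𝓕 w : Lp ℂ 2 (volume : Measure ℝ)) =ᵐ[volume] fun η =>
      2 * Real.pi * Complex.I * η * (𝓕 u : Lp ℂ 2 (volume : Measure ℝ)) η)
    (hv : v =ᵐ[volume] fun x => (unitWeight x : ℂ) * u x) :
    ∃ z : Lp ℂ 2 (volume : Measure ℝ), ‖z‖ ≤ ‖w‖ + ‖u‖ ∧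
      (fun η => 2 * Real.pi * Complex.I * η * (𝓕 v : Lp ℂ 2 (volume : Measure ℝ)) η)
        =ᵐ[volume] z := by
  have m1 := memLp_ofReal_mul continuous_unitWeight abs_unitWeight_le (Lp.memLp w)
  have m2 := memLp_ofReal_mul continuous_unitWeightDeriv abs_unitWeightDeriv_le (Lp.memLp u)
  have hle : ∀ {a : ℝ → ℝ} {y : Lp ℂ 2 (volume : Measure ℝ)} (_ : ∀ x, |a x| ≤ 1)
      (m : MemLp (fun x => (a x : ℂ) * y x) 2 volume), ‖m.toLp‖ ≤ ‖y‖ := by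
    intro a y ha m
    refine Lp.norm_le_norm_of_ae_le ?_
    filter_upwards [m.coeFn_toLp] with x hx
    rw [hx, norm_mul, Complex.norm_real, Real.norm_eq_abs]
    exact mul_le_of_le_one_left (norm_nonneg _) (ha x)
  -- By the product rule the weak derivative of v is (x/⟨x⟩)w + (x/⟨x⟩)'u, where w is that of u; z
  -- is its Fourier transform. Both multipliers are bounded by 1.
  refine ⟨𝓕 (m1.toLp + m2.toLp), ?_, ?_⟩
  · rw [Lp.norm_fourier_eq]
    exact (norm_add_le _ _).trans
      (add_le_add (hle abs_unitWeight_le m1) (hle abs_unitWeightDeriv_le m2))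
  · refine ae_eq_of_integral_schwartz_mul_eq ?_ (locallyIntegrable_coeFn _) fun ψ => ?_
    · exact (locallyIntegrable_coeFn _).continuous_mul (by fun_prop)
    rw [integral_mul_coeFn_fourier]
    set ψ₁ : 𝓢(ℝ, ℂ) := freqMul ψ with hψ₁
    set θ : 𝓢(ℝ, ℂ) := 𝓕 ψ with hθ
    set χ : 𝓢(ℝ, ℂ) := SchwartzMap.smulLeftCLM ℂ (fun x : ℝ => (unitWeight x : ℂ)) θ with hχ
    have hχa : ∀ x, χ x = unitWeight x * θ x := fun x =>
      SchwartzMap.smulLeftCLM_apply_apply hasTemperateGrowth_unitWeight θ x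
    have hd : ∀ x, (𝓕 ψ₁ : 𝓢(ℝ, ℂ)) x = deriv θ x := fun x => (deriv_fourier_eq ψ x).symm
    have hdχ : ∀ x, deriv χ x = unitWeight x * deriv θ x + unitWeightDeriv x * θ x := by
      intro x
      have e : (χ : ℝ → ℂ) = fun x => (unitWeight x : ℂ) * θ x := funext hχa
      rw [e, ((hasDerivAt_unitWeight x).ofReal_comp.fun_mul (θ.hasDerivAt x)).deriv]
      ring
    set M₁ : Lp ℂ 2 (volume : Measure ℝ) := m1.toLp _
    set M₂ : Lp ℂ 2 (volume : Measure ℝ) := m2.toLp _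
    have e1 : ∫ x, ψ x * (2 * Real.pi * Complex.I * x * (𝓕 v : Lp ℂ 2 (volume : Measure ℝ)) x)
        = -∫ x, ψ₁ x * (𝓕 v : Lp ℂ 2 (volume : Measure ℝ)) x := by
      rw [← integral_neg]
      congr 1; ext x
      rw [hψ₁, freqMul_apply]
      ring
    have e2 : ∫ x, 𝓕 ψ₁ x * v x = ∫ x, (deriv χ x * u x - θ x * M₂ x) := by
      refine integral_congr_ae ?_
      filter_upwards [hv, m2.coeFn_toLp] with x h1 h2
      rw [hd, h1, h2, hdχ]; ring
    have isw : ∀ (θ : 𝓢(ℝ, ℂ)) (y : Lp ℂ 2 (volume : Measure ℝ)),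
        Integrable (fun x => θ x * y x) volume := fun θ y =>
      (θ.memLp 2).integrable_mul (Lp.memLp y)
    have e3 : ∫ x, θ x * (M₁ + M₂) x
        = (∫ x, χ x * w x) + ∫ x, θ x * M₂ x := by
      rw [← integral_add (isw χ w) (isw _ _)]
      refine integral_congr_ae ?_
      filter_upwards [Lp.coeFn_add M₁ M₂, m1.coeFn_toLp] with x h1 h2
      rw [h1, Pi.add_apply, h2, hχa]; ring
    have i1 : Integrable (fun x => deriv χ x * u x) volume := by
      have := isw (SchwartzMap.derivCLM ℂ ℂ χ) u
      simpa [SchwartzMap.derivCLM_apply] using this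
    rw [e1, integral_mul_coeFn_fourier, e2, e3, integral_sub i1 (isw _ _),
      integral_deriv_mul_eq_neg hw χ]
    ring

end

/-! ### From the norms of g to the amplitude bounds for its Fourier transform. -/

noncomputable section

/-- Pointwise 2|f| ≤ (1+x²)|f|² + (1+x²)⁻¹. It serves on both sides: for g through its weight, and
for ĝ because N₀ ≥ 1. -/
theorem integrable_of_weight {f : ℝ → ℂ} (hf : AEStronglyMeasurable f volume)
    (h : Integrable (fun x => (1 + x ^ 2) * ‖f x‖ ^ 2) volume) : Integrable f volume := by
  refine Integrable.mono' ((h.add integrable_inv_one_add_sq).div_const 2) hf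
    (Eventually.of_forall fun x => ?_)
  have hw : (0 : ℝ) < 1 + x ^ 2 := by positivity
  have hs : 0 < √(1 + x ^ 2) := Real.sqrt_pos.2 hw
  have h1 : √(1 + x ^ 2) * √(1 + x ^ 2) = 1 + x ^ 2 := Real.mul_self_sqrt hw.le
  have h2 := two_mul_le_add_sq (√(1 + x ^ 2) * ‖f x‖) (√(1 + x ^ 2))⁻¹
  have h3 : 2 * (√(1 + x ^ 2) * ‖f x‖) * (√(1 + x ^ 2))⁻¹ = 2 * ‖f x‖ := by field_simp
  have h4 : (√(1 + x ^ 2) * ‖f x‖) ^ 2 + (√(1 + x ^ 2))⁻¹ ^ 2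
      = (1 + x ^ 2) * ‖f x‖ ^ 2 + (1 + x ^ 2)⁻¹ := by
    rw [mul_pow, inv_pow, Real.sq_sqrt hw.le]
  rw [h3, h4] at h2
  simp only [Pi.add_apply]
  linarith

theorem integral_norm_sq_le_of_eLpNorm_le {W : ℝ → ℂ} {B : ℝ} (hB : 0 ≤ B)
    (hW : AEStronglyMeasurable W volume) (h : eLpNorm W 2 volume ≤ ENNReal.ofReal B) :
    Integrable (fun x => ‖W x‖ ^ 2) volume ∧ ∫ x, ‖W x‖ ^ 2 ≤ B ^ 2 := by
  have hm : MemLp W 2 volume := ⟨hW, h.trans_lt ENNReal.ofReal_lt_top⟩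
  refine ⟨(memLp_two_iff_integrable_sq_norm hW).1 hm, ?_⟩
  rw [hm.eLpNorm_eq_integral_rpow_norm (by norm_num) (by norm_num),
    ENNReal.ofReal_le_ofReal_iff hB] at h
  simp only [ENNReal.toReal_ofNat, Real.rpow_two] at h
  rw [← one_div, ← Real.sqrt_eq_rpow, Real.sqrt_le_iff] at h
  exact h.2

theorem integral_norm_sq_coeFn_le {U : Lp ℂ 2 (volume : Measure ℝ)} {B : ℝ} (hB : 0 ≤ B)
    (h : ‖U‖ ≤ B) :
    Integrable (fun x => ‖U x‖ ^ 2) volume ∧ ∫ x, ‖U x‖ ^ 2 ≤ B ^ 2 := by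
  refine integral_norm_sq_le_of_eLpNorm_le hB (Lp.aestronglyMeasurable U) ?_
  rw [← Lp.enorm_def, ← ofReal_norm]
  exact ENNReal.ofReal_le_ofReal h

theorem norm_le_of_integral_norm_sq_le {U : Lp ℂ 2 (volume : Measure ℝ)} {B : ℝ} (hB : 0 ≤ B)
    (h : ∫ x, ‖U x‖ ^ 2 ≤ B ^ 2) : ‖U‖ ≤ B := by
  rw [Lp.norm_def, (Lp.memLp U).eLpNorm_eq_integral_rpow_norm (by norm_num) (by norm_num),
    ENNReal.toReal_ofReal (by positivity)]
  simp only [ENNReal.toReal_ofNat, Real.rpow_two]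
  rw [← one_div, ← Real.sqrt_eq_rpow, Real.sqrt_le_iff]
  exact ⟨hB, h⟩

theorem sobolevNorm_le_ofReal {σ B : ℝ} {f : ℝ → ℝ} (hB : 0 ≤ B)
    (h : sobolevNorm σ f ≤ ENNReal.ofReal B) :
    ∃ hf : MemLp (fun x : ℝ => (f x : ℂ)) 2 (volume : Measure ℝ),
      Integrable (fun η : ℝ => (1 + (2 * Real.pi * η) ^ 2) ^ σ *
        ‖(𝓕 (hf.toLp (fun x : ℝ => (f x : ℂ))) : Lp ℂ 2 (volume : Measure ℝ)) η‖ ^ 2) volume ∧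
      ∫ η : ℝ, (1 + (2 * Real.pi * η) ^ 2) ^ σ *
        ‖(𝓕 (hf.toLp (fun x : ℝ => (f x : ℂ))) : Lp ℂ 2 (volume : Measure ℝ)) η‖ ^ 2 ≤ B ^ 2 := by
  -- For f outside L² the infimum defining the norm is over an empty family and equals ∞.
  have hf : MemLp (fun x : ℝ => (f x : ℂ)) 2 (volume : Measure ℝ) := by
    by_contra hf
    rw [sobolevNorm, iInf_neg hf, top_le_iff] at h
    exact ENNReal.ofReal_ne_top h
  refine ⟨hf, ?_⟩
  rw [sobolevNorm, iInf_pos hf] at h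
  have hc : Continuous fun η : ℝ => ((japBracket (2 * Real.pi * η) ^ σ : ℝ) : ℂ) := by
    refine Complex.continuous_ofReal.comp (Continuous.rpow_const ?_ fun x => Or.inl ?_)
    · unfold japBracket; fun_prop
    · linarith [one_le_japBracket (2 * Real.pi * x)]
  have := integral_norm_sq_le_of_eLpNorm_le hB
    (hc.aestronglyMeasurable.mul (Lp.aestronglyMeasurable _)) h
  have e : ∀ η : ℝ, ‖((japBracket (2 * Real.pi * η) ^ σ : ℝ) : ℂ) *
      (𝓕 (hf.toLp (fun x : ℝ => (f x : ℂ))) : Lp ℂ 2 (volume : Measure ℝ)) η‖ ^ 2 =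
      (1 + (2 * Real.pi * η) ^ 2) ^ σ *
        ‖(𝓕 (hf.toLp (fun x : ℝ => (f x : ℂ))) : Lp ℂ 2 (volume : Measure ℝ)) η‖ ^ 2 := by
    intro η
    rw [norm_mul, mul_pow, Complex.norm_real, Real.norm_eq_abs, sq_abs, japBracket,
      Real.sqrt_eq_rpow, ← Real.rpow_natCast, ← Real.rpow_mul (by positivity),
      ← Real.rpow_mul (by positivity)]
    congr 2
    push_cast; ring
  simpa only [Pi.mul_apply, e] using this

/-- The fundamental theorem of calculus for the Fourier transform of `g` when `x g ∈ L²`. -/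
theorem fourier_sub_eq_intervalIntegral {g : ℝ → ℂ} (hg : Integrable g volume)
    {v : Lp ℂ 2 (volume : Measure ℝ)} (hv : v =ᵐ[volume] fun x => (x : ℂ) * g x) (α β : ℝ) :
    𝓕 g β - 𝓕 g α = ∫ η in α..β,
      -(2 * Real.pi * Complex.I) * (𝓕 v : Lp ℂ 2 (volume : Measure ℝ)) η := by
  wlog hαβ : α ≤ β generalizing α β
  · rw [intervalIntegral.integral_symm, ← this β α (le_of_not_ge hαβ)]; ring
  have hms : MeasurableSet (Ioc α β) := measurableSet_Ioc
  have hμs : volume (Ioc α β) ≠ (⊤ : ℝ≥0∞) := by simp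
  -- Only 𝓕v ∈ L² is known, so its integral is read as a pairing with the indicator of (α, β].
  -- Plancherel moves the transform onto the indicator, where 2πix times the inverse transform is
  -- e^{2πixβ} - e^{2πixα}.
  have hin : inner ℂ (indicatorConstLp 2 hms hμs (1 : ℂ)) (𝓕 v : Lp ℂ 2 (volume : Measure ℝ))
      = ∫ η in α..β, (𝓕 v : Lp ℂ 2 (volume : Measure ℝ)) η := by
    rw [L2.inner_indicatorConstLp_one, intervalIntegral.integral_of_le hαβ]
  have h2 : MemLp ((Ioc α β).indicator fun _ => (1 : ℂ)) 2 volume :=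
    memLp_indicator_const 2 hms 1 (Or.inr hμs)
  have h1 : Integrable ((Ioc α β).indicator fun _ => (1 : ℂ)) volume :=
    (integrable_indicator_iff hms).2 (integrableOn_const hμs)
  have hχ : indicatorConstLp 2 hms hμs (1 : ℂ) = h2.toLp _ := rfl
  have hP : inner ℂ (𝓕⁻ (h2.toLp _) : Lp ℂ 2 (volume : Measure ℝ)) v =
      inner ℂ (h2.toLp _) (𝓕 v : Lp ℂ 2 (volume : Measure ℝ)) := by
    rw [← Lp.inner_fourier_eq, FourierTransform.fourier_fourierInv_eq]
  rw [hχ, ← hP, L2.inner_def] at hin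
  rw [intervalIntegral.integral_const_mul, ← hin, ← integral_const_mul]
  have hk : ∀ x : ℝ, 2 * Real.pi * Complex.I * x *
      𝓕⁻ ((Ioc α β).indicator fun _ => (1 : ℂ)) x =
      Complex.exp ((2 * Real.pi * Complex.I * x) * β) -
        Complex.exp ((2 * Real.pi * Complex.I * x) * α) := by
    intro x
    rw [Real.fourierInv_eq']
    have e : ∀ y : ℝ, Complex.exp (((2 * Real.pi * inner ℝ y x : ℝ) : ℂ) * Complex.I) •
        (Ioc α β).indicator (fun _ => (1 : ℂ)) y =
        (Ioc α β).indicator (fun y : ℝ => Complex.exp ((2 * Real.pi * Complex.I * x) * y)) y := by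
      intro y
      by_cases hy : y ∈ Ioc α β
      · simp only [indicator_of_mem hy, smul_eq_mul, mul_one]
        congr 1
        simp
        ring
      · simp [indicator_of_notMem hy]
    simp_rw [e]
    rw [integral_indicator hms, ← intervalIntegral.integral_of_le hαβ,
      ← intervalIntegral.integral_const_mul]
    apply intervalIntegral.integral_eq_sub_of_hasDerivAt
      (f := fun y : ℝ => Complex.exp ((2 * Real.pi * Complex.I * x) * y))
    · intro y _
      have := ((hasDerivAt_id (y : ℂ)).const_mul (2 * Real.pi * Complex.I * x)).cexp.comp_ofReal
      convert! this using 1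
      simp; ring
    · exact Continuous.intervalIntegrable (by fun_prop) _ _
  have hexp : ∀ x y : ℝ, (starRingEnd ℂ) (Complex.exp ((2 * Real.pi * Complex.I * x) * y)) =
      Complex.exp (((-2 * Real.pi * x * y : ℝ) : ℂ) * Complex.I) := by
    intro x y
    rw [← Complex.exp_conj]
    congr 1
    simp [Complex.conj_ofNat]
    ring
  have hi : ∀ y : ℝ, Integrable (fun x : ℝ =>
      Complex.exp (((-2 * Real.pi * x * y : ℝ) : ℂ) * Complex.I) • g x) volume := by
    intro y
    refine (integrable_norm_iff ?_).1 ?_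
    · have : Continuous fun x : ℝ =>
          Complex.exp (((-2 * Real.pi * x * y : ℝ) : ℂ) * Complex.I) := by fun_prop
      exact this.aestronglyMeasurable.smul hg.1
    · simpa only [norm_smul, Complex.norm_exp_ofReal_mul_I, one_mul] using hg.norm
  rw [Real.fourier_real_eq_integral_exp_smul, Real.fourier_real_eq_integral_exp_smul,
    ← integral_sub (hi β) (hi α)]
  refine integral_congr_ae ?_
  filter_upwards [hv, coeFn_fourierInv_toLp h1 h2] with x hx hx'
  rw [hx, hx', ← hexp, ← hexp, ← sub_smul, ← map_sub, ← hk]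
  simp [Complex.conj_ofNat]
  ring

/-- The normalization constant of the unitary Fourier transform. -/
def fourierConst : ℝ := 1 / √(2 * Real.pi)

theorem fourierConst_pos : 0 < fourierConst := by unfold fourierConst; positivity

theorem fourierConst_sq : fourierConst ^ 2 = (2 * Real.pi)⁻¹ := by
  rw [fourierConst, div_pow, Real.sq_sqrt (by positivity), one_pow, one_div]

theorem fourierConst_le_one : fourierConst ≤ 1 := by
  have h := fourierConst_sq
  have h1 : (2 * Real.pi)⁻¹ ≤ 1 := inv_le_one_of_one_le₀ (by linarith [Real.pi_gt_three])
  nlinarith [fourierConst_pos]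

theorem hatFT_eq (g : ℝ → ℝ) (ξ : ℝ) :
    hatFT g ξ = (fourierConst : ℂ) * 𝓕 (fun x : ℝ => (g x : ℂ)) (ξ / (2 * Real.pi)) := by
  rw [hatFT, Real.fourier_real_eq_integral_exp_smul, fourierConst]
  congr 2
  ext x
  rw [smul_eq_mul]
  congr 2
  have : (Real.pi : ℂ) ≠ 0 := by exact_mod_cast Real.pi_ne_zero
  push_cast
  field_simp

/-- In ξ = 2πη the Jacobian cancels the square 1/(2π) of the normalization constant. -/
theorem integral_weight_rescale {w : ℝ → ℝ} {F : ℝ → ℂ} {f : ℝ → ℂ}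
    (hi : Integrable (fun η => w (2 * Real.pi * η) * ‖F η‖ ^ 2) volume)
    (hf : ∀ ξ, ‖f ξ‖ = fourierConst * ‖F (ξ / (2 * Real.pi))‖) :
    Integrable (fun ξ => w ξ * ‖f ξ‖ ^ 2) volume ∧
      ∫ ξ, w ξ * ‖f ξ‖ ^ 2 = ∫ η, w (2 * Real.pi * η) * ‖F η‖ ^ 2 := by
  have hπ : (2 * Real.pi) ≠ 0 := by positivity
  have e : (fun ξ => w ξ * ‖f ξ‖ ^ 2) = fun ξ =>
      (fun η => (2 * Real.pi)⁻¹ * (w (2 * Real.pi * η) * ‖F η‖ ^ 2)) (ξ / (2 * Real.pi)) := by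
    ext ξ
    simp only
    rw [hf, mul_pow, fourierConst_sq, mul_div_cancel₀ _ hπ]; ring
  rw [e]
  refine ⟨(hi.const_mul _).comp_div hπ, ?_⟩
  rw [Measure.integral_comp_div (fun η => (2 * Real.pi)⁻¹ * (w (2 * Real.pi * η) * ‖F η‖ ^ 2)),
    integral_const_mul, abs_of_pos (by positivity), smul_eq_mul]
  field_simp

/-- The Fourier transform of a function in `H^{1,1} ∩ H^N` is an admissible amplitude. -/
theorem exists_amplitudeBound_hatFT {N A B : ℝ} (hN : 1 ≤ N) (hB : 0 ≤ B) {g : ℝ → ℝ}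
    (h1 : weightedNorm g ≤ ENNReal.ofReal B) (h2 : sobolevNorm N g ≤ ENNReal.ofReal B)
    (hA : Continuous (hatFT g) → ∀ ξ, ‖hatFT g ξ‖ ≤ A) :
    Integrable (fun x => (g x : ℂ)) volume ∧
      ∃ f', AmplitudeBound N A (3 * B) (hatFT g) f' := by
  obtain ⟨hu, hui, huB⟩ := sobolevNorm_le_ofReal hB h1
  obtain ⟨hg, hgi, hgB⟩ := sobolevNorm_le_ofReal hB h2
  set u : Lp ℂ 2 (volume : Measure ℝ) := hu.toLp _ with hu_def
  have hgint : Integrable (fun x => (g x : ℂ)) volume := by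
    refine integrable_of_weight hg.1 (((memLp_two_iff_integrable_sq_norm hu.1).1 hu).congr
      (Eventually.of_forall fun x => ?_))
    simp only [Complex.norm_real, Real.norm_eq_abs, sq_abs, mul_pow, japBracket]
    rw [Real.sq_sqrt (by positivity)]
  refine ⟨hgint, ?_⟩
  -- the weak derivative of `⟨x⟩ g`
  have hπ : 0 < 2 * Real.pi := by positivity
  simp only [Real.rpow_one] at hui huB
  have hUm := Lp.aestronglyMeasurable (𝓕 u : Lp ℂ 2 (volume : Measure ℝ))
  have hwm : AEStronglyMeasurable (fun η : ℝ =>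
      2 * Real.pi * Complex.I * η * (𝓕 u : Lp ℂ 2 (volume : Measure ℝ)) η) volume :=
    (Continuous.aestronglyMeasurable (by fun_prop)).mul hUm
  have hnorm : ∀ (η : ℝ) (z : ℂ),
      ‖2 * Real.pi * Complex.I * η * z‖ ^ 2 = (2 * Real.pi * η) ^ 2 * ‖z‖ ^ 2 := by
    intro η z
    rw [norm_mul, mul_pow]
    congr 1
    simp only [norm_mul, Complex.norm_I, Complex.norm_real, mul_one, Complex.norm_ofNat,
      Real.norm_eq_abs, mul_pow, sq_abs]
  have hwi : Integrable (fun η : ℝ =>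
      ‖2 * Real.pi * Complex.I * η * (𝓕 u : Lp ℂ 2 (volume : Measure ℝ)) η‖ ^ 2) volume := by
    refine Integrable.mono' hui (hwm.norm.pow 2) (Eventually.of_forall fun η => ?_)
    rw [Real.norm_of_nonneg (by positivity), hnorm]
    gcongr; linarith
  have hW : MemLp (fun η : ℝ =>
      2 * Real.pi * Complex.I * η * (𝓕 u : Lp ℂ 2 (volume : Measure ℝ)) η) 2 volume :=
    (memLp_two_iff_integrable_sq_norm hwm).2 hwi
  set w : Lp ℂ 2 (volume : Measure ℝ) := 𝓕⁻ (hW.toLp _) with hw_def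
  have hw : (𝓕 w : Lp ℂ 2 (volume : Measure ℝ)) =ᵐ[volume] fun η =>
      2 * Real.pi * Complex.I * η * (𝓕 u : Lp ℂ 2 (volume : Measure ℝ)) η := by
    rw [hw_def, FourierTransform.fourier_fourierInv_eq]; exact hW.coeFn_toLp
  have hwB : ‖w‖ ≤ B := by
    rw [← Lp.norm_fourier_eq]
    refine norm_le_of_integral_norm_sq_le hB (le_trans ?_ huB)
    rw [integral_congr_ae (hw.mono fun η h => by simp only [h]; rfl)]
    refine integral_mono hwi hui fun η => ?_
    simp only
    rw [hnorm]
    gcongr; linarith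
  have huB' : ‖u‖ ≤ B := by
    rw [← Lp.norm_fourier_eq]
    refine norm_le_of_integral_norm_sq_le hB (le_trans ?_ huB)
    refine integral_mono ((memLp_two_iff_integrable_sq_norm hUm).1 (Lp.memLp _)) hui fun η => ?_
    simp only
    exact le_mul_of_one_le_left (by positivity) (by nlinarith [sq_nonneg (2 * Real.pi * η)])
  have hvm := memLp_ofReal_mul continuous_unitWeight abs_unitWeight_le (Lp.memLp u)
  set v : Lp ℂ 2 (volume : Measure ℝ) := hvm.toLp _ with hv_def
  have hv : v =ᵐ[volume] fun x => (unitWeight x : ℂ) * u x := hvm.coeFn_toLp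
  have hvg : v =ᵐ[volume] fun x => (x : ℂ) * (g x : ℂ) := by
    filter_upwards [hv, hu.coeFn_toLp] with x hx hx'
    rw [hx, hx']
    have h := congrArg (fun r : ℝ => (r : ℂ)) (unitWeight_mul_japBracket x)
    push_cast at h ⊢
    linear_combination (g x : ℂ) * h
  have hvB : ‖v‖ ≤ B := by
    refine (Lp.norm_le_norm_of_ae_le ?_).trans huB'
    filter_upwards [hv] with x hx
    rw [hx, norm_mul, Complex.norm_real, Real.norm_eq_abs]
    exact mul_le_of_le_one_left (norm_nonneg _) (abs_unitWeight_le x)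
  -- Since x g = (x/⟨x⟩)·⟨x⟩g, membership of ⟨x⟩g in H¹ passes to v = x g, whose transform is ĝ' up
  -- to a constant.
  obtain ⟨z, hz, hzV⟩ := fourier_unitWeight_mul hw hv
  set V : Lp ℂ 2 (volume : Measure ℝ) := 𝓕 v with hV
  obtain ⟨hVi, hVB⟩ := integral_norm_sq_coeFn_le hB ((Lp.norm_fourier_eq v).trans_le hvB)
  obtain ⟨hzi, hzB⟩ := integral_norm_sq_coeFn_le (B := 2 * B) (by positivity)
    (hz.trans (by linarith))
  have hsum : (fun η => (1 + (2 * Real.pi * η) ^ 2) * ‖V η‖ ^ 2) =ᵐ[volume]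
      fun η => ‖V η‖ ^ 2 + ‖z η‖ ^ 2 := by
    filter_upwards [hzV] with η hη
    rw [← hη, hnorm]; ring
  have hVwi : Integrable (fun η => (1 + (2 * Real.pi * η) ^ 2) * ‖V η‖ ^ 2) volume :=
    (hVi.add hzi).congr hsum.symm
  -- From ‖V‖ ≤ B and ‖z‖ ≤ 2B: B² + 4B² ≤ (3B)².
  have hVwB : ∫ η, (1 + (2 * Real.pi * η) ^ 2) * ‖V η‖ ^ 2 ≤ (3 * B) ^ 2 := by
    rw [integral_congr_ae hsum, integral_add hVi hzi]
    nlinarith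
  -- the amplitude
  have hft := hatFT_eq g
  have hGae : (𝓕 (hg.toLp _) : Lp ℂ 2 (volume : Measure ℝ)) =ᵐ[volume]
      𝓕 (fun x : ℝ => (g x : ℂ)) := coeFn_fourier_toLp hgint hg
  have hGeq := hGae.mono fun η h => congrArg
    (fun z : ℂ => (1 + (2 * Real.pi * η) ^ 2) ^ N * ‖z‖ ^ 2) h
  have hGi := hgi.congr hGeq
  rw [integral_congr_ae hGeq] at hgB
  -- The chain rule factor 1/(2π) cancels the 2π of the kernel e^{-2πixη}, leaving -i.
  set f' : ℝ → ℂ := fun ξ => (fourierConst : ℂ) * (-Complex.I * V (ξ / (2 * Real.pi))) with hf'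
  have hnf' : ∀ ξ, ‖f' ξ‖ = fourierConst * ‖V (ξ / (2 * Real.pi))‖ := fun ξ => by
    simp [hf', abs_of_pos fourierConst_pos]
  have hnf : ∀ ξ, ‖hatFT g ξ‖ =
      fourierConst * ‖𝓕 (fun x : ℝ => (g x : ℂ)) (ξ / (2 * Real.pi))‖ := fun ξ => by
    simp [hft, abs_of_pos fourierConst_pos]
  obtain ⟨r1, r2⟩ := integral_weight_rescale (w := fun x => 1 + x ^ 2) hVwi hnf'
  obtain ⟨r3, r4⟩ := integral_weight_rescale (w := fun x => (1 + x ^ 2) ^ N) hGi hnf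
  have hf'm : StronglyMeasurable f' := by
    have : StronglyMeasurable fun ξ : ℝ => V (ξ / (2 * Real.pi)) :=
      (Lp.stronglyMeasurable V).comp_measurable (by fun_prop)
    exact (this.const_mul _).const_mul _
  have hf'i : Integrable (fun ξ => ‖f' ξ‖ ^ 2) volume := by
    refine Integrable.mono' r1 (hf'm.norm.pow 2).aestronglyMeasurable
      (Eventually.of_forall fun ξ => ?_)
    rw [Real.norm_of_nonneg (by positivity)]
    exact le_mul_of_one_le_left (by positivity) (by nlinarith [sq_nonneg ξ])
  have hL : HasL2Deriv (hatFT g) f' :=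
    { memLp := (memLp_two_iff_integrable_sq_norm hf'm.aestronglyMeasurable).2 hf'i
      sub_eq := by
        intro x y
        rw [hft, hft, ← mul_sub, fourier_sub_eq_intervalIntegral hgint hvg]
        have := intervalIntegral.integral_comp_div (a := x) (b := y)
          (fun η => -Complex.I * V η) hπ.ne'
        simp only [hf', intervalIntegral.integral_const_mul] at this ⊢
        rw [this, ← hV, Complex.real_smul]
        push_cast; ring }
  refine ⟨f', {
    toHasL2Deriv := hL
    nonneg := (by positivity)
    integrable := ?_
    -- The norm of ĝ is an essential supremum; it bounds every value only once continuity is known,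
    -- which is why `hA` takes continuity as input.
    sup_le := hA hL.continuous
    integrable_sq_weight := r3
    sq_le := ?_
    integrable_deriv_weight := r1
    deriv_le := r2.trans_le hVwB }⟩
  · refine integrable_of_weight hL.continuous.aestronglyMeasurable
      (Integrable.mono' r3 ?_ (Eventually.of_forall fun ξ => ?_))
    · exact (Continuous.mul (by fun_prop) (hL.continuous.norm.pow 2)).aestronglyMeasurable
    · rw [Real.norm_of_nonneg (by positivity)]
      gcongr
      exact Real.self_le_rpow_of_one_le (by nlinarith [sq_nonneg ξ]) hN
  · rw [r4]
    exact hgB.trans (by nlinarith)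

end

/-! ### Cutoffs, and the bounds for the low and high frequency integrals. -/

noncomputable section

namespace AmplitudeBound

variable {N A B : ℝ} {f f' : ℝ → ℂ}

theorem mono (h : AmplitudeBound N A B f f') {A' B' : ℝ} (hA : A ≤ A') (hB : B ≤ B') :
    AmplitudeBound N A' B' f f' where
  toHasL2Deriv := h.toHasL2Deriv
  nonneg := h.nonneg.trans hB
  integrable := h.integrable
  sup_le x := (h.sup_le x).trans hA
  integrable_sq_weight := h.integrable_sq_weight
  sq_le := h.sq_le.trans (pow_le_pow_left₀ h.nonneg hB 2)
  integrable_deriv_weight := h.integrable_deriv_weight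
  deriv_le := h.deriv_le.trans (pow_le_pow_left₀ h.nonneg hB 2)

/-- The term m'f is controlled by the L² norm of f alone, because ⟨x⟩m' is bounded by K. Squaring
the sum gives 2K²B² + 2K²B² = (2KB)². -/
theorem mul (h : AmplitudeBound N A B f f') (hN : 0 ≤ N) {m m' : ℝ → ℝ} {K : ℝ} (hK : 1 ≤ K)
    (hm : ∀ x, HasDerivAt m (m' x) x) (hm' : Continuous m') (hmK : ∀ x, |m x| ≤ K)
    (hmK' : ∀ x, (1 + x ^ 2) * m' x ^ 2 ≤ K ^ 2) :
    AmplitudeBound N (K * A) (2 * K * B) (fun x => (m x : ℂ) * f x)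
      (fun x => (m x : ℂ) * f' x + (m' x : ℂ) * f x) := by
  have hB := h.nonneg
  have hmc : Continuous m := continuous_iff_continuousAt.2 fun x => (hm x).continuousAt
  have hfc := h.continuous
  have hsq : ∀ x, ‖(m x : ℂ) * f x‖ ^ 2 ≤ K ^ 2 * ‖f x‖ ^ 2 := fun x => by
    rw [norm_mul, mul_pow, Complex.norm_real, Real.norm_eq_abs]
    gcongr; exact hmK x
  have hmeas : AEStronglyMeasurable (fun x => (m x : ℂ) * f' x + (m' x : ℂ) * f x) volume :=
    ((Complex.continuous_ofReal.comp hmc).aestronglyMeasurable.mul h.memLp.1).add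
      ((Complex.continuous_ofReal.comp hm').mul hfc).aestronglyMeasurable
  have hd : ∀ x, (1 + x ^ 2) * ‖(m x : ℂ) * f' x + (m' x : ℂ) * f x‖ ^ 2 ≤
      2 * K ^ 2 * ((1 + x ^ 2) * ‖f' x‖ ^ 2) + 2 * K ^ 2 * ((1 + x ^ 2) ^ N * ‖f x‖ ^ 2) := by
    intro x
    have h1 := norm_add_le ((m x : ℂ) * f' x) ((m' x : ℂ) * f x)
    rw [norm_mul, norm_mul, Complex.norm_real, Complex.norm_real, Real.norm_eq_abs,
      Real.norm_eq_abs] at h1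
    have h2 : ‖(m x : ℂ) * f' x + (m' x : ℂ) * f x‖ ^ 2 ≤
        2 * (m x ^ 2 * ‖f' x‖ ^ 2) + 2 * (m' x ^ 2 * ‖f x‖ ^ 2) := by
      refine (pow_le_pow_left₀ (norm_nonneg _) h1 2).trans ?_
      rw [← sq_abs (m x), ← sq_abs (m' x), ← mul_pow, ← mul_pow]
      nlinarith [sq_nonneg (|m x| * ‖f' x‖ - |m' x| * ‖f x‖)]
    have h3 : m x ^ 2 ≤ K ^ 2 := by
      rw [← sq_abs]; exact pow_le_pow_left₀ (abs_nonneg _) (hmK x) 2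
    have h4 : (1 : ℝ) ≤ (1 + x ^ 2) ^ N := Real.one_le_rpow (by nlinarith [sq_nonneg x]) hN
    have hw : (0 : ℝ) ≤ 1 + x ^ 2 := by positivity
    calc _ ≤ (1 + x ^ 2) * (2 * (m x ^ 2 * ‖f' x‖ ^ 2) + 2 * (m' x ^ 2 * ‖f x‖ ^ 2)) := by gcongr
      _ = 2 * m x ^ 2 * ((1 + x ^ 2) * ‖f' x‖ ^ 2)
          + 2 * ((1 + x ^ 2) * m' x ^ 2) * (1 * ‖f x‖ ^ 2) := by ring
      _ ≤ _ := by gcongr; exact hmK' x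
  have hdi := (h.integrable_deriv_weight.const_mul (2 * K ^ 2)).add
    (h.integrable_sq_weight.const_mul (2 * K ^ 2))
  have hdm : AEStronglyMeasurable (fun x : ℝ =>
      (1 + x ^ 2) * ‖(m x : ℂ) * f' x + (m' x : ℂ) * f x‖ ^ 2) volume :=
    (Continuous.aestronglyMeasurable (by fun_prop)).mul (hmeas.norm.pow 2)
  have hdw : Integrable (fun x : ℝ =>
      (1 + x ^ 2) * ‖(m x : ℂ) * f' x + (m' x : ℂ) * f x‖ ^ 2) volume :=
    Integrable.mono' hdi hdm (Eventually.of_forall fun x => by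
      rw [Real.norm_of_nonneg (by positivity)]; exact hd x)
  have hsm : AEStronglyMeasurable (fun x : ℝ => (1 + x ^ 2) ^ N * ‖(m x : ℂ) * f x‖ ^ 2) volume :=
    (Continuous.mul ((by fun_prop : Continuous fun x : ℝ => 1 + x ^ 2).rpow_const
      fun x => Or.inl (by positivity)) (by fun_prop)).aestronglyMeasurable
  have hsw : Integrable (fun x : ℝ => (1 + x ^ 2) ^ N * ‖(m x : ℂ) * f x‖ ^ 2) volume :=
    Integrable.mono' (h.integrable_sq_weight.const_mul (K ^ 2)) hsm
      (Eventually.of_forall fun x => by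
        rw [Real.norm_of_nonneg (by positivity)]
        have hw : (0 : ℝ) ≤ (1 + x ^ 2) ^ N := by positivity
        nlinarith [mul_le_mul_of_nonneg_left (hsq x) hw])
  have h2 : MemLp (fun x => (m x : ℂ) * f' x + (m' x : ℂ) * f x) 2 volume := by
    refine (memLp_two_iff_integrable_sq_norm hmeas).2 (Integrable.mono' hdw (hmeas.norm.pow 2)
      (Eventually.of_forall fun x => ?_))
    rw [Real.norm_of_nonneg (by positivity)]
    exact le_mul_of_one_le_left (by positivity) (by nlinarith [sq_nonneg x])
  exact {
    toHasL2Deriv := h.toHasL2Deriv.mul (fun x => (hm x).ofReal_comp)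
      (Complex.continuous_ofReal.comp hm') h2
    nonneg := (by positivity)
    integrable := Integrable.mono' (h.integrable.norm.const_mul K)
      ((Complex.continuous_ofReal.comp hmc).mul hfc).aestronglyMeasurable
      (Eventually.of_forall fun x => by
        rw [norm_mul, Complex.norm_real, Real.norm_eq_abs]
        gcongr; exact hmK x)
    sup_le := fun x => by
      rw [norm_mul, Complex.norm_real, Real.norm_eq_abs]
      gcongr
      · exact hmK x
      · exact h.sup_le x
    integrable_sq_weight := hsw
    sq_le := by
      calc _ ≤ ∫ x, K ^ 2 * ((1 + x ^ 2) ^ N * ‖f x‖ ^ 2) := by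
            refine integral_mono hsw (h.integrable_sq_weight.const_mul (K ^ 2)) fun x => ?_
            have hw : (0 : ℝ) ≤ (1 + x ^ 2) ^ N := by positivity
            simp only
            nlinarith [mul_le_mul_of_nonneg_left (hsq x) hw]
        _ ≤ K ^ 2 * B ^ 2 := by
            rw [integral_const_mul]
            exact mul_le_mul_of_nonneg_left h.sq_le (sq_nonneg K)
        _ ≤ _ := by nlinarith [mul_nonneg (sq_nonneg K) (sq_nonneg B)]
    integrable_deriv_weight := hdw
    deriv_le := by
      refine (integral_mono hdw hdi hd).trans ?_
      rw [integral_add' (h.integrable_deriv_weight.const_mul _)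
        (h.integrable_sq_weight.const_mul _), integral_const_mul, integral_const_mul]
      nlinarith [mul_le_mul_of_nonneg_left h.sq_le (sq_nonneg K),
        mul_le_mul_of_nonneg_left h.deriv_le (sq_nonneg K)] }

end AmplitudeBound

theorem exists_bound_of_hasCompactSupport {m : ℝ → ℝ} (hs : ContDiff ℝ 1 m)
    (hc : HasCompactSupport m) :
    ∃ K : ℝ, 1 ≤ K ∧ (∀ x, |m x| ≤ K) ∧ (∀ x, |1 - m x| ≤ K) ∧
      ∀ x, (1 + x ^ 2) * deriv m x ^ 2 ≤ K ^ 2 := by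
  have hd : Continuous (deriv m) := hs.continuous_deriv le_rfl
  obtain ⟨C₁, h₁⟩ := hs.continuous.bounded_above_of_compact_support hc
  have h3 : Continuous ((fun x : ℝ => (1 + x ^ 2) * deriv m x) * deriv m) :=
    Continuous.mul (by fun_prop) hd
  obtain ⟨C₂, h₂⟩ := h3.bounded_above_of_compact_support hc.deriv.mul_left
  have p₁ := (norm_nonneg _).trans (h₁ 0)
  have p₂ := (norm_nonneg _).trans (h₂ 0)
  refine ⟨1 + C₁ + C₂, by linarith, fun x => ?_, fun x => ?_, fun x => ?_⟩
  · exact (h₁ x).trans (by linarith)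
  · have := h₁ x
    rw [Real.norm_eq_abs, abs_le] at this
    rw [abs_le]
    constructor <;> linarith
  · have := (le_abs_self _).trans (h₂ x)
    rw [Pi.mul_apply, mul_assoc, ← sq] at this
    nlinarith

theorem IsCutoff.exists_bound {φ : ℝ → ℝ} (hφ : IsCutoff φ) {r : ℝ} (hr : 0 < r) :
    ∃ (K : ℝ) (m' : ℝ → ℝ), 1 ≤ K ∧ Continuous m' ∧
      (∀ x, HasDerivAt (fun ξ => φ (r * ξ)) (m' x) x) ∧ (∀ x, |φ (r * x)| ≤ K) ∧
      (∀ x, |1 - φ (r * x)| ≤ K) ∧ ∀ x, (1 + x ^ 2) * m' x ^ 2 ≤ K ^ 2 := by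
  have hs : ContDiff ℝ 1 (fun ξ => φ (r * ξ)) :=
    (hφ.smooth.of_le (by exact_mod_cast le_top)).comp (contDiff_const.mul contDiff_id)
  have hc : HasCompactSupport (fun ξ => φ (r * ξ)) := by
    refine HasCompactSupport.intro (isCompact_Icc (a := -(2 / r)) (b := 2 / r)) fun x hx => ?_
    refine hφ.eq_zero _ ?_
    by_contra! h
    rw [abs_mul, abs_of_pos hr, ← le_div_iff₀' hr] at h
    exact hx (abs_le.1 h)
  obtain ⟨K, hK, h1, h2, h3⟩ := exists_bound_of_hasCompactSupport hs hc
  exact ⟨K, deriv fun ξ => φ (r * ξ), hK, hs.continuous_deriv le_rfl,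
    fun x => (hs.differentiable one_ne_zero x).hasDerivAt, h1, h2, h3⟩

theorem forall_norm_le_of_eLpNorm_top_le {f : ℝ → ℂ} {A : ℝ} (hA : 0 ≤ A) (hf : Continuous f)
    (h : eLpNorm f ∞ volume ≤ ENNReal.ofReal A) (x : ℝ) : ‖f x‖ ≤ A := by
  have hae : ∀ᵐ x, ‖f x‖ ≤ A := by
    rw [eLpNorm_exponent_top] at h
    filter_upwards [ae_le_eLpNormEssSup (f := f) (μ := volume)] with x hx
    have := hx.trans h
    rwa [← ofReal_norm, ENNReal.ofReal_le_ofReal_iff hA] at this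
  have hd := Measure.dense_of_ae hae
  have hcl : IsClosed {x | ‖f x‖ ≤ A} := isClosed_le hf.norm continuous_const
  have := hd.closure_eq
  rw [hcl.closure_eq] at this
  exact this.ge (mem_univ x)

theorem le_ofReal_of_ofReal_rpow_neg_mul_le {t A r : ℝ} (ht : 0 < t) {a : ℝ≥0∞}
    (h : ENNReal.ofReal (t ^ (-r)) * a ≤ ENNReal.ofReal A) : a ≤ ENNReal.ofReal (A * t ^ r) := by
  have h1 : ENNReal.ofReal (t ^ r) * ENNReal.ofReal (t ^ (-r)) = 1 := by
    rw [← ENNReal.ofReal_mul (by positivity), ← Real.rpow_add ht]; simp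
  calc a = ENNReal.ofReal (t ^ r) * (ENNReal.ofReal (t ^ (-r)) * a) := by
        rw [← mul_assoc, h1, one_mul]
    _ ≤ ENNReal.ofReal (t ^ r) * ENNReal.ofReal A := by gcongr
    _ = _ := by rw [← ENNReal.ofReal_mul (by positivity), mul_comm]

theorem one_le_sobolevIndex (s : ℝ) : (1 : ℝ) ≤ sobolevIndex s := by
  rw [sobolevIndex]; push_cast; linarith [Nat.cast_nonneg (α := ℝ) ⌊s⌋₊]

theorem lt_sobolevIndex (s : ℝ) : s < sobolevIndex s := by
  rw [sobolevIndex]; push_cast; exact Nat.lt_floor_add_one s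

/-- A function whose weighted and Sobolev norms are at most `A t^{1/6}` has an admissible
Fourier transform. -/
theorem exists_amplitudeBound_of_norms_le {s t A : ℝ} (ht : 1 ≤ t) (hA : 0 ≤ A) {g : ℝ → ℝ}
    (h : ENNReal.ofReal (t ^ (-(1 : ℝ) / 6)) *
      (weightedNorm g + sobolevNorm (sobolevIndex s : ℝ) g) ≤ ENNReal.ofReal A)
    (hsup : eLpNorm (hatFT g) ∞ volume ≤ ENNReal.ofReal A) :
    Integrable (fun x => (g x : ℂ)) volume ∧
    ∃ f', AmplitudeBound (sobolevIndex s) (3 * A) (3 * A * t ^ (1 / 6 : ℝ)) (hatFT g) f' := by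
  rw [neg_div] at h
  have h' := le_ofReal_of_ofReal_rpow_neg_mul_le (by linarith) h
  obtain ⟨hg, f', hf'⟩ := exists_amplitudeBound_hatFT (one_le_sobolevIndex s)
    (B := A * t ^ (1 / 6 : ℝ)) (by positivity) (le_self_add.trans h') (le_add_self.trans h')
    (forall_norm_le_of_eLpNorm_top_le hA · hsup)
  -- The sup bound is relaxed from A to 3A so that the pair of bounds has the form A', A' t^{1/6}
  -- required by the oscillatory estimates.
  exact ⟨hg, f', hf'.mono (by linarith) (by rw [mul_assoc])⟩

theorem SmallProfile.exists_amplitudeBound {s t : ℝ} (ht : 1 ≤ t) {g : ℝ → ℝ}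
    (h : SmallProfile s t g) :
    ∃ f', AmplitudeBound (sobolevIndex s) 3 (3 * t ^ (1 / 6 : ℝ)) (hatFT g) f' := by
  unfold SmallProfile at h
  rw [← ENNReal.ofReal_one] at h
  simpa using (exists_amplitudeBound_of_norms_le ht zero_le_one
    (le_add_self.trans h) (le_self_add.trans h)).2

theorem SmallProfile.exists_amplitudeBound_mul {s t K : ℝ} (ht : 1 ≤ t) {g : ℝ → ℝ}
    (h : SmallProfile s t g) {m m' : ℝ → ℝ} (hK : 1 ≤ K)
    (hm : ∀ x, HasDerivAt m (m' x) x) (hm' : Continuous m') (hmK : ∀ x, |m x| ≤ K)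
    (hmK' : ∀ x, (1 + x ^ 2) * m' x ^ 2 ≤ K ^ 2) :
    ∃ f', AmplitudeBound (sobolevIndex s) (6 * K) (6 * K * t ^ (1 / 6 : ℝ))
      (fun x => (m x : ℂ) * hatFT g x) f' := by
  obtain ⟨f', hf'⟩ := h.exists_amplitudeBound ht
  exact ⟨_, (hf'.mul (by positivity) hK hm hm' hmK hmK').mono (by linarith) (by linarith)⟩

theorem exp_phase_eq {t : ℝ} (ht : t ≠ 0) (s x ξ : ℝ) :
    Complex.exp (Complex.I * t * (phase s x t ξ : ℝ)) =
      Complex.exp (Complex.I * ((t * dispersion s ξ + x * ξ : ℝ) : ℂ)) := by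
  have ht' : (t : ℂ) ≠ 0 := by exact_mod_cast ht
  congr 1
  rw [phase, dispersion]
  push_cast
  field_simp
  ring

theorem exp_mul_exp_eq (s t x ξ : ℝ) (z : ℂ) :
    Complex.exp (Complex.I * x * ξ) *
      (Complex.exp (Complex.I * t * ξ * (besselSymbol s ξ : ℝ)) * z) =
      Complex.exp (Complex.I * ((t * dispersion s ξ + x * ξ : ℝ) : ℂ)) * z := by
  rw [← mul_assoc, ← Complex.exp_add]
  congr 2
  rw [dispersion]
  push_cast
  ring

theorem lowInt_eq {t : ℝ} (ht : t ≠ 0) (φ : ℝ → ℝ) (s x : ℝ) (g : ℝ → ℝ) :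
    lowInt φ s t x g = (fourierConst : ℂ) *
      ∫ ξ, Complex.exp (Complex.I * ((t * dispersion s ξ + x * ξ : ℝ) : ℂ)) *
        ((φ (2 ^ 10 * ξ) : ℝ) * hatFT g ξ) := by
  rw [lowInt, fourierConst]
  congr 2
  ext ξ
  rw [exp_phase_eq ht]; ring

theorem highInt_eq {t : ℝ} (ht : t ≠ 0) (φ : ℝ → ℝ) (s x : ℝ) (g : ℝ → ℝ) :
    highInt φ s t x g = (fourierConst : ℂ) *
      ∫ ξ, Complex.exp (Complex.I * ((t * dispersion s ξ + x * ξ : ℝ) : ℂ)) *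
        ((1 - φ (2 ^ 10 * ξ) : ℝ) * hatFT g ξ) := by
  rw [highInt, fourierConst]
  congr 2
  ext ξ
  rw [exp_phase_eq ht]; ring

theorem norm_fourierConst_mul_le (z : ℂ) : ‖(fourierConst : ℂ) * z‖ ≤ ‖z‖ := by
  rw [norm_mul, Complex.norm_real, Real.norm_of_nonneg fourierConst_pos.le]
  exact mul_le_of_le_one_left (norm_nonneg _) fourierConst_le_one

theorem propagator_eq_lowInt_add_highInt {φ : ℝ → ℝ} (hφ : IsCutoff φ) {s t : ℝ} (ht : 1 ≤ t)
    {g : ℝ → ℝ} (h : SmallProfile s t g) (x : ℝ) :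
    propagator s t g x = lowInt φ s t x g + highInt φ s t x g := by
  obtain ⟨K, m', hK, hc, hd, h1, h2, h3⟩ := hφ.exists_bound (r := 2 ^ 10) (by positivity)
  obtain ⟨_, a1⟩ := h.exists_amplitudeBound_mul ht hK hd hc h1 h3
  obtain ⟨_, a2⟩ := h.exists_amplitudeBound_mul ht hK (fun x => (hd x).const_sub 1) hc.neg h2
    (by simpa using h3)
  have ht0 : t ≠ 0 := by positivity
  rw [lowInt_eq ht0, highInt_eq ht0, ← mul_add,
    ← integral_add (a1.integrable_exp_mul (isPhase_dispersion s t x))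
      (a2.integrable_exp_mul (isPhase_dispersion s t x)), propagator, ← fourierConst]
  congr 2
  ext ξ
  rw [exp_mul_exp_eq]
  push_cast
  ring

/-- The whole-line estimate applies directly to (1-φ)ĝ. The region near the origin itself
contributes at most a multiple of t^{-1/3}, so the vanishing of 1-φ there brings nothing. -/
theorem exists_norm_highInt_le {φ : ℝ → ℝ} (hφ : IsCutoff φ) {s : ℝ} (hs : 0 < s) (hs1 : s ≠ 1) :
    ∃ C : ℝ, 0 < C ∧ ∀ t : ℝ, 1 ≤ t → ∀ x : ℝ, ∀ g : ℝ → ℝ, SmallProfile s t g →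
      ‖highInt φ s t x g‖ ≤ C * t ^ (-(1 : ℝ) / 3) := by
  obtain ⟨K, m', hK, hc, hd, h1, h2, h3⟩ := hφ.exists_bound (r := 2 ^ 10) (by positivity)
  obtain ⟨C, hC, hb⟩ := exists_norm_integral_dispersion_le hs hs1 (lt_sobolevIndex s)
  refine ⟨C * (6 * K), by positivity, fun t ht x g hg => ?_⟩
  obtain ⟨_, a⟩ := hg.exists_amplitudeBound_mul ht hK (fun x => (hd x).const_sub 1) hc.neg h2
    (by simpa using h3)
  rw [highInt_eq (by positivity), neg_div]
  exact (norm_fourierConst_mul_le _).trans (hb t ht x _ _ _ a)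

theorem max_rpow_le_japBracket_rpow (X : ℝ) :
    (max 1 |X|) ^ (-(1 / 4) : ℝ) ≤ 2 * japBracket X ^ (-(1 / 4) : ℝ) := by
  have hj := one_le_japBracket X
  have h1 : japBracket X / 2 ≤ max 1 |X| := by
    rw [div_le_iff₀ two_pos, japBracket, Real.sqrt_le_iff]
    have h2 := le_max_left 1 |X|
    have h3 := le_max_right 1 |X|
    have h4 : X ^ 2 ≤ max 1 |X| ^ 2 := by
      rw [← sq_abs]; exact pow_le_pow_left₀ (abs_nonneg _) h3 2
    exact ⟨by positivity, by nlinarith⟩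
  calc (max 1 |X|) ^ (-(1 / 4) : ℝ) ≤ (japBracket X / 2) ^ (-(1 / 4) : ℝ) :=
        Real.rpow_le_rpow_of_nonpos (by positivity) h1 (by norm_num)
    _ = (2 : ℝ) ^ (1 / 4 : ℝ) * japBracket X ^ (-(1 / 4) : ℝ) := by
        rw [Real.div_rpow (by positivity) (by norm_num), Real.rpow_neg two_pos.le]
        field_simp
    _ ≤ 2 * japBracket X ^ (-(1 / 4) : ℝ) := by
        gcongr
        exact Real.rpow_le_self_of_one_le (by norm_num) (by norm_num)

theorem exists_norm_lowInt_le {φ : ℝ → ℝ} (hφ : IsCutoff φ) {s : ℝ} (hs : 0 < s)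
    (hs1 : s < 1 + 3 * 2 ^ 18) :
    ∃ C : ℝ, 0 < C ∧ ∀ t : ℝ, 1 ≤ t → ∀ x : ℝ, ∀ g : ℝ → ℝ, SmallProfile s t g →
      ‖lowInt φ s t x g‖ ≤ C * t ^ (-(1 : ℝ) / 3) *
        japBracket ((x + t) / t ^ ((1 : ℝ) / 3)) ^ (-(1 : ℝ) / 4) := by
  obtain ⟨K, m', hK, hc, hd, h1, h2, h3⟩ := hφ.exists_bound (r := 2 ^ 10) (by positivity)
  obtain ⟨C, hC, hb⟩ := exists_norm_integral_low_le (N := sobolevIndex s) hs hs1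
  refine ⟨4 * (C * (6 * K)), by positivity, fun t ht x g hg => ?_⟩
  have ht0 : 0 < t := by linarith
  obtain ⟨_, a⟩ := hg.exists_amplitudeBound_mul ht hK hd hc h1 h3
  set f : ℝ → ℂ := fun ξ => ((φ (2 ^ 10 * ξ) : ℝ) : ℂ) * hatFT g ξ with hf
  rw [lowInt_eq ht0.ne', neg_div, neg_div]
  refine (norm_fourierConst_mul_le _).trans ?_
  set F : ℝ → ℂ := fun ξ =>
    Complex.exp (Complex.I * ((t * dispersion s ξ + x * ξ : ℝ) : ℂ)) * f ξ with hF
  have hFi : Integrable F volume := a.integrable_exp_mul (isPhase_dispersion s t x)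
  set b : ℝ := (2 ^ 9 : ℝ)⁻¹ with hb_def
  -- φ(2¹⁰ξ) vanishes for |ξ| > 2·2⁻¹⁰ = 2⁻⁹.
  have hsplit : ∫ ξ, F ξ = (∫ ξ in -b..-0, F ξ) + ∫ ξ in 0..b, F ξ := by
    rw [neg_zero, intervalIntegral.integral_add_adjacent_intervals hFi.intervalIntegrable
      hFi.intervalIntegrable, intervalIntegral.integral_of_le (by norm_num [hb_def]),
      ← integral_Icc_eq_integral_Ioc, setIntegral_eq_integral_of_forall_compl_eq_zero]
    intro ξ hξ
    have : φ (2 ^ 10 * ξ) = 0 := by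
      refine hφ.eq_zero _ ?_
      by_contra! h
      rw [abs_mul, abs_of_pos (by positivity)] at h
      refine hξ (abs_le.1 ?_)
      rw [hb_def]; norm_num at h ⊢; linarith
    simp [hF, hf, this]
  have e : (x + t) / t ^ ((1 : ℝ) / 3) = (x + t) * t ^ (-(1 / 3) : ℝ) := by
    rw [Real.rpow_neg ht0.le, div_eq_mul_inv]
  have b1 := hb t ht x _ _ _ a
  have b2 := hb t ht x _ _ _ a.comp_neg.conj
  rw [← norm_integral_Iic_dispersion] at b2
  have hj := max_rpow_le_japBracket_rpow ((x + t) * t ^ (-(1 / 3) : ℝ))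
  calc ‖∫ ξ, F ξ‖ ≤ C * (6 * K) * (t ^ (-(1 / 3) : ℝ) *
          (max 1 |(x + t) * t ^ (-(1 / 3) : ℝ)|) ^ (-(1 / 4) : ℝ)) +
        C * (6 * K) * (t ^ (-(1 / 3) : ℝ) *
          (max 1 |(x + t) * t ^ (-(1 / 3) : ℝ)|) ^ (-(1 / 4) : ℝ)) := by
        rw [hsplit]
        exact (norm_add_le _ _).trans (add_le_add b2 b1)
    _ = 2 * (C * (6 * K)) * t ^ (-(1 / 3) : ℝ) *
          (max 1 |(x + t) * t ^ (-(1 / 3) : ℝ)|) ^ (-(1 / 4) : ℝ) := by ring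
    _ ≤ 2 * (C * (6 * K)) * t ^ (-(1 / 3) : ℝ) *
          (2 * japBracket ((x + t) * t ^ (-(1 / 3) : ℝ)) ^ (-(1 / 4) : ℝ)) := by gcongr
    _ = _ := by rw [e]; ring

end

/-! ### The linear flow on Schwartz functions. -/

noncomputable section

theorem hasTemperateGrowth_cexp_I_mul :
    (fun x : ℝ => Complex.exp (Complex.I * x)).HasTemperateGrowth := by
  refine ⟨(contDiff_const.mul Complex.ofRealCLM.contDiff).cexp, fun n => ⟨0, 1, fun x => ?_⟩⟩
  have : ∀ n : ℕ, iteratedDeriv n (fun x : ℝ => Complex.exp (Complex.I * x)) =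
      fun x : ℝ => Complex.I ^ n * Complex.exp (Complex.I * x) := by
    intro n
    induction n with
    | zero => simp
    | succ n ih =>
      rw [iteratedDeriv_succ, ih]
      ext x
      have h : HasDerivAt (fun y : ℝ => Complex.exp (Complex.I * y))
          (Complex.exp (Complex.I * x) * (Complex.I * 1)) x :=
        ((hasDerivAt_id (x : ℂ)).const_mul Complex.I).cexp.comp_ofReal
      rw [(h.const_mul (Complex.I ^ n)).deriv]
      simp; ring
  rw [norm_iteratedFDeriv_eq_norm_iteratedDeriv, this]
  simp [Complex.norm_exp]

theorem hasTemperateGrowth_besselSymbol (s : ℝ) :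
    (fun η : ℝ => besselSymbol s (2 * Real.pi * η)).HasTemperateGrowth := by
  have h1 : (fun x : ℝ => (1 + ‖x‖ ^ 2) ^ (-s / 2 : ℝ)).HasTemperateGrowth :=
    Function.hasTemperateGrowth_one_add_norm_sq_rpow ℝ _
  have h2 : (fun x : ℝ => 2 * Real.pi * x).HasTemperateGrowth := by fun_prop
  exact h1.comp h2

theorem hasTemperateGrowth_dispersion (s : ℝ) :
    (fun η : ℝ => dispersion s (2 * Real.pi * η)).HasTemperateGrowth :=
  (hasTemperateGrowth_besselSymbol s).mul (by fun_prop)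

theorem hasTemperateGrowth_flowSymbol (s r : ℝ) :
    (fun η : ℝ =>
      Complex.exp (Complex.I * ((r * dispersion s (2 * Real.pi * η) : ℝ) : ℂ))).HasTemperateGrowth := by
  have h : (fun η : ℝ => r * dispersion s (2 * Real.pi * η)).HasTemperateGrowth :=
    (Function.HasTemperateGrowth.const r).mul (hasTemperateGrowth_dispersion s)
  exact hasTemperateGrowth_cexp_I_mul.comp h

/-- The Fourier multiplier `e^{r K_s ∂ₓ}` on Schwartz functions. -/
def schwartzFlow (s r : ℝ) : 𝓢(ℝ, ℂ) →L[ℂ] 𝓢(ℝ, ℂ) :=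
  SchwartzMap.fourierMultiplierCLM ℂ
    (fun η : ℝ => Complex.exp (Complex.I * ((r * dispersion s (2 * Real.pi * η) : ℝ) : ℂ)))

theorem fourier_fourierMultiplierCLM {m : ℝ → ℂ} (hm : m.HasTemperateGrowth) (θ : 𝓢(ℝ, ℂ))
    (η : ℝ) : (𝓕 (SchwartzMap.fourierMultiplierCLM ℂ m θ) : 𝓢(ℝ, ℂ)) η =
      m η * (𝓕 θ : 𝓢(ℝ, ℂ)) η := by
  rw [SchwartzMap.fourierMultiplierCLM_apply, FourierTransform.fourier_fourierInv_eq,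
    SchwartzMap.smulLeftCLM_apply_apply hm, smul_eq_mul]

theorem fourier_schwartzFlow (s r : ℝ) (θ : 𝓢(ℝ, ℂ)) (η : ℝ) :
    (𝓕 (schwartzFlow s r θ) : 𝓢(ℝ, ℂ)) η =
      Complex.exp (Complex.I * ((r * dispersion s (2 * Real.pi * η) : ℝ) : ℂ)) *
        (𝓕 θ : 𝓢(ℝ, ℂ)) η :=
  fourier_fourierMultiplierCLM (hasTemperateGrowth_flowSymbol s r) θ η

theorem fourier_derivCLM (θ : 𝓢(ℝ, ℂ)) (η : ℝ) :
    (𝓕 (SchwartzMap.derivCLM ℂ ℂ θ) : 𝓢(ℝ, ℂ)) η =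
      2 * Real.pi * Complex.I * η * (𝓕 θ : 𝓢(ℝ, ℂ)) η := by
  have e : (SchwartzMap.derivCLM ℂ ℂ θ : ℝ → ℂ) = deriv θ :=
    funext fun x => SchwartzMap.derivCLM_apply ℂ θ x
  rw [SchwartzMap.fourier_coe, e, Real.fourier_deriv θ.integrable θ.differentiable
    (e ▸ (SchwartzMap.derivCLM ℂ ℂ θ).integrable), SchwartzMap.fourier_coe]
  rfl

theorem fourier_besselOp_derivCLM (s : ℝ) (θ : 𝓢(ℝ, ℂ)) (η : ℝ) :
    (𝓕 (besselOp s (SchwartzMap.derivCLM ℂ ℂ θ)) : 𝓢(ℝ, ℂ)) η =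
      Complex.I * (dispersion s (2 * Real.pi * η) : ℝ) * (𝓕 θ : 𝓢(ℝ, ℂ)) η := by
  have h : (fun η : ℝ => ((besselSymbol s (2 * Real.pi * η) : ℝ) : ℂ)).HasTemperateGrowth := by
    have := hasTemperateGrowth_besselSymbol s
    fun_prop
  rw [besselOp, fourier_fourierMultiplierCLM h, fourier_derivCLM, dispersion]
  push_cast
  ring

theorem schwartzFlow_zero (s : ℝ) (θ : 𝓢(ℝ, ℂ)) : schwartzFlow s 0 θ = θ := by
  rw [schwartzFlow]
  simp

/-- A Taylor remainder valid for every real y, as the frequency is unbounded: for |y| > 1 the crude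
bound 2 + |y| is at most 3y². -/
theorem norm_exp_I_mul_sub_le (y : ℝ) :
    ‖Complex.exp (Complex.I * y) - 1 - Complex.I * y‖ ≤ 3 * y ^ 2 := by
  have hn : ‖Complex.I * (y : ℂ)‖ = |y| := by simp
  rcases le_or_gt |y| 1 with h | h
  · have := Complex.norm_exp_sub_one_sub_id_le (x := Complex.I * y) (by rwa [hn])
    rw [hn, sq_abs] at this
    nlinarith [sq_nonneg y]
  · have h1 : ‖Complex.exp (Complex.I * y)‖ = 1 := by simp [Complex.norm_exp]
    have h2 := norm_sub_le (Complex.exp (Complex.I * y) - 1) (Complex.I * y)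
    have h3 := norm_sub_le (Complex.exp (Complex.I * y)) 1
    rw [hn] at h2
    rw [h1, norm_one] at h3
    rw [← sq_abs]
    nlinarith

theorem abs_dispersion_le {s : ℝ} (hs : 0 ≤ s) (x : ℝ) : |dispersion s x| ≤ |x| := by
  have h0 : 0 ≤ besselSymbol s x := by unfold besselSymbol; positivity
  have h1 : besselSymbol s x ≤ 1 := by
    rw [besselSymbol_eq]
    exact Real.rpow_le_one_of_one_le_of_nonpos (by nlinarith [sq_nonneg x]) (by linarith)
  rw [dispersion, abs_mul, abs_of_nonneg h0]
  exact mul_le_of_le_one_left (abs_nonneg x) h1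

theorem coeFn_toLp_fourier (θ : 𝓢(ℝ, ℂ)) :
    (𝓕 θ : 𝓢(ℝ, ℂ)).toLp 2 volume =ᵐ[volume] (𝓕 θ : 𝓢(ℝ, ℂ)) :=
  SchwartzMap.coeFn_toLp _ _ _

/-- By Plancherel the remainder at frequency η is at most 3(x-r)²p²|θ̂|, and |p(ξ)| ≤ |ξ| bounds
this by 3(x-r)²(2πη)²|θ̂|, which is square integrable for Schwartz θ. -/
theorem hasDerivAt_schwartzFlow_toLp {s : ℝ} (hs : 0 ≤ s) (θ : 𝓢(ℝ, ℂ)) (r : ℝ) :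
    HasDerivAt (fun r => (schwartzFlow s r θ).toLp 2 volume)
      ((besselOp s (SchwartzMap.derivCLM ℂ ℂ (schwartzFlow s r θ))).toLp 2 volume) r := by
  rw [hasDerivAt_iff_isLittleO]
  refine Asymptotics.IsBigO.trans_isLittleO (g := fun x => ‖x - r‖ ^ 2) ?_
    (Asymptotics.isLittleO_pow_sub_sub r one_lt_two)
  -- Q = -(2πη)²θ̂ is the majorant of the second-order remainder.
  set Q : 𝓢(ℝ, ℂ) := freqMul (freqMul (𝓕 θ)) with hQ
  refine Asymptotics.IsBigO.of_bound (3 * ‖Q.toLp 2 volume‖) (Eventually.of_forall fun x => ?_)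
  set R : 𝓢(ℝ, ℂ) := schwartzFlow s x θ - schwartzFlow s r θ -
    ((x - r : ℝ) : ℂ) • besselOp s (SchwartzMap.derivCLM ℂ ℂ (schwartzFlow s r θ)) with hR
  have e : (schwartzFlow s x θ).toLp 2 volume - (schwartzFlow s r θ).toLp 2 volume -
      (x - r) • (besselOp s (SchwartzMap.derivCLM ℂ ℂ (schwartzFlow s r θ))).toLp 2 volume =
      R.toLp 2 volume := by
    simp only [← SchwartzMap.toLpCLM_apply (𝕜 := ℂ), hR, map_sub, map_smul]
    rfl
  rw [e, ← SchwartzMap.norm_fourier_toL2_eq, norm_pow, norm_norm, mul_right_comm]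
  refine Lp.norm_le_mul_norm_of_ae_le_mul ?_
  filter_upwards [coeFn_toLp_fourier R, Q.coeFn_toLp 2 volume] with η h1 h2
  rw [h1, h2, hQ, freqMul_apply, freqMul_apply]
  have h3 : (𝓕 R : 𝓢(ℝ, ℂ)) η =
      (Complex.exp (Complex.I * ((x * dispersion s (2 * Real.pi * η) : ℝ) : ℂ)) -
        Complex.exp (Complex.I * ((r * dispersion s (2 * Real.pi * η) : ℝ) : ℂ)) -
        ((x - r : ℝ) : ℂ) * (Complex.I * (dispersion s (2 * Real.pi * η) : ℝ) *
          Complex.exp (Complex.I * ((r * dispersion s (2 * Real.pi * η) : ℝ) : ℂ)))) *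
      (𝓕 θ : 𝓢(ℝ, ℂ)) η := by
    rw [hR]
    simp only [← FourierTransform.fourierCLM_apply (R := ℂ), map_sub, map_smul]
    simp only [FourierTransform.fourierCLM_apply, sub_apply, smul_apply, fourier_schwartzFlow, fourier_besselOp_derivCLM, smul_eq_mul]
    ring
  set a := dispersion s (2 * Real.pi * η) with ha
  have h4 : Complex.exp (Complex.I * ((x * a : ℝ) : ℂ)) -
        Complex.exp (Complex.I * ((r * a : ℝ) : ℂ)) -
        ((x - r : ℝ) : ℂ) * (Complex.I * (a : ℝ) * Complex.exp (Complex.I * ((r * a : ℝ) : ℂ))) =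
      Complex.exp (Complex.I * ((r * a : ℝ) : ℂ)) *
        (Complex.exp (Complex.I * (((x - r) * a : ℝ) : ℂ)) - 1 -
          Complex.I * (((x - r) * a : ℝ) : ℂ)) := by
    have : Complex.exp (Complex.I * ((x * a : ℝ) : ℂ)) =
        Complex.exp (Complex.I * ((r * a : ℝ) : ℂ)) *
          Complex.exp (Complex.I * (((x - r) * a : ℝ) : ℂ)) := by
      rw [← Complex.exp_add]; congr 1; push_cast; ring
    rw [this]; push_cast; ring
  rw [h3, h4, norm_mul, norm_mul, IsPhase.norm_exp, one_mul]
  have h5 := norm_exp_I_mul_sub_le ((x - r) * a)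
  have h6 : a ^ 2 ≤ (2 * Real.pi * η) ^ 2 := sq_le_sq.2 (abs_dispersion_le hs _)
  have h7 : ‖-(2 * Real.pi * Complex.I) * η * (-(2 * Real.pi * Complex.I) * η *
      (𝓕 θ : 𝓢(ℝ, ℂ)) η)‖ = (2 * Real.pi * η) ^ 2 * ‖(𝓕 θ : 𝓢(ℝ, ℂ)) η‖ := by
    rw [← mul_assoc, norm_mul, ← sq, norm_pow]
    rw [← sq_abs (2 * Real.pi * η)]
    congr 2
    simp [abs_mul]
  rw [h7, Real.norm_eq_abs, sq_abs]
  calc _ ≤ 3 * ((x - r) * a) ^ 2 * ‖(𝓕 θ : 𝓢(ℝ, ℂ)) η‖ := by gcongr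
    _ = 3 * (x - r) ^ 2 * (a ^ 2 * ‖(𝓕 θ : 𝓢(ℝ, ℂ)) η‖) := by ring
    _ ≤ _ := by gcongr

/-- The complexification of a real `L²` function. -/
def complexify : Lp ℝ 2 (volume : Measure ℝ) →L[ℝ] Lp ℂ 2 (volume : Measure ℝ) :=
  Complex.ofRealCLM.compLpL 2 volume

theorem coeFn_complexify (v : Lp ℝ 2 (volume : Measure ℝ)) :
    complexify v =ᵐ[volume] fun x => ((v x : ℝ) : ℂ) := ContinuousLinearMap.coeFn_compLpL _ _

theorem inner_complexify (v : Lp ℝ 2 (volume : Measure ℝ)) (θ : 𝓢(ℝ, ℂ)) :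
    inner ℂ (complexify v) (θ.toLp 2 volume) = ∫ x, ((v x : ℝ) : ℂ) * θ x := by
  rw [L2.inner_def]
  refine integral_congr_ae ?_
  filter_upwards [coeFn_complexify v, θ.coeFn_toLp 2 volume] with x h1 h2
  rw [h1, h2]
  simp [mul_comm]

/-- A product rule in which V is continuous but differentiable only after pairing with the fixed
vector W(τ). The slope splits as that of ⟨V, W(τ)⟩ plus ⟨V(r), slope of W⟩, and the second term
converges because V is continuous. -/
theorem hasDerivWithinAt_inner_of_continuousWithinAt {E : Type*} [NormedAddCommGroup E]
    [InnerProductSpace ℂ E] {V W : ℝ → E} {W' : E} {d : ℂ} {S : Set ℝ} {τ : ℝ}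
    (hV : ContinuousWithinAt V S τ) (hW : HasDerivWithinAt W W' S τ)
    (hd : HasDerivWithinAt (fun r => inner ℂ (V r) (W τ)) d S τ) :
    HasDerivWithinAt (fun r => inner ℂ (V r) (W r)) (d + inner ℂ (V τ) W') S τ := by
  rw [hasDerivWithinAt_iff_tendsto_slope] at *
  have h1 : Tendsto V (𝓝[S \ {τ}] τ) (𝓝 (V τ)) := hV.mono_left (nhdsWithin_mono _ sdiff_subset)
  refine (hd.add (h1.inner hW)).congr fun r => ?_
  simp only [slope, vsub_eq_sub, inner_smul_right_eq_smul, inner_sub_right]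
  rw [← smul_add]
  congr 1
  ring

end

/-! ### Weak solutions and their decay. -/

noncomputable section

/-- Pairing a weak solution with the backward flow of a Schwartz function is conserved. -/
theorem IsLinearSolution.integral_mul_eq {σ s : ℝ} (hs : 0 ≤ s) {u₀ : ℝ → ℝ}
    {u : ℝ → Lp ℝ 2 (volume : Measure ℝ)} (h : IsLinearSolution σ s u₀ u) {T : ℝ} (hT : 0 ≤ T)
    (θ : 𝓢(ℝ, ℂ)) :
    ∫ x, ((u T x : ℝ) : ℂ) * θ x = ∫ x, ((u₀ x : ℝ) : ℂ) * schwartzFlow s (σ * T) θ x := by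
  -- The test function solves the equation backwards from θ at time T. The derivative falling on W
  -- cancels the one given by the weak formulation.
  set W : ℝ → Lp ℂ 2 (volume : Measure ℝ) :=
    fun τ => (schwartzFlow s (σ * (T - τ)) θ).toLp 2 volume with hW_def
  have hV : ContinuousOn (fun τ => complexify (u τ)) (Ici 0) :=
    complexify.continuous.comp_continuousOn h.continuousOn
  have hderiv : ∀ τ, 0 ≤ τ →
      HasDerivWithinAt (fun τ => inner ℂ (complexify (u τ)) (W τ)) 0 (Ici 0) τ := by
    intro τ hτ
    set D := besselOp s (SchwartzMap.derivCLM ℂ ℂ (schwartzFlow s (σ * (T - τ)) θ)) with hD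
    have hin : HasDerivAt (fun τ => σ * (T - τ)) (-σ) τ := by
      simpa using ((hasDerivAt_id τ).const_sub T).const_mul σ
    have hW : HasDerivAt W ((-σ) • D.toLp 2 volume) τ :=
      HasDerivAt.scomp (g₁ := fun r => (schwartzFlow s r θ).toLp 2 volume) τ
        (hasDerivAt_schwartzFlow_toLp hs θ (σ * (T - τ))) hin
    have hd := h.weak (schwartzFlow s (σ * (T - τ)) θ) τ hτ
    simp only [← inner_complexify] at hd
    have := hasDerivWithinAt_inner_of_continuousWithinAt (hV τ hτ) hW.hasDerivWithinAt hd
    convert! this using 1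
    rw [inner_smul_right_eq_smul, Complex.real_smul]
    push_cast
    ring
  have hconst := constant_of_has_deriv_right_zero (a := 0) (b := T)
    (f := fun τ => inner ℂ (complexify (u τ)) (W τ))
    (fun τ hτ => ((hderiv τ hτ.1).continuousWithinAt).mono Icc_subset_Ici_self)
    (fun τ hτ => (hderiv τ hτ.1).mono (Ici_subset_Ici.2 hτ.1)) T (right_mem_Icc.2 hT)
  simp only [hW_def, inner_complexify, sub_self, mul_zero, schwartzFlow_zero, sub_zero] at hconst
  rw [hconst]
  refine integral_congr_ae ?_
  filter_upwards [h.initial] with x hx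
  rw [hx]

/-- The multiplication formula ∫ 𝓕f·g = ∫ f·𝓕g is used twice: once to reach the frequency side,
where the flow is multiplication by an exponential, and once to come back. The pairing is bilinear,
hence the reflection y ↦ -y. -/
theorem integral_mul_schwartzFlow {s r : ℝ} {g : ℝ → ℂ} (hg : Integrable g volume)
    (hG : Integrable (𝓕 g) volume) (θ : 𝓢(ℝ, ℂ)) :
    ∫ x, g x * schwartzFlow s r θ x = ∫ x, θ x * 𝓕 (fun y => 𝓕 g (-y) *
      Complex.exp (Complex.I * ((r * dispersion s (2 * Real.pi * y) : ℝ) : ℂ))) x := by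
  set F : 𝓢(ℝ, ℂ) := 𝓕 (schwartzFlow s r θ) with hF
  set G : ℝ → ℂ := fun y => 𝓕 g (-y) *
      Complex.exp (Complex.I * ((r * dispersion s (2 * Real.pi * y) : ℝ) : ℂ)) with hG_def
  have hGi : Integrable G volume := by
    have hc : Continuous fun y : ℝ =>
        Complex.exp (Complex.I * ((r * dispersion s (2 * Real.pi * y) : ℝ) : ℂ)) :=
      (hasTemperateGrowth_flowSymbol s r).1.continuous
    refine hG.comp_neg.mono (hG.comp_neg.1.mul hc.aestronglyMeasurable)
      (Eventually.of_forall fun y => ?_)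
    rw [norm_mul, IsPhase.norm_exp, mul_one]
  have h1 : ∀ x, schwartzFlow s r θ x = 𝓕 F (-x) := fun x => by
    rw [SchwartzMap.fourier_coe, ← Real.fourierInv_eq_fourier_neg, ← SchwartzMap.fourierInv_coe, hF,
      FourierTransform.fourierInv_fourier_eq]
  have h2 : ∀ y, F y = Complex.exp (Complex.I * ((r * dispersion s (2 * Real.pi * y) : ℝ) : ℂ)) *
      𝓕 θ y := fun y => by rw [hF, fourier_schwartzFlow]
  have h3 : ∀ y, 𝓕 (fun x => g (-x)) y = 𝓕 g (-y) := fun y => by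
    rw [← Real.fourierInv_eq_fourier_neg, Real.fourierInv_eq_fourier_comp_neg]
  calc ∫ x, g x * schwartzFlow s r θ x = ∫ x, g (-x) * 𝓕 F x := by
        simp only [h1]
        rw [← integral_neg_eq_self]
        simp
    _ = ∫ y, 𝓕 (fun x => g (-x)) y * F y :=
        (integral_fourier_mul_eq hg.comp_neg F.integrable).symm
    _ = ∫ y, 𝓕 θ y * G y := by
        congr 1; ext y
        rw [h3, h2, hG_def]; ring
    _ = _ := integral_fourier_mul_eq θ.integrable hGi

/-- Substitute ξ = -2πy; as the dispersion is odd, the flow carried by the test function becomes the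
inverse flow -r on g. -/
theorem fourier_propagated_eq (s r : ℝ) (g : ℝ → ℝ) (x : ℝ) :
    𝓕 (fun y => 𝓕 (fun x : ℝ => (g x : ℂ)) (-y) *
      Complex.exp (Complex.I * ((r * dispersion s (2 * Real.pi * y) : ℝ) : ℂ))) x =
    (fourierConst : ℂ) * ∫ ξ, Complex.exp (Complex.I * ((-r * dispersion s ξ + x * ξ : ℝ) : ℂ)) *
      hatFT g ξ := by
  have hπ : (-(2 * Real.pi)) ≠ 0 := neg_ne_zero.2 (by positivity)
  have hc : (fourierConst : ℂ) * fourierConst = ((2 * Real.pi)⁻¹ : ℝ) := by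
    rw [← fourierConst_sq]; push_cast; ring
  have hc0 : (fourierConst : ℂ) ≠ 0 := by exact_mod_cast fourierConst_pos.ne'
  have h1 := Measure.integral_comp_mul_left (fun ξ =>
    Complex.exp (Complex.I * ((-r * dispersion s ξ + x * ξ : ℝ) : ℂ)) * hatFT g ξ) (-(2 * Real.pi))
  rw [abs_inv, abs_neg, abs_of_pos (by positivity), Complex.real_smul, ← hc, mul_assoc] at h1
  refine mul_left_cancel₀ hc0 ?_
  rw [← h1, Real.fourier_real_eq_integral_exp_smul, ← integral_const_mul]
  congr 1
  ext y
  have e1 : -(2 * Real.pi) * y / (2 * Real.pi) = -y := by field_simp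
  rw [hatFT_eq, e1, neg_mul (2 * Real.pi) y, dispersion_neg]
  have e2 : Complex.exp (Complex.I * ((-r * -dispersion s (2 * Real.pi * y) +
      x * -(2 * Real.pi * y) : ℝ) : ℂ)) =
      Complex.exp (((-2 * Real.pi * y * x : ℝ) : ℂ) * Complex.I) *
      Complex.exp (Complex.I * ((r * dispersion s (2 * Real.pi * y) : ℝ) : ℂ)) := by
    rw [← Complex.exp_add]
    congr 1
    push_cast; ring
  rw [e2, smul_eq_mul]
  ring

theorem eLpNorm_hatFT_le (g : ℝ → ℝ) : eLpNorm (hatFT g) ∞ volume ≤ eLpNorm g 1 volume := by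
  rw [eLpNorm_exponent_top]
  refine essSup_le_of_ae_le _ (Eventually.of_forall fun ξ => ?_)
  have h1 : ‖hatFT g ξ‖ₑ ≤
      ‖∫ x : ℝ, Complex.exp (-(Complex.I * x * ξ)) * (g x : ℂ)‖ₑ := by
    rw [← ofReal_norm, ← ofReal_norm]
    exact ENNReal.ofReal_le_ofReal (norm_fourierConst_mul_le _)
  refine h1.trans ((enorm_integral_le_lintegral_enorm _).trans (le_of_eq ?_))
  rw [eLpNorm_one_eq_lintegral_enorm]
  congr 1
  ext x
  have : -(Complex.I * x * ξ) = Complex.I * ((-(x * ξ) : ℝ) : ℂ) := by push_cast; ring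
  rw [enorm_mul, this, ← ofReal_norm, IsPhase.norm_exp, ENNReal.ofReal_one, one_mul,
    ← ofReal_norm, ← ofReal_norm, Complex.norm_real]

/-- For σ = 1, conjugating the integral changes t, x into the phase already treated with -x in place
of x; the class of amplitudes is stable under conjugation. -/
theorem exists_norm_integral_dispersion_sign_le {s N : ℝ} (hs : 0 < s) (hs1 : s ≠ 1)
    (hsN : s < N) :
    ∃ C : ℝ, 0 < C ∧ ∀ σ : ℝ, (σ = 1 ∨ σ = -1) → ∀ t : ℝ, 1 ≤ t → ∀ (x A : ℝ) (f f' : ℝ → ℂ),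
      AmplitudeBound N A (A * t ^ (1 / 6 : ℝ)) f f' →
      ‖∫ ξ, Complex.exp (Complex.I * ((-(σ * t) * dispersion s ξ + x * ξ : ℝ) : ℂ)) * f ξ‖ ≤
        C * A * t ^ (-(1 / 3) : ℝ) := by
  obtain ⟨C, hC, h⟩ := exists_norm_integral_dispersion_le hs hs1 hsN
  refine ⟨C, hC, fun σ hσ t ht x A f f' hf => ?_⟩
  rcases hσ with rfl | rfl
  · refine le_trans (le_of_eq ?_) (h t ht (-x) A _ _ hf.conj)
    rw [← Complex.norm_conj, ← integral_conj]
    refine congrArg norm (integral_congr_ae (Eventually.of_forall fun ξ => ?_))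
    simp only [map_mul, ← Complex.exp_conj, Complex.conj_I, Complex.conj_ofReal]
    congr 2
    push_cast
    ring
  · simpa using h t ht x A f f' hf

theorem exists_eLpNorm_linearSolution_le {s : ℝ} (hs : 0 < s) (hs1 : s ≠ 1) :
    ∃ C : ℝ, 0 < C ∧ ∀ σ : ℝ, (σ = 1 ∨ σ = -1) →
      ∀ (u₀ : ℝ → ℝ) (u : ℝ → Lp ℝ 2 (volume : Measure ℝ)), IsLinearSolution σ s u₀ u →
        ∀ t : ℝ, 1 ≤ t →
          eLpNorm (u t) ∞ volume ≤
            ENNReal.ofReal (C * t ^ (-(1 : ℝ) / 3)) *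
              (eLpNorm u₀ 1 volume +
                ENNReal.ofReal (t ^ (-(1 : ℝ) / 6)) *
                  (weightedNorm u₀ + sobolevNorm (sobolevIndex s : ℝ) u₀)) := by
  obtain ⟨C, hC, hb⟩ := exists_norm_integral_dispersion_sign_le hs hs1 (lt_sobolevIndex s)
  refine ⟨C * 3, by positivity, fun σ hσ u₀ u hu t ht => ?_⟩
  have ht0 : 0 < t := by linarith
  set X : ℝ≥0∞ := eLpNorm u₀ 1 volume + ENNReal.ofReal (t ^ (-(1 : ℝ) / 6)) *
    (weightedNorm u₀ + sobolevNorm (sobolevIndex s : ℝ) u₀) with hX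
  -- An infinite right side is trivial. Otherwise X itself takes the role of A, so no normalization
  -- of u₀ is needed.
  by_cases hXt : X = ⊤
  · rw [hXt, ENNReal.mul_top (by simpa using by positivity)]
    exact le_top
  have hXr : ENNReal.ofReal X.toReal = X := ENNReal.ofReal_toReal hXt
  obtain ⟨hint, f', hf⟩ := exists_amplitudeBound_of_norms_le (s := s) (A := X.toReal) (g := u₀) ht
    ENNReal.toReal_nonneg (by rw [hXr]; exact le_add_self)
    (by rw [hXr]; exact (eLpNorm_hatFT_le u₀).trans le_self_add)
  set P : ℝ → ℂ := 𝓕 (fun y => 𝓕 (fun x : ℝ => (u₀ x : ℂ)) (-y) *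
    Complex.exp (Complex.I * ((σ * t * dispersion s (2 * Real.pi * y) : ℝ) : ℂ))) with hP
  have hPb : ∀ x, ‖P x‖ ≤ C * (3 * X.toReal) * t ^ (-(1 / 3) : ℝ) := fun x => by
    rw [hP, fourier_propagated_eq]
    exact (norm_fourierConst_mul_le _).trans (hb σ hσ t ht x _ _ _ hf)
  have hFi : Integrable (𝓕 (fun x : ℝ => (u₀ x : ℂ))) volume := by
    have h2 : (fun ξ => (fourierConst : ℂ)⁻¹ * hatFT u₀ (2 * Real.pi * ξ)) =
        𝓕 (fun x : ℝ => (u₀ x : ℂ)) := by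
      ext ξ
      have hc0 : (fourierConst : ℂ) ≠ 0 := by exact_mod_cast fourierConst_pos.ne'
      rw [hatFT_eq, mul_div_cancel_left₀ _ (by positivity), inv_mul_cancel_left₀ hc0]
    rw [← h2]
    exact (hf.integrable.comp_mul_left' (by positivity)).const_mul _
  have hPc : Continuous P := continuous_fourier_of_integrable <| by
    refine hFi.comp_neg.mono (hFi.comp_neg.1.mul
      (hasTemperateGrowth_flowSymbol s (σ * t)).1.continuous.aestronglyMeasurable)
      (Eventually.of_forall fun y => ?_)
    rw [norm_mul, IsPhase.norm_exp, mul_one]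
  -- Conservation of the pairing and the formula for the flow give u(t) and P the same integrals
  -- against all Schwartz functions.
  have hae : (fun x => ((u t x : ℝ) : ℂ)) =ᵐ[volume] P := by
    refine ae_eq_of_integral_schwartz_mul_eq ?_ hPc.locallyIntegrable fun ψ => ?_
    · exact ((Lp.memLp (u t)).ofReal (K := ℂ)).locallyIntegrable (by norm_num)
    · rw [hP, ← integral_mul_schwartzFlow hint hFi, ← hu.integral_mul_eq hs.le ht0.le]
      simp only [mul_comm]
  have hbd : ∀ᵐ x, ‖u t x‖ ≤ C * (3 * X.toReal) * t ^ (-(1 / 3) : ℝ) := by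
    filter_upwards [hae] with x hx
    rw [← Complex.norm_real, hx]
    exact hPb x
  rw [eLpNorm_exponent_top, ← hXr, ← ENNReal.ofReal_mul (by positivity), neg_div]
  refine (eLpNormEssSup_le_of_ae_bound hbd).trans (ENNReal.ofReal_le_ofReal (le_of_eq ?_))
  ring

end

/-! ### The main theorem. -/

theorem mainTheorem5 (s : ℝ) (hs : 0 < s) (φ : ℝ → ℝ) (hφ : IsCutoff φ) :
    -- the splitting of the propagator into absolutely convergent integrals
    (∀ t : ℝ, 1 ≤ t → ∀ g : ℝ → ℝ, SmallProfile s t g →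
      Integrable (hatFT g) volume ∧
      ∀ x : ℝ, propagator s t g x = lowInt φ s t x g + highInt φ s t x g) ∧
    -- the low-frequency estimate
    (s < 1 + 3 * 2 ^ 18 →
      ∃ C : ℝ, 0 < C ∧ ∀ t : ℝ, 1 ≤ t → ∀ x : ℝ, ∀ g : ℝ → ℝ, SmallProfile s t g →
        ‖lowInt φ s t x g‖ ≤
          C * t ^ (-(1 : ℝ) / 3) *
            japBracket ((x + t) / t ^ ((1 : ℝ) / 3)) ^ (-(1 : ℝ) / 4)) ∧
    -- the high-frequency estimate
    (s ≠ 1 →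
      ∃ C : ℝ, 0 < C ∧ ∀ t : ℝ, 1 ≤ t → ∀ x : ℝ, ∀ g : ℝ → ℝ, SmallProfile s t g →
        ‖highInt φ s t x g‖ ≤ C * t ^ (-(1 : ℝ) / 3)) ∧
    -- decay of the solutions of the linear equation, for either sign of the dispersive term
    (s ≠ 1 →
      ∃ C : ℝ, 0 < C ∧ ∀ σ : ℝ, (σ = 1 ∨ σ = -1) →
        ∀ (u₀ : ℝ → ℝ) (u : ℝ → Lp ℝ 2 (volume : Measure ℝ)), IsLinearSolution σ s u₀ u →
          ∀ t : ℝ, 1 ≤ t →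
            eLpNorm (u t) ∞ volume ≤
              ENNReal.ofReal (C * t ^ (-(1 : ℝ) / 3)) *
                (eLpNorm u₀ 1 volume +
                  ENNReal.ofReal (t ^ (-(1 : ℝ) / 6)) *
                    (weightedNorm u₀ + sobolevNorm (sobolevIndex s : ℝ) u₀))) := by
  refine ⟨fun t ht g hg => ⟨?_, propagator_eq_lowInt_add_highInt hφ ht hg⟩,
    exists_norm_lowInt_le hφ hs, exists_norm_highInt_le hφ hs, ?_⟩
  · obtain ⟨_, h⟩ := hg.exists_amplitudeBound ht
    exact h.integrable
  · exact exists_eLpNorm_linearSolution_le hs
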